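/- Let $p\in[0,1]$, $\beta\in[0,\tfrac12)$, $t\ge 1$, and for $n=2^m$ let $\delta_n=2^{-n^\beta}$. Let $V$ be a row of $n$ i.i.d. Bernoulli$(p)$ bits and $A=VG_n$, where $G_n=P_n\begin{bmatrix}1&0\\1&1\end{bmatrix}^{\otimes m}$ over $\mathbb F_2$ and $P_n$ is the bit-reversal matrix. Put $\mathcal H=\{j: H(A_j\mid A_1,\dots,A_{j-1})>1-\delta_n\}$, $\mathcal U=\{j: H(A_j\mid A_1,\dots,A_{j-1})<\delta_n\}$, $\mathcal J=(\mathcal U\cup\mathcal H)^c$ (entropies in bits) and $\tilde n=|\mathcal H|+|\mathcal J|$. The NU-HUNCC scheme for $\ell$ noiseless links: the $\ell$ source rows are independent copies of $V$, collected in $V_{\mathcal L}\in\mathbb F_2^{\ell\times n}$. Row $i$ is compressed to $M_i=[A_i[\mathcal H],\,A_i[\mathcal J]\oplus U_i]\in\mathbb F_2^{\tilde n}$, where distinct bits of an independent uniform seed row of $d\ge|\mathcal J|$ bits, shared with the receiver and not observed by the eavesdropper, pad the bits in $\mathcal J$. Each of the $\tilde n$ columns of $M$ is encoded with one binning codebook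 of $2^{k_s}$ bins with $2^{k_w}$ codewords of length $\ell$ each, $k_s+k_w=\ell$: the first $k_s$ bits of the column choose the bin and the other $k_w$ bits the codeword in it. Row $i$ of the encoded matrix $X$ is sent over link $i$. The receiver decodes each column (it fails if the received codeword appears more than once in the codebook), removes the pad, recovers the bits in $\mathcal U$ by successive cancellation, and inverts $G_n$; let $P_e$ be the probability that it does not recover $V_{\mathcal L}$. An eavesdropper who sees the links in $\mathcal W$ observes $Z_{\mathcal W}$, the rows of $X$ in $\mathcal W$. Let $\mathbb V(P,Q)=\sum_z|P(z)-Q(z)|$. There is an absolute constant $C$ such that for all such $p,\beta,t$ and every sequence $\ell=\ell(n)$ with $\ell=\omega(\tilde n^{2/t})$ and $\ell=o(2^{n^\beta}/\tilde n)$ (that is, $\ell\tilde n=o(2^{n^\beta})$), and for all $\epsilon_e,\epsilon_s>0$, the following holds for all sufficiently large $n=2^m$. For all $w<\ell$ and all $k_s\le \ell-w-\ell\epsilon$, where $\ell\epsilon=\lceil t\log_2\ell\rceil$, there is a binning codebook such that, for every seed length $d\ge|\mathcal J|$, $$P_e\le \tilde n\,C\,2^{-\ell}+\sqrt{2\tilde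 n\ell 2^{-n^\beta}}+\ell 2^{-n^\beta}\quad\text{and}\quad P_e\le\epsilon_e,$$ and, for every set $\mathcal W$ of $w$ links, every set $\mathcal K_s$ of $k_s$ messages and every value $v$ of $V_{\mathcal K_s}$ of positive probability, $$\mathbb V\big(p_{Z_{\mathcal W}\mid V_{\mathcal K_s}=v},\,p_{Z_{\mathcal W}}\big)\le \tilde n\,\ell^{-t/2}+2\sqrt{2\tilde n\ell 2^{-n^\beta}}\quad\text{and}\quad \mathbb V\big(p_{Z_{\mathcal W}\mid V_{\mathcal K_s}=v},\,p_{Z_{\mathcal W}}\big)\le\epsilon_s.$$ -/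

import Mathlib

open Filter Topology Asymptotics

noncomputable section

namespace NUHUNCC

/-! ### Finite probability -/

/-- Law of the random variable `X` on the finite probability space with weights `μ`. -/
def law {Ω α : Type*} [Fintype Ω] [DecidableEq α] (μ : Ω → ℝ) (X : Ω → α) (a : α) : ℝ :=
  ∑ ω ∈ Finset.univ.filter (fun ω => X ω = a), μ ω

/-- Conditional law `a ↦ P(X = a | Y = b)`; meaningful when `P(Y = b) > 0`. -/
def condLaw {Ω α γ : Type*} [Fintype Ω] [DecidableEq α] [DecidableEq γ]
    (μ : Ω → ℝ) (X : Ω → α) (Y : Ω → γ) (b : γ) (a : α) : ℝ :=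
  law μ (fun ω => (X ω, Y ω)) (a, b) / law μ Y b

/-- Conditional Shannon entropy `H(X | Y)` in bits. -/
def condEntropy {Ω α γ : Type*} [Fintype Ω] [Fintype α] [Fintype γ]
    [DecidableEq α] [DecidableEq γ] (μ : Ω → ℝ) (X : Ω → α) (Y : Ω → γ) : ℝ :=
  ∑ b, law μ Y b * ∑ a, Real.negMulLog (condLaw μ X Y b a) / Real.log 2

/-- Non-normalized variational distance. -/
def varDist {α : Type*} [Fintype α] (P Q : α → ℝ) : ℝ := ∑ a, |P a - Q a|

/-! ### The source and the polarization transform -/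

/-- Bernoulli law on one bit, `P(1) = p`. -/
def bern (p : ℝ) (b : ZMod 2) : ℝ := if b = 1 then p else 1 - p

/-- Law of `n` independent bits of the memoryless source. -/
def srcWeight (p : ℝ) {n : ℕ} (v : Fin n → ZMod 2) : ℝ := ∏ j, bern p (v j)

def arikanKernel : Matrix (Fin 2) (Fin 2) (ZMod 2) := !![1, 0; 1, 1]

/-- The `m`-fold Kronecker power of the `2 × 2` kernel. -/
def kronPow : (m : ℕ) → Matrix (Fin (2 ^ m)) (Fin (2 ^ m)) (ZMod 2)
  | 0 => 1
  | m + 1 =>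
    let e : Fin 2 × Fin (2 ^ m) ≃ Fin (2 ^ (m + 1)) :=
      finProdFinEquiv.trans (finCongr (pow_succ' 2 m).symm)
    Matrix.reindex e e (Matrix.kroneckerMap (fun a b => a * b) arikanKernel (kronPow m))

/-- Reversal of the `m` binary digits of an index. -/
def bitReversal (m : ℕ) : Equiv.Perm (Fin (2 ^ m)) :=
  (finFunctionFinEquiv (m := 2) (n := m)).symm.trans
    ((Equiv.arrowCongr Fin.revPerm (Equiv.refl (Fin 2))).trans finFunctionFinEquiv)

/-- `G_n`: bit reversal matrix times Kronecker power, `n = 2 ^ m`. -/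
def polarMatrix (m : ℕ) : Matrix (Fin (2 ^ m)) (Fin (2 ^ m)) (ZMod 2) :=
  (bitReversal m).permMatrix (ZMod 2) * kronPow m

/-- The polarized row `A = v G_n`. -/
def polarize {m : ℕ} (v : Fin (2 ^ m) → ZMod 2) : Fin (2 ^ m) → ZMod 2 :=
  Matrix.vecMul v (polarMatrix m)

/-- The prefix `(A_i)_{i < j}`. -/
def polarPrefix {m : ℕ} (j : Fin (2 ^ m)) (v : Fin (2 ^ m) → ZMod 2) :
    {i : Fin (2 ^ m) // i < j} → ZMod 2 :=
  fun i => polarize v i.1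

/-- `H(A_j | A_i, i < j)` for a source row of `2 ^ m` bits. -/
def polarEntropy (p : ℝ) (m : ℕ) (j : Fin (2 ^ m)) : ℝ :=
  condEntropy (srcWeight p) (fun v : Fin (2 ^ m) → ZMod 2 => polarize v j) (polarPrefix j)

/-- `δ_n = 2 ^ (- n ^ β)` with `n = 2 ^ m`. -/
def delta (β : ℝ) (m : ℕ) : ℝ := (2 : ℝ) ^ (-(((2 : ℝ) ^ m) ^ β))

open Classical in
/-- Positions with entropy almost one. -/
def highSet (p β : ℝ) (m : ℕ) : Finset (Fin (2 ^ m)) :=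
  Finset.univ.filter (fun j => 1 - delta β m < polarEntropy p m j)

open Classical in
/-- Positions with entropy almost zero. -/
def lowSet (p β : ℝ) (m : ℕ) : Finset (Fin (2 ^ m)) :=
  Finset.univ.filter (fun j => polarEntropy p m j < delta β m)

/-- The unpolarized positions. -/
def midSet (p β : ℝ) (m : ℕ) : Finset (Fin (2 ^ m)) :=
  (lowSet p β m ∪ highSet p β m)ᶜ

/-- Positions of a compressed row: the high-entropy bits followed by the unpolarized bits. -/
abbrev MsgIdx (p β : ℝ) (m : ℕ) : Type := ↥(highSet p β m) ⊕ ↥(midSet p β m)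

/-- Length `ñ` of a compressed row. -/
def msgLen (p β : ℝ) (m : ℕ) : ℕ := (highSet p β m).card + (midSet p β m).card

/-! ### Source code -/

/-- Source encoder of one row. The seed has `d` bits, and the unpolarized position `j` is
one-time padded with the seed bit `σ j`; such a `σ` exists iff `d ≥ |midSet|`. -/
def srcEnc {p β : ℝ} {m d : ℕ} (σ : ↥(midSet p β m) ↪ Fin d)
    (v : Fin (2 ^ m) → ZMod 2) (u : Fin d → ZMod 2) : MsgIdx p β m → ZMod 2 :=
  Sum.elim (fun j => polarize v j.1) (fun j => polarize v j.1 + u (σ j))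

/-- The polarized bits that the decoder reads off a compressed row after removing the pad
(`0` is a placeholder at the positions of `lowSet`). -/
def unpad {p β : ℝ} {m d : ℕ} (σ : ↥(midSet p β m) ↪ Fin d)
    (x : MsgIdx p β m → ZMod 2) (u : Fin d → ZMod 2) (j : Fin (2 ^ m)) : ZMod 2 :=
  if h : j ∈ highSet p β m then x (Sum.inl ⟨j, h⟩)
  else if h : j ∈ midSet p β m then x (Sum.inr ⟨j, h⟩) + u (σ ⟨j, h⟩)
  else 0

open Classical in
/-- Successive cancellation: a bit of `lowSet` is decided by comparing the probabilities of its
two values given the bits decided before; the other bits are taken from `b`. -/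
def scBit (p β : ℝ) (m : ℕ) (b : Fin (2 ^ m) → ZMod 2) (j : Fin (2 ^ m)) : ZMod 2 :=
  if j ∈ lowSet p β m then
    let past : {i : Fin (2 ^ m) // i < j} → ZMod 2 := fun i => scBit p β m b i.1
    if law (srcWeight p) (fun v => (polarize v j, polarPrefix j v)) (0, past)
        < law (srcWeight p) (fun v => (polarize v j, polarPrefix j v)) (1, past)
    then 1 else 0
  else b j
termination_by j.val
decreasing_by exact i.2

/-- Source decoder of one row. -/
def srcDec {p β : ℝ} {m d : ℕ} (σ : ↥(midSet p β m) ↪ Fin d)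
    (x : MsgIdx p β m → ZMod 2) (u : Fin d → ZMod 2) : Fin (2 ^ m) → ZMod 2 :=
  Matrix.vecMul (scBit p β m (unpad σ x u)) (polarMatrix m)⁻¹

/-! ### Binning channel code, applied to every column -/

/-- A codebook with `2 ^ ks` bins of `2 ^ kw` codewords of length `ℓ`. -/
abbrev Codebook (ks kw ℓ : ℕ) : Type :=
  (Fin ks → ZMod 2) → (Fin kw → ZMod 2) → (Fin ℓ → ZMod 2)

/-- Column encoder: the first `ks` bits choose the bin, the other `kw` bits the codeword in it. -/
def chanEnc {ks kw ℓ : ℕ} (h : ks + kw = ℓ) (B : Codebook ks kw ℓ) (c : Fin ℓ → ZMod 2) :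
    Fin ℓ → ZMod 2 :=
  B (fun i => c (Fin.cast h (Fin.castAdd kw i))) (fun i => c (Fin.cast h (Fin.natAdd ks i)))

open Classical in
/-- Column decoder: the column whose codeword was received if that codeword appears only once
in the codebook, and a declared failure `none` otherwise. -/
def chanDec {ks kw ℓ : ℕ} (h : ks + kw = ℓ) (B : Codebook ks kw ℓ) (y : Fin ℓ → ZMod 2) :
    Option (Fin ℓ → ZMod 2) :=
  if hy : ∃! c, chanEnc h B c = y then some hy.choose else none

/-! ### The whole scheme -/

/-- Sample space: source matrix and seed matrix. -/
abbrev Sample (m ℓ d : ℕ) : Type :=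
  (Fin ℓ → Fin (2 ^ m) → ZMod 2) × (Fin ℓ → Fin d → ZMod 2)

/-- Independent rows of the source, and an independent uniform seed matrix. -/
def weight (p : ℝ) {m ℓ d : ℕ} (ω : Sample m ℓ d) : ℝ :=
  (∏ i, srcWeight p (ω.1 i)) * (1 / (Fintype.card (Fin ℓ → Fin d → ZMod 2) : ℝ))

/-- The transmitted matrix: rows are links. -/
def transmit {p β : ℝ} {m ℓ d ks kw : ℕ} (h : ks + kw = ℓ) (B : Codebook ks kw ℓ)
    (σ : ↥(midSet p β m) ↪ Fin d) (ω : Sample m ℓ d) : Fin ℓ → MsgIdx p β m → ZMod 2 :=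
  fun i j => chanEnc h B (fun i' => srcEnc σ (ω.1 i') (ω.2 i') j) i

open Classical in
/-- Decoder of the legitimate receiver, from all links and the shared seed. -/
def decode {p β : ℝ} {m ℓ d ks kw : ℕ} (h : ks + kw = ℓ) (B : Codebook ks kw ℓ)
    (σ : ↥(midSet p β m) ↪ Fin d) (y : Fin ℓ → MsgIdx p β m → ZMod 2)
    (u : Fin ℓ → Fin d → ZMod 2) : Option (Fin ℓ → Fin (2 ^ m) → ZMod 2) :=
  if hy : ∀ j, (chanDec h B (fun i => y i j)).isSome then
    some (fun i => srcDec σ (fun j => (chanDec h B (fun i' => y i' j)).get (hy j) i) (u i))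
  else none

/-- Probability that the receiver does not recover the source matrix. -/
def errProb {p β : ℝ} {m ℓ d ks kw : ℕ} (h : ks + kw = ℓ) (B : Codebook ks kw ℓ)
    (σ : ↥(midSet p β m) ↪ Fin d) : ℝ :=
  ∑ ω ∈ Finset.univ.filter
    (fun ω : Sample m ℓ d => decode h B σ (transmit h B σ ω) ω.2 ≠ some ω.1), weight p ω

/-- What the eavesdropper sees on the links in `W`. -/
def observe {p β : ℝ} {m ℓ d ks kw : ℕ} (h : ks + kw = ℓ) (B : Codebook ks kw ℓ)
    (σ : ↥(midSet p β m) ↪ Fin d) (W : Finset (Fin ℓ)) (ω : Sample m ℓ d) :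
    ↥W → MsgIdx p β m → ZMod 2 :=
  fun i => transmit h B σ ω i.1

/-- The source messages with index in `K`. -/
def secretPart {m ℓ : ℕ} (d : ℕ) (K : Finset (Fin ℓ)) (ω : Sample m ℓ d) :
    ↥K → Fin (2 ^ m) → ZMod 2 :=
  fun i => ω.1 i.1

/-- Variational distance between the law of the observation on `W` given that the messages
in `K` are `v`, and its unconditional law. -/
def leakage {p β : ℝ} {m ℓ d ks kw : ℕ} (h : ks + kw = ℓ) (B : Codebook ks kw ℓ)
    (σ : ↥(midSet p β m) ↪ Fin d) (W K : Finset (Fin ℓ))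
    (v : ↥K → Fin (2 ^ m) → ZMod 2) : ℝ :=
  varDist (condLaw (weight p) (observe h B σ W) (secretPart d K) v)
    (law (weight p) (observe h B σ W))

end NUHUNCC

end

/-! The codebook is chosen so that the column encoder is a bijection π of F_2^ℓ. Channel decoding
then never fails, C = 0 suffices, and only successive cancellation can err. On a low-entropy
position a decision from the true past errs with probability at most the conditional entropy, so P_e
≤ ℓnδ_n (`errProb_le`). The polar transform preserves entropy, hence ñ ≥ n(H(p) - δ_n)
(`bitEntropy_mul_le_msgLen`), and since ℓñδ_n tends to 0 this makes ℓnδ_n at most √(2ñℓδ_n) for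
large n. No rate of polarization enters.

For secrecy, the law of the observation given V_K = v is compared with the uniform law. By the chain
rule the bits in H of a row have relative entropy at most |H|δ_n bits to uniform bits, and the
padded bits are uniform and independent of them. Replacing the high-entropy bits of the rows outside
K by uniform ones thus costs √(2ñℓδ_n), by Pinsker. After that the columns are independent, each
uniform on a subcube with free coordinates outside K, or on the whole cube at padded positions. If
every subcube column, seen on W, has relative entropy at most κ/2^u to uniform, u = ℓε, then
additivity and Pinsker give √(2ñκ/2^u). This is at most ñℓ^(-t/2) once κ ≤ ñ/2, because 2^u ≥ ℓ^t.
The unconditional law only pays the replacement, since π preserves the uniform law (`leakage_le`).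

What remains is one bijection that extracts almost uniform bits on every W of size w from every
subcube of dimension w + u, with κ of order log²ℓ (`exists_perm_typeDiv_le`). By the method of
types, one choice of W and subcube fails with probability about exp(-2^w(κ - u - 2)). There are
2^O(ℓ) choices, so a uniform permutation works when ℓ ≤ 2^w. For smaller w there are too many
subcubes, and π instead translates each coset of a binary linear code by a random codeword. A large
distance puts the points of a subcube into different cosets, so their translations are independent;
a large dual distance makes the translations uniform on W; and only the syndrome of the base point
matters, which leaves 2^O(log²ℓ) cases.

Finally log ℓ ≤ n^β with β < 1/2 gives log²ℓ = o(n), which is the required κ ≤ ñ/2. The cases p ∈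
{0, 1}, where ñ = 0, and β = 0, where the hypotheses on ℓ conflict, are separate. -/

set_option linter.unusedSectionVars false

noncomputable section

namespace NUHUNCC

/-! ### Laws and variational distance -/

section Sums

variable {α : Type*} [Fintype α]

lemma varDist_triangle (P Q R : α → ℝ) : varDist P R ≤ varDist P Q + varDist Q R := by
  unfold varDist
  rw [← Finset.sum_add_distrib]
  exact Finset.sum_le_sum fun a _ => abs_sub_le _ _ _

lemma varDist_comm (P Q : α → ℝ) : varDist P Q = varDist Q P := by
  unfold varDist
  exact Finset.sum_congr rfl fun a _ => abs_sub_comm _ _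

lemma varDist_comp_equiv {α' : Type*} [Fintype α'] (e : α' ≃ α) (P Q : α → ℝ) :
    varDist (fun a => P (e a)) (fun a => Q (e a)) = varDist P Q :=
  Equiv.sum_comp e fun a => |P a - Q a|

variable {ι : Type*} [Fintype ι] [DecidableEq ι]

lemma sum_prod_pi (P : ι → α → ℝ) :
    ∑ x : ι → α, ∏ i, P i (x i) = ∏ i, ∑ a, P i a := by
  rw [Finset.prod_univ_sum, Fintype.piFinset_univ]

lemma sum_prod_pi_mul (P : ι → α → ℝ) (hP : ∀ i, ∑ a, P i a = 1) (j : ι)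
    (g : α → ℝ) : ∑ x : ι → α, (∏ i, P i (x i)) * g (x j) = ∑ a, P j a * g a := by
  have h1 : ∀ x : ι → α, (∏ i, P i (x i)) * g (x j)
      = ∏ i, P i (x i) * (if i = j then g (x i) else 1) := by
    intro x
    rw [Finset.prod_mul_distrib]
    congr 1
    rw [Finset.prod_ite_eq']
    simp
  simp_rw [h1]
  rw [sum_prod_pi (fun i a => P i a * (if i = j then g a else 1)),
    Finset.prod_eq_single j]
  · simp
  · intro i _ hi
    simp [hi, hP]
  · simp

end Sums

section Laws

variable {Ω γ : Type*} [Fintype Ω] [DecidableEq γ]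

lemma law_eq_sum_ite (μ : Ω → ℝ) (X : Ω → γ) (a : γ) :
    law μ X a = ∑ ω, if X ω = a then μ ω else 0 := by
  rw [law, Finset.sum_filter]

lemma law_nonneg {μ : Ω → ℝ} (hμ : ∀ ω, 0 ≤ μ ω) (X : Ω → γ) (a : γ) : 0 ≤ law μ X a :=
  Finset.sum_nonneg fun ω _ => hμ ω

/-- The law of `e ∘ X` for a bijection `e`. -/
lemma law_equiv_comp {α : Type*} [DecidableEq α] (μ : Ω → ℝ) (X : Ω → α) (e : α ≃ γ) (c : γ) :
    law μ (fun ω => e (X ω)) c = law μ X (e.symm c) := by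
  unfold law
  congr 1
  ext ω
  simp [Equiv.eq_symm_apply]

variable {α : Type*} [Fintype α] [DecidableEq α]

lemma sum_law_mul (μ : Ω → ℝ) (X : Ω → α) (g : α → ℝ) :
    ∑ a, law μ X a * g a = ∑ ω, μ ω * g (X ω) := by
  simp_rw [law_eq_sum_ite, Finset.sum_mul]
  rw [Finset.sum_comm]
  refine Finset.sum_congr rfl fun ω _ => ?_
  simp [ite_mul]

lemma sum_law (μ : Ω → ℝ) (X : Ω → α) : ∑ a, law μ X a = ∑ ω, μ ω := by
  simpa using sum_law_mul μ X (fun _ => 1)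

lemma law_law (μ : Ω → ℝ) (X : Ω → α) (f : α → γ) (c : γ) :
    law (law μ X) f c = law μ (fun ω => f (X ω)) c := by
  have := sum_law_mul μ X (fun a => if f a = c then 1 else 0)
  simp only [mul_ite, mul_one, mul_zero] at this
  rw [law_eq_sum_ite, law_eq_sum_ite, this]

lemma varDist_law_le (μ ν : Ω → ℝ) (X : Ω → α) :
    varDist (law μ X) (law ν X) ≤ varDist μ ν := by
  unfold varDist
  calc ∑ a, |law μ X a - law ν X a|
      ≤ ∑ a, law (fun ω => |μ ω - ν ω|) X a := by
        refine Finset.sum_le_sum fun a _ => ?_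
        unfold law
        rw [← Finset.sum_sub_distrib]
        exact Finset.abs_sum_le_sum_abs _ _
    _ = ∑ ω, |μ ω - ν ω| := sum_law _ _

lemma law_comp_equiv {Ω' : Type*} [Fintype Ω'] (e : Ω' ≃ Ω) (μ : Ω → ℝ) (X : Ω → γ) (c : γ) :
    law (fun ω => μ (e ω)) (fun ω => X (e ω)) c = law μ X c := by
  simp_rw [law, Finset.sum_filter]
  exact Equiv.sum_comp e fun ω => if X ω = c then μ ω else 0

/-- Independent coordinates are mapped to independent coordinates. -/
lemma law_prod_pi {ι : Type*} [Fintype ι] [DecidableEq ι] (μ : ι → Ω → ℝ) (X : ι → Ω → γ) (x : ι → γ) :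
    law (fun ω : ι → Ω => ∏ i, μ i (ω i)) (fun ω i => X i (ω i)) x
      = ∏ i, law (μ i) (X i) (x i) := by
  simp_rw [law_eq_sum_ite]
  rw [← sum_prod_pi (fun i ω => if X i ω = x i then μ i ω else 0)]
  refine Finset.sum_congr rfl fun ω _ => ?_
  split_ifs with h
  · refine Finset.prod_congr rfl fun i _ => ?_
    rw [if_pos (congrFun h i)]
  · obtain ⟨i, hi⟩ := Function.ne_iff.1 h
    exact (Finset.prod_eq_zero (Finset.mem_univ i) (if_neg hi)).symm

end Laws

/-! ### Relative entropy and Pinsker's inequality -/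

/-- Relative entropy in nats. -/
def kl {α : Type*} [Fintype α] (P Q : α → ℝ) : ℝ := ∑ a, P a * Real.log (P a / Q a)

/-- The derivative is log x + 1/x - 1 ≥ 0. Up to a factor 4 this function is the derivative of the
one in `three_mul_sub_one_sq_le`, and it vanishes at 1. -/
lemma monotoneOn_add_one_mul_log :
    MonotoneOn (fun x : ℝ => (x + 1) * Real.log x - 2 * (x - 1)) (Set.Ioi 0) := by
  have hd : ∀ x ∈ Set.Ioi (0 : ℝ), HasDerivAt (fun x : ℝ => (x + 1) * Real.log x - 2 * (x - 1))
      (1 * Real.log x + (x + 1) * x⁻¹ - 2 * 1) x := by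
    intro x hx
    have h := (((hasDerivAt_id x).add_const 1).mul (Real.hasDerivAt_log (ne_of_gt hx))).sub
      (((hasDerivAt_id x).sub_const 1).const_mul 2)
    exact h
  refine monotoneOn_of_deriv_nonneg (convex_Ioi 0)
    (fun x hx => (hd x hx).continuousAt.continuousWithinAt)
    (fun x hx => ?_) fun x hx => ?_
  · rw [interior_Ioi] at hx
    exact (hd x hx).differentiableAt.differentiableWithinAt
  · rw [interior_Ioi] at hx
    rw [(hd x hx).deriv]
    have := Real.one_sub_inv_le_log_of_pos hx
    have hx0 : x ≠ 0 := ne_of_gt hx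
    have : (x + 1) * x⁻¹ = 1 + x⁻¹ := by field_simp
    linarith

lemma hasDerivAt_pinsker_aux {x : ℝ} (hx : 0 < x) :
    HasDerivAt (fun x : ℝ => (2 * x + 4) * (x * Real.log x - x + 1) - 3 * (x - 1) ^ 2)
      (4 * ((x + 1) * Real.log x - 2 * (x - 1))) x := by
  have h1 : HasDerivAt (fun x : ℝ => x * Real.log x - x + 1) (Real.log x + 1 - 1) x :=
    ((Real.hasDerivAt_mul_log hx.ne').sub (hasDerivAt_id x)).add_const 1
  have h2 : HasDerivAt (fun x : ℝ => 2 * x + 4) (2 * 1) x :=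
    ((hasDerivAt_id x).const_mul 2).add_const 4
  have h3 : HasDerivAt (fun x : ℝ => 3 * (x - 1) ^ 2) (3 * (2 * (x - 1) ^ (2 - 1) * 1)) x :=
    (((hasDerivAt_id x).sub_const 1).pow 2).const_mul 3
  have h := (h2.mul h1).sub h3
  refine h.congr_deriv ?_
  ring

/-- The pointwise form of Pinsker's inequality: with x = P/Q and after multiplication by Q² it
bounds (P - Q)² by a product of two terms whose sums are 2 and the relative entropy, ready for
Cauchy-Schwarz. The difference of the two sides decreases before 1, increases after 1, and is 0 at
1. -/
lemma three_mul_sub_one_sq_le {x : ℝ} (hx : 0 ≤ x) :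
    3 * (x - 1) ^ 2 ≤ (2 * x + 4) * (x * Real.log x - x + 1) := by
  set f : ℝ → ℝ := fun x => (2 * x + 4) * (x * Real.log x - x + 1) - 3 * (x - 1) ^ 2 with hf
  set g : ℝ → ℝ := fun x => (x + 1) * Real.log x - 2 * (x - 1) with hg
  have hg1 : g 1 = 0 := by simp [hg]
  have hf1 : f 1 = 0 := by simp [hf]
  have hd : ∀ y : ℝ, 0 < y → HasDerivAt f (4 * g y) y := fun y hy => hasDerivAt_pinsker_aux hy
  have hmono := monotoneOn_add_one_mul_log
  suffices h : 0 ≤ f x by simp only [hf] at h; linarith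
  rcases hx.eq_or_lt with rfl | hx
  · simp [hf]; norm_num
  rcases le_total x 1 with h1 | h1
  · have : AntitoneOn f (Set.Icc x 1) := by
      refine antitoneOn_of_deriv_nonpos (convex_Icc _ _)
        (fun y hy => (hd y (hx.trans_le hy.1)).continuousAt.continuousWithinAt)
        (fun y hy => ?_) fun y hy => ?_
      · rw [interior_Icc] at hy
        exact (hd y (hx.trans hy.1)).differentiableAt.differentiableWithinAt
      · rw [interior_Icc] at hy
        rw [(hd y (hx.trans hy.1)).deriv]
        have := hmono (hx.trans hy.1 : (0 : ℝ) < y) (one_pos : (0 : ℝ) < 1) hy.2.le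
        change g y ≤ g 1 at this
        linarith
    have := this ⟨le_rfl, h1⟩ ⟨h1, le_rfl⟩ h1
    linarith
  · have : MonotoneOn f (Set.Icc 1 x) := by
      refine monotoneOn_of_deriv_nonneg (convex_Icc _ _)
        (fun y hy => (hd y (one_pos.trans_le hy.1)).continuousAt.continuousWithinAt)
        (fun y hy => ?_) fun y hy => ?_
      · rw [interior_Icc] at hy
        exact (hd y (one_pos.trans hy.1)).differentiableAt.differentiableWithinAt
      · rw [interior_Icc] at hy
        rw [(hd y (one_pos.trans hy.1)).deriv]
        have := hmono (one_pos : (0 : ℝ) < 1) (one_pos.trans hy.1 : (0 : ℝ) < y) hy.1.le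
        change g 1 ≤ g y at this
        linarith
    have := this ⟨le_rfl, h1⟩ ⟨h1, le_rfl⟩ h1
    linarith

section KL

variable {α ι : Type*} [Fintype α] [Fintype ι]

/-- Pinsker's inequality. -/
theorem varDist_le_sqrt_two_mul_kl {P Q : α → ℝ} (hP : ∀ a, 0 ≤ P a) (hQ : ∀ a, 0 ≤ Q a)
    (hP1 : ∑ a, P a = 1) (hQ1 : ∑ a, Q a = 1) (hPQ : ∀ a, Q a = 0 → P a = 0) :
    varDist P Q ≤ √(2 * kl P Q) := by
  refine Real.le_sqrt_of_sq_le ?_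
  have key : ∀ a, |P a - Q a| ^ 2
      ≤ ((2 * P a + 4 * Q a) / 3) * (P a * Real.log (P a / Q a) - P a + Q a) := by
    intro a
    rcases (hQ a).eq_or_lt with h0 | h0
    · simp [hPQ a h0.symm, ← h0]
    · have h := three_mul_sub_one_sq_le (div_nonneg (hP a) h0.le)
      have e : P a = Q a * (P a / Q a) := by field_simp
      rw [sq_abs]
      set x := P a / Q a
      rw [e]
      have : 0 ≤ Q a ^ 2 := sq_nonneg _
      nlinarith [mul_le_mul_of_nonneg_left h this]
  have hnn : ∀ a, 0 ≤ (2 * P a + 4 * Q a) / 3 := fun a => by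
    have := hP a; have := hQ a; positivity
  have hnn' : ∀ a, 0 ≤ P a * Real.log (P a / Q a) - P a + Q a := by
    intro a
    rcases (hQ a).eq_or_lt with h0 | h0
    · simp [hPQ a h0.symm, ← h0]
    · by_contra! hneg
      have h1 : 0 < (2 * P a + 4 * Q a) / 3 := by have := hP a; positivity
      have := key a
      nlinarith [sq_nonneg (|P a - Q a|)]
  have := Finset.sum_sq_le_sum_mul_sum_of_sq_le_mul Finset.univ
    (r := fun a => |P a - Q a|) (fun a _ => hnn a) (fun a _ => hnn' a) (fun a _ => key a)
  refine this.trans_eq ?_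
  rw [Finset.sum_add_distrib, Finset.sum_sub_distrib, hP1, hQ1, ← Finset.sum_div,
    Finset.sum_add_distrib, ← Finset.mul_sum, ← Finset.mul_sum, hP1, hQ1, kl]
  ring

/-- Relative entropy of product laws. -/
theorem kl_prod_pi [DecidableEq ι] {P Q : ι → α → ℝ} (hP1 : ∀ i, ∑ a, P i a = 1)
    (hPQ : ∀ i a, Q i a = 0 → P i a = 0) :
    kl (fun x : ι → α => ∏ i, P i (x i)) (fun x => ∏ i, Q i (x i)) = ∑ i, kl (P i) (Q i) := by
  unfold kl
  have h : ∀ x : ι → α, (∏ i, P i (x i)) * Real.log ((∏ i, P i (x i)) / ∏ i, Q i (x i))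
      = ∑ j, (∏ i, P i (x i)) * Real.log (P j (x j) / Q j (x j)) := by
    intro x
    rw [← Finset.mul_sum]
    by_cases h0 : ∏ i, P i (x i) = 0
    · simp [h0]
    · rw [← Finset.prod_div_distrib, Real.log_prod]
      intro i _
      have hi : P i (x i) ≠ 0 := fun hi => h0 (Finset.prod_eq_zero (Finset.mem_univ i) hi)
      exact div_ne_zero hi fun hq => hi (hPQ i _ hq)
  simp_rw [h]
  rw [Finset.sum_comm]
  refine Finset.sum_congr rfl fun j _ => ?_
  exact sum_prod_pi_mul P hP1 j fun a => Real.log (P j a / Q j a)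

lemma kl_self (P : α → ℝ) : kl P P = 0 := by
  unfold kl
  refine Finset.sum_eq_zero fun a _ => ?_
  by_cases h : P a = 0
  · simp [h]
  · simp [div_self h]

end KL

/-! ### Shannon entropy -/

section Entropy

variable {Ω α γ : Type*} [Fintype Ω] [Fintype α] [Fintype γ] [DecidableEq α] [DecidableEq γ]

/-- Shannon entropy of `X` in nats. -/
def ent (μ : Ω → ℝ) (X : Ω → α) : ℝ := ∑ a, Real.negMulLog (law μ X a)

lemma law_comp_injective {α γ : Type*} [DecidableEq α] [DecidableEq γ] (μ : Ω → ℝ) (X : Ω → α)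
    {f : α → γ} (hf : Function.Injective f) (a : α) :
    law μ (fun ω => f (X ω)) (f a) = law μ X a := by
  unfold law
  congr 1
  ext ω
  simp [hf.eq_iff]

lemma ent_comp_injective (μ : Ω → ℝ) (X : Ω → α) {f : α → γ} (hf : Function.Injective f) :
    ent μ (fun ω => f (X ω)) = ent μ X := by
  refine (Fintype.sum_of_injective f hf _ _ (fun c hc => ?_) fun a => ?_).symm
  · have : law μ (fun ω => f (X ω)) c = 0 := by
      rw [law, Finset.sum_eq_zero]
      intro ω hω
      exact absurd ⟨X ω, (Finset.mem_filter.1 hω).2⟩ hc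
    rw [this, Real.negMulLog_zero]
  · rw [law_comp_injective μ X hf]

lemma sum_law_prod (μ : Ω → ℝ) (X : Ω → α) (Y : Ω → γ) (b : γ) :
    ∑ a, law μ (fun ω => (X ω, Y ω)) (a, b) = law μ Y b := by
  simp_rw [law_eq_sum_ite]
  rw [Finset.sum_comm]
  refine Finset.sum_congr rfl fun ω _ => ?_
  by_cases h : Y ω = b <;> simp [h]

lemma law_prod_le {μ : Ω → ℝ} (hμ : ∀ ω, 0 ≤ μ ω) (X : Ω → α) (Y : Ω → γ) (a : α) (b : γ) :
    law μ (fun ω => (X ω, Y ω)) (a, b) ≤ law μ Y b := by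
  rw [← sum_law_prod μ X Y b]
  exact Finset.single_le_sum (f := fun a => law μ (fun ω => (X ω, Y ω)) (a, b))
    (fun a _ => law_nonneg hμ _ _) (Finset.mem_univ a)

lemma condEntropy_mul_log_two {μ : Ω → ℝ} (hμ : ∀ ω, 0 ≤ μ ω) (X : Ω → α) (Y : Ω → γ) :
    condEntropy μ X Y * Real.log 2 = ent μ (fun ω => (X ω, Y ω)) - ent μ Y := by
  have h2 : Real.log 2 ≠ 0 := (Real.log_pos one_lt_two).ne'
  unfold condEntropy ent
  rw [Fintype.sum_prod_type_right, Finset.sum_mul, ← Finset.sum_sub_distrib]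
  refine Finset.sum_congr rfl fun b _ => ?_
  have hs := sum_law_prod μ X Y b
  set L := law μ Y b
  rw [← Finset.sum_div, mul_assoc, div_mul_cancel₀ _ h2]
  by_cases hL : L = 0
  · have : ∀ a, law μ (fun ω => (X ω, Y ω)) (a, b) = 0 := fun a =>
      le_antisymm ((law_prod_le hμ X Y a b).trans_eq hL) (law_nonneg hμ _ _)
    simp [hL, this]
  · have : ∀ a, L * Real.negMulLog (condLaw μ X Y b a)
        = Real.negMulLog (law μ (fun ω => (X ω, Y ω)) (a, b))
          + law μ (fun ω => (X ω, Y ω)) (a, b) * Real.log L := by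
      intro a
      unfold condLaw
      change L * Real.negMulLog (law μ (fun ω => (X ω, Y ω)) (a, b) / L) = _
      set q := law μ (fun ω => (X ω, Y ω)) (a, b)
      by_cases hq : q = 0
      · simp [hq]
      · rw [Real.negMulLog, Real.negMulLog, Real.log_div hq hL]
        field_simp
        ring
    rw [Finset.mul_sum]
    simp_rw [this]
    rw [Finset.sum_add_distrib, ← Finset.sum_mul, hs, Real.negMulLog]
    ring

lemma condLaw_nonneg {μ : Ω → ℝ} (hμ : ∀ ω, 0 ≤ μ ω) (X : Ω → α) (Y : Ω → γ) (b : γ) (a : α) :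
    0 ≤ condLaw μ X Y b a :=
  div_nonneg (law_nonneg hμ _ _) (law_nonneg hμ _ _)

lemma condLaw_le_one {μ : Ω → ℝ} (hμ : ∀ ω, 0 ≤ μ ω) (X : Ω → α) (Y : Ω → γ) (b : γ) (a : α) :
    condLaw μ X Y b a ≤ 1 :=
  div_le_one_of_le₀ (law_prod_le hμ X Y a b) (law_nonneg hμ _ _)

lemma condEntropy_nonneg {μ : Ω → ℝ} (hμ : ∀ ω, 0 ≤ μ ω) (X : Ω → α) (Y : Ω → γ) :
    0 ≤ condEntropy μ X Y :=
  Finset.sum_nonneg fun b _ => mul_nonneg (law_nonneg hμ _ _) <| Finset.sum_nonneg fun a _ =>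
    div_nonneg (Real.negMulLog_nonneg (condLaw_nonneg hμ X Y b a) (condLaw_le_one hμ X Y b a))
      (Real.log_nonneg one_le_two)

lemma law_mul_condLaw {μ : Ω → ℝ} (hμ : ∀ ω, 0 ≤ μ ω) (X : Ω → α) (Y : Ω → γ) (b : γ) (a : α) :
    law μ Y b * condLaw μ X Y b a = law μ (fun ω => (X ω, Y ω)) (a, b) := by
  unfold condLaw
  by_cases hL : law μ Y b = 0
  · have := le_antisymm ((law_prod_le hμ X Y a b).trans_eq hL) (law_nonneg hμ _ _)
    rw [this, hL]; simp
  · field_simp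

/-- Conditioning on more reduces entropy. -/
theorem condEntropy_le_condEntropy_comp {δ : Type*} [Fintype δ] [DecidableEq δ] {μ : Ω → ℝ}
    (hμ : ∀ ω, 0 ≤ μ ω) (X : Ω → α) (Y : Ω → γ) (f : γ → δ) :
    condEntropy μ X Y ≤ condEntropy μ X (fun ω => f (Y ω)) := by
  unfold condEntropy
  rw [← Finset.sum_fiberwise (s := Finset.univ) (g := f)]
  refine Finset.sum_le_sum fun z _ => ?_
  simp_rw [Finset.mul_sum]
  rw [Finset.sum_comm]
  refine Finset.sum_le_sum fun a _ => ?_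
  simp_rw [← mul_div_assoc]
  rw [← Finset.sum_div]
  refine div_le_div_of_nonneg_right ?_ (Real.log_nonneg one_le_two)
  set L := law μ (fun ω => f (Y ω)) z with hLdef
  have hL : ∑ y ∈ Finset.univ.filter (fun y => f y = z), law μ Y y = L := by
    rw [hLdef, ← law_law μ Y f z, law]
  have hLa : ∑ y ∈ Finset.univ.filter (fun y => f y = z), law μ (fun ω => (X ω, Y ω)) (a, y)
      = law μ (fun ω => (X ω, f (Y ω))) (a, z) := by
    simp_rw [law_eq_sum_ite]
    rw [Finset.sum_comm]
    refine Finset.sum_congr rfl fun ω _ => ?_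
    by_cases h1 : X ω = a <;> by_cases h2 : f (Y ω) = z <;> simp [h1, h2, Finset.sum_ite_eq]
  have hL0 : 0 ≤ L := law_nonneg hμ _ _
  rcases hL0.eq_or_lt with h0 | h0
  · have : ∀ y ∈ Finset.univ.filter (fun y => f y = z), law μ Y y = 0 :=
      (Finset.sum_eq_zero_iff_of_nonneg fun y _ => law_nonneg hμ _ _).1 (hL.trans h0.symm)
    rw [← h0, zero_mul, Finset.sum_eq_zero]
    intro y hy
    rw [this y hy, zero_mul]
  -- Jensen on the fibre of `f` over `z`: the conditional law given `f(Y) = z` is the mixture of the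
  -- conditional laws given `Y = y`, with weights P(Y = y)/P(f(Y) = z).
  · have J := Real.concaveOn_negMulLog.le_map_sum
      (t := Finset.univ.filter (fun y => f y = z)) (w := fun y => law μ Y y / L)
      (p := fun y => condLaw μ X Y y a)
      (fun y _ => div_nonneg (law_nonneg hμ _ _) hL0)
      (by rw [← Finset.sum_div, hL, div_self h0.ne'])
      (fun y _ => condLaw_nonneg hμ X Y y a)
    have e : ∑ y ∈ Finset.univ.filter (fun y => f y = z),
        (law μ Y y / L) • condLaw μ X Y y a = condLaw μ X (fun ω => f (Y ω)) z a := by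
      unfold condLaw at *
      change _ = law μ (fun ω => (X ω, f (Y ω))) (a, z) / L
      rw [← hLa, Finset.sum_div]
      refine Finset.sum_congr rfl fun y _ => ?_
      rw [smul_eq_mul, div_mul_eq_mul_div]
      congr 1
      exact law_mul_condLaw hμ X Y y a
    rw [e] at J
    have := mul_le_mul_of_nonneg_left J hL0
    refine le_trans (le_of_eq ?_) this
    rw [Finset.mul_sum]
    refine Finset.sum_congr rfl fun y _ => ?_
    rw [smul_eq_mul]
    field_simp

lemma kl_const (P : α → ℝ) (hP : ∑ a, P a = 1) {q : ℝ} (hq : 0 < q) :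
    kl P (fun _ => q) = -Real.log q - ∑ a, Real.negMulLog (P a) := by
  unfold kl
  have : ∀ a, P a * Real.log (P a / q) = P a * (-Real.log q) - Real.negMulLog (P a) := by
    intro a
    by_cases h : P a = 0
    · simp [h]
    · rw [Real.log_div h hq.ne', Real.negMulLog]; ring
  simp_rw [this]
  rw [Finset.sum_sub_distrib, ← Finset.sum_mul, hP, one_mul]

end Entropy

/-! ### Chain rule for a vector of random bits -/

section Chain

variable {Ω α : Type*} [Fintype Ω] [Fintype α] [DecidableEq α] {N : ℕ}

/-- Restriction of a vector to the coordinates in `S`. -/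
def restrictTo (A : Ω → Fin N → α) (S : Finset (Fin N)) (ω : Ω) : ↥S → α := fun i => A ω i

/-- Restriction of a vector to the coordinates before `j`. -/
def before (A : Ω → Fin N → α) (j : Fin N) (ω : Ω) : {i : Fin N // i < j} → α := fun i => A ω i

lemma ent_insert (μ : Ω → ℝ) (A : Ω → Fin N → α) (S : Finset (Fin N)) (j : Fin N) :
    ent μ (restrictTo A (insert j S))
      = ent μ (fun ω => (A ω j, restrictTo A S ω)) := by
  let g : (↥(insert j S) → α) → α × (↥S → α) := fun x =>
    (x ⟨j, Finset.mem_insert_self j S⟩, fun i => x ⟨i, Finset.mem_insert_of_mem i.2⟩)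
  have hg : Function.Injective g := by
    intro x y h
    have h1 := congrArg Prod.fst h
    have h2 := congrArg Prod.snd h
    funext ⟨i, hi⟩
    rcases Finset.mem_insert.1 hi with rfl | h'
    · exact h1
    · exact congrFun h2 ⟨i, h'⟩
  exact (ent_comp_injective μ (restrictTo A (insert j S)) hg).symm

lemma ent_restrictTo_empty {μ : Ω → ℝ} (hμ1 : ∑ ω, μ ω = 1) (A : Ω → Fin N → α) :
    ent μ (restrictTo A ∅) = 0 := by
  unfold ent
  have : ∀ a, law μ (restrictTo A ∅) a = 1 := by
    intro a
    rw [law, Finset.filter_true_of_mem, hμ1]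
    intro ω _
    exact Subsingleton.elim _ _
  simp [this]

/-- The chain rule in increasing order of `S`: conditioning on the whole past gives at most the
entropy obtained by conditioning on the earlier members of `S` alone. -/
theorem sum_condEntropy_le_ent {μ : Ω → ℝ} (hμ : ∀ ω, 0 ≤ μ ω) (hμ1 : ∑ ω, μ ω = 1)
    (A : Ω → Fin N → α) (S : Finset (Fin N)) :
    ∑ j ∈ S, condEntropy μ (fun ω => A ω j) (before A j) * Real.log 2
      ≤ ent μ (restrictTo A S) := by
  induction S using Finset.induction_on_max with
  | empty => simp [ent_restrictTo_empty hμ1]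
  | insert j S hj ih =>
    have hjS : j ∉ S := fun h => lt_irrefl _ (hj j h)
    rw [Finset.sum_insert hjS, ent_insert]
    have h := condEntropy_mul_log_two hμ (fun ω => A ω j) (restrictTo A S)
    have hm := condEntropy_le_condEntropy_comp hμ (fun ω => A ω j) (before A j)
      (fun x => fun i : ↥S => x ⟨i, hj i i.2⟩)
    have hm' : condEntropy μ (fun ω => A ω j) (before A j)
        ≤ condEntropy μ (fun ω => A ω j) (restrictTo A S) := hm
    have := mul_le_mul_of_nonneg_right hm' (Real.log_nonneg one_le_two)
    linarith

/-- For a down-set the earlier members of `S` are the whole past, so no entropy is lost in the chain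
rule. -/
theorem sum_condEntropy_eq_ent {μ : Ω → ℝ} (hμ : ∀ ω, 0 ≤ μ ω) (hμ1 : ∑ ω, μ ω = 1)
    (A : Ω → Fin N → α) (S : Finset (Fin N)) (hS : ∀ j ∈ S, ∀ i < j, i ∈ S) :
    ∑ j ∈ S, condEntropy μ (fun ω => A ω j) (before A j) * Real.log 2
      = ent μ (restrictTo A S) := by
  induction S using Finset.induction_on_max with
  | empty => simp [ent_restrictTo_empty hμ1]
  | insert j S hj ih =>
    have hjS : j ∉ S := fun h => lt_irrefl _ (hj j h)
    have hlow : ∀ i < j, i ∈ S := fun i hi =>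
      (Finset.mem_insert.1 (hS j (Finset.mem_insert_self j S) i hi)).resolve_left hi.ne
    rw [Finset.sum_insert hjS, ent_insert,
      ih fun k hk i hi => hlow i (hi.trans (hj k hk)), condEntropy_mul_log_two hμ]
    have h1 : ent μ (before A j) = ent μ (restrictTo A S) := by
      refine ent_comp_injective μ (restrictTo A S)
        (f := fun x => fun i : {i : Fin N // i < j} => x ⟨i, hlow i i.2⟩) ?_
      intro x y h
      funext ⟨i, hi⟩
      exact congrFun h ⟨i, hj i hi⟩
    have h2 : ent μ (fun ω => (A ω j, before A j ω))
        = ent μ (fun ω => (A ω j, restrictTo A S ω)) := by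
      refine ent_comp_injective μ (fun ω => (A ω j, restrictTo A S ω))
        (f := fun x => (x.1, fun i : {i : Fin N // i < j} => x.2 ⟨i, hlow i i.2⟩)) ?_
      intro x y h
      obtain ⟨h1, h2⟩ := Prod.mk.inj h
      refine Prod.ext h1 ?_
      funext ⟨i, hi⟩
      exact congrFun h2 ⟨i, hj i hi⟩
    rw [h1, h2]
    ring

end Chain

/-! ### The source and the polar transform -/

lemma bern_nonneg {p : ℝ} (h0 : 0 ≤ p) (h1 : p ≤ 1) (b : ZMod 2) : 0 ≤ bern p b := by
  unfold bern; split_ifs <;> linarith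

lemma sum_zmod_two (f : ZMod 2 → ℝ) : ∑ b, f b = f 0 + f 1 := Fin.sum_univ_two f

lemma sum_bern (p : ℝ) : ∑ b, bern p b = 1 := by
  rw [sum_zmod_two]; simp [bern]

lemma srcWeight_nonneg {p : ℝ} (h0 : 0 ≤ p) (h1 : p ≤ 1) {n : ℕ} (v : Fin n → ZMod 2) :
    0 ≤ srcWeight p v := Finset.prod_nonneg fun _ _ => bern_nonneg h0 h1 _

lemma sum_srcWeight (p : ℝ) (n : ℕ) : ∑ v : Fin n → ZMod 2, srcWeight p v = 1 := by
  unfold srcWeight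
  rw [sum_prod_pi fun _ => bern p]
  simp [sum_bern]

lemma sum_negMulLog_srcWeight (p : ℝ) (n : ℕ) :
    ∑ v : Fin n → ZMod 2, Real.negMulLog (srcWeight p v)
      = n * (Real.negMulLog p + Real.negMulLog (1 - p)) := by
  -- Relative entropy to the counting measure is minus the entropy; additivity of `kl` needs no
  -- normalization of the second argument.
  have h := kl_prod_pi (ι := Fin n) (P := fun _ => bern p) (Q := fun _ _ => 1)
    (fun _ => sum_bern p) (fun _ _ h => absurd h one_ne_zero)
  unfold kl at h
  simp only [Finset.prod_const_one, div_one, Finset.sum_const, Finset.card_univ,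
    Fintype.card_fin, nsmul_eq_mul, sum_zmod_two] at h
  have e : ∀ v : Fin n → ZMod 2, Real.negMulLog (srcWeight p v)
      = -((∏ i, bern p (v i)) * Real.log (∏ i, bern p (v i))) := fun v => neg_mul _ _
  simp_rw [e]
  rw [Finset.sum_neg_distrib, h]
  simp only [bern, zero_ne_one, if_false, if_true, Real.negMulLog]
  ring

/-- The kernel is an involution over F_2 and Kronecker products multiply factorwise. Only the
invertibility of G_n is needed from it. -/
lemma kronPow_mul_self (m : ℕ) : kronPow m * kronPow m = 1 := by
  induction m with
  | zero => exact one_mul 1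
  | succ m ih =>
    have ha : arikanKernel * arikanKernel = 1 := by decide
    have : Matrix.kroneckerMap (fun a b => a * b) arikanKernel (kronPow m)
        * Matrix.kroneckerMap (fun a b => a * b) arikanKernel (kronPow m) = 1 := by
      have := Matrix.mul_kronecker_mul arikanKernel arikanKernel (kronPow m) (kronPow m)
      rw [ha, ih, Matrix.one_kronecker_one] at this
      exact this.symm
    rw [kronPow]
    simp only [Matrix.reindex_apply]
    rw [Matrix.submatrix_mul_equiv, this, Matrix.submatrix_one_equiv]

lemma isUnit_det_polarMatrix (m : ℕ) : IsUnit (polarMatrix m).det := by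
  rw [polarMatrix, Matrix.det_mul]
  refine IsUnit.mul ?_ ?_
  · rw [Matrix.det_permutation]
    exact (Units.isUnit _).map (Int.castRingHom (ZMod 2))
  · refine IsUnit.of_mul_eq_one (kronPow m).det ?_
    rw [← Matrix.det_mul, kronPow_mul_self, Matrix.det_one]

lemma vecMul_polarize_inv {m : ℕ} (v : Fin (2 ^ m) → ZMod 2) :
    Matrix.vecMul (polarize v) (polarMatrix m)⁻¹ = v := by
  rw [polarize, Matrix.vecMul_vecMul, Matrix.mul_nonsing_inv _ (isUnit_det_polarMatrix m),
    Matrix.vecMul_one]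

lemma polarize_injective (m : ℕ) :
    Function.Injective (polarize : (Fin (2 ^ m) → ZMod 2) → _) :=
  Function.LeftInverse.injective (g := fun a => Matrix.vecMul a (polarMatrix m)⁻¹)
    vecMul_polarize_inv

/-! ### Entropies of the polarized bits -/

lemma polarEntropy_nonneg {p : ℝ} (h0 : 0 ≤ p) (h1 : p ≤ 1) {m : ℕ} (j : Fin (2 ^ m)) : 0 ≤ polarEntropy p m j :=
  condEntropy_nonneg (srcWeight_nonneg h0 h1) _ _

/-- The polar transform preserves the total entropy. -/
theorem sum_polarEntropy_mul_log_two {p : ℝ} (h0 : 0 ≤ p) (h1 : p ≤ 1) (m : ℕ) :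
    (∑ j, polarEntropy p m j) * Real.log 2
      = 2 ^ m * (Real.negMulLog p + Real.negMulLog (1 - p)) := by
  have h := sum_condEntropy_eq_ent (srcWeight_nonneg h0 h1) (sum_srcWeight p (2 ^ m))
    (polarize : (Fin (2 ^ m) → ZMod 2) → _) Finset.univ fun _ _ _ _ => Finset.mem_univ _
  rw [Finset.sum_mul]
  refine h.trans ?_
  have e : ent (srcWeight p) (restrictTo (polarize : (Fin (2 ^ m) → ZMod 2) → _) Finset.univ)
      = ent (srcWeight p) (fun v : Fin (2 ^ m) → ZMod 2 => v) := by
    refine ent_comp_injective (srcWeight p) (fun v : Fin (2 ^ m) → ZMod 2 => v)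
      (f := restrictTo polarize Finset.univ) ?_
    intro x y h
    refine polarize_injective m (funext fun i => ?_)
    exact congrFun h ⟨i, Finset.mem_univ i⟩
  rw [e, ent]
  have e2 : ∀ v : Fin (2 ^ m) → ZMod 2, law (srcWeight p) (fun v => v) v = srcWeight p v := by
    intro v
    rw [law_eq_sum_ite]
    simp
  simp_rw [e2]
  rw [sum_negMulLog_srcWeight]
  push_cast
  ring

/-- The law of the high-entropy positions of a polarized row. -/
def highLaw (p β : ℝ) (m : ℕ) : (↥(highSet p β m) → ZMod 2) → ℝ :=
  law (srcWeight p) (restrictTo polarize (highSet p β m))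

lemma sum_highLaw (p β : ℝ) (m : ℕ) : ∑ x, highLaw p β m x = 1 :=
  (sum_law _ _).trans (sum_srcWeight p _)

/-- Relative entropy to uniform is the entropy deficit, and by the chain rule each high-entropy
position contributes a deficit of at most δ_n bits. -/
theorem kl_highLaw_le {p : ℝ} (h0 : 0 ≤ p) (h1 : p ≤ 1) (β : ℝ) (m : ℕ) :
    kl (highLaw p β m) (fun _ => (1 / 2 : ℝ) ^ (highSet p β m).card)
      ≤ (highSet p β m).card * (delta β m * Real.log 2) := by
  have hl : 0 < Real.log 2 := Real.log_pos one_lt_two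
  rw [kl_const _ (sum_highLaw p β m) (by positivity)]
  have h := sum_condEntropy_le_ent (srcWeight_nonneg h0 h1) (sum_srcWeight p (2 ^ m))
    polarize (highSet p β m)
  have h2 : ∑ j ∈ highSet p β m, (1 - delta β m) * Real.log 2
      ≤ ∑ j ∈ highSet p β m, condEntropy (srcWeight p) (fun v => polarize v j)
          (before polarize j) * Real.log 2 := by
    refine Finset.sum_le_sum fun j hj => ?_
    refine mul_le_mul_of_nonneg_right ?_ hl.le
    exact (Finset.mem_filter.1 hj).2.le
  rw [Finset.sum_const, nsmul_eq_mul] at h2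
  have h3 : ∑ a, Real.negMulLog (highLaw p β m a)
      = ent (srcWeight p) (restrictTo polarize (highSet p β m)) := rfl
  rw [h3, Real.log_pow, one_div, Real.log_inv]
  linarith

/-! ### The first polarized bit -/

lemma kronPow_apply_zero (m : ℕ) (i : Fin (2 ^ m)) : kronPow m i 0 = 1 := by
  induction m with
  | zero =>
    have hi : i = 0 := Fin.ext (Nat.lt_one_iff.1 i.2)
    rw [hi]
    exact Matrix.one_apply_eq 0
  | succ m ih =>
    have ha : ∀ x : Fin 2, arikanKernel x 0 = 1 := by decide
    have h0 : (finProdFinEquiv.trans (finCongr (pow_succ' 2 m).symm)).symm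
        (0 : Fin (2 ^ (m + 1))) = (0, (0 : Fin (2 ^ m))) := by
      rw [Equiv.symm_apply_eq]
      ext
      simp
    rw [kronPow]
    simp only [Matrix.reindex_apply, Matrix.submatrix_apply, Matrix.kroneckerMap_apply]
    rw [h0, ha, ih, one_mul]

/-- The kernel has a first column of ones, so all its Kronecker powers do, and bit reversal only
permutes rows. The parity bit serves to show ñ ≥ 1 when β = 0. -/
lemma polarize_zero {m : ℕ} (v : Fin (2 ^ m) → ZMod 2) : polarize v 0 = ∑ i, v i := by
  have : ∀ i, polarMatrix m i 0 = 1 := by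
    intro i
    have : polarMatrix m = (kronPow m).submatrix (bitReversal m) id :=
      PEquiv.toMatrix_toPEquiv_mul _ _
    rw [this, Matrix.submatrix_apply]
    exact kronPow_apply_zero m _
  simp [polarize, Matrix.vecMul, dotProduct, this]

/-- The nontrivial real character of `ZMod 2`. -/
def bitSign (b : ZMod 2) : ℝ := if b = 1 then -1 else 1

lemma bitSign_add (a b : ZMod 2) : bitSign (a + b) = bitSign a * bitSign b := by
  have h : ∀ a b : ZMod 2, (a + b = 1 ↔ ¬ (a = 1 ↔ b = 1)) := by decide
  by_cases ha : a = 1 <;> by_cases hb : b = 1 <;> simp [bitSign, h, ha, hb]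

lemma bitSign_sum {ι : Type*} (s : Finset ι) (v : ι → ZMod 2) :
    bitSign (∑ i ∈ s, v i) = ∏ i ∈ s, bitSign (v i) := by
  classical
  induction s using Finset.induction_on with
  | empty => simp [bitSign]
  | insert a s ha ih => rw [Finset.sum_insert ha, Finset.prod_insert ha, bitSign_add, ih]

/-- The left side is the mean of the nontrivial character of the sum, which factors over the
independent bits. -/
lemma law_parity_sub (p : ℝ) (n : ℕ) :
    law (srcWeight p) (fun v : Fin n → ZMod 2 => ∑ i, v i) 0
      - law (srcWeight p) (fun v : Fin n → ZMod 2 => ∑ i, v i) 1 = (1 - 2 * p) ^ n := by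
  have h := sum_law_mul (srcWeight p) (fun v : Fin n → ZMod 2 => ∑ i, v i) bitSign
  rw [sum_zmod_two] at h
  simp only [bitSign_sum, srcWeight, ← Finset.prod_mul_distrib] at h
  rw [sum_prod_pi fun _ b => bern p b * bitSign b] at h
  simp only [sum_zmod_two, Finset.prod_const, Finset.card_univ, Fintype.card_fin] at h
  simp only [bitSign, bern, zero_ne_one, if_false, if_true] at h
  rw [show (1 - 2 * p) = (1 - p) * 1 + p * -1 by ring, ← h]
  ring

lemma mul_one_sub_le_negMulLog {x : ℝ} (hx : 0 ≤ x) : x * (1 - x) ≤ Real.negMulLog x := by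
  rcases hx.eq_or_lt with rfl | hx0
  · simp
  · rw [Real.negMulLog, neg_mul, ← mul_neg]
    refine mul_le_mul_of_nonneg_left ?_ hx
    linarith [Real.log_le_sub_one_of_pos hx0]

/-- The first bit has no past, so its entropy is that of the parity. With masses q and r = 1 - q,
the bound x(1 - x) ≤ -x log x gives at least 2qr = (1 - (q - r)²)/2 nats, and q - r is the bias just
computed. -/
theorem polarEntropy_zero_ge {p : ℝ} (h0 : 0 ≤ p) (h1 : p ≤ 1) (m : ℕ) :
    (1 - ((1 - 2 * p) ^ 2 ^ m) ^ 2) / (2 * Real.log 2) ≤ polarEntropy p m 0 := by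
  have hl : 0 < Real.log 2 := Real.log_pos one_lt_two
  have hs := law_parity_sub p (2 ^ m)
  have ht := (sum_law (srcWeight p) (fun v : Fin (2 ^ m) → ZMod 2 => ∑ i, v i)).trans
    (sum_srcWeight p (2 ^ m))
  rw [sum_zmod_two] at ht
  have hq0 : 0 ≤ law (srcWeight p) (fun v : Fin (2 ^ m) → ZMod 2 => ∑ i, v i) 0 :=
    law_nonneg (srcWeight_nonneg h0 h1) _ _
  have hq1 : 0 ≤ law (srcWeight p) (fun v : Fin (2 ^ m) → ZMod 2 => ∑ i, v i) 1 :=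
    law_nonneg (srcWeight_nonneg h0 h1) _ _
  have hent : polarEntropy p m 0 * Real.log 2
      = Real.negMulLog (law (srcWeight p) (fun v : Fin (2 ^ m) → ZMod 2 => ∑ i, v i) 0)
        + Real.negMulLog (law (srcWeight p) (fun v : Fin (2 ^ m) → ZMod 2 => ∑ i, v i) 1) := by
    have hemp : IsEmpty {i : Fin (2 ^ m) // i < 0} := ⟨fun i => Fin.not_lt_zero _ i.2⟩
    rw [polarEntropy, condEntropy_mul_log_two (srcWeight_nonneg h0 h1)]
    have e1 : ent (srcWeight p) (polarPrefix (m := m) 0) = 0 := by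
      unfold ent
      refine Finset.sum_eq_zero fun a _ => ?_
      rw [law, Finset.filter_true_of_mem fun ω _ => Subsingleton.elim _ _, sum_srcWeight,
        Real.negMulLog_one]
    have e2 : ent (srcWeight p) (fun v => (polarize v 0, polarPrefix (m := m) 0 v))
        = ent (srcWeight p) (fun v : Fin (2 ^ m) → ZMod 2 => ∑ i, v i) := by
      have := ent_comp_injective (srcWeight p) (fun v : Fin (2 ^ m) → ZMod 2 => ∑ i, v i)
        (f := fun b => (b, fun i : {i : Fin (2 ^ m) // i < 0} => (0 : ZMod 2)))
        (fun x y h => (Prod.mk.inj h).1)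
      rw [← this]
      congr 1
      funext v
      exact Prod.ext (polarize_zero v) (Subsingleton.elim _ _)
    rw [e1, e2, ent, sum_zmod_two, sub_zero]
  set q := law (srcWeight p) (fun v : Fin (2 ^ m) → ZMod 2 => ∑ i, v i) 0
  set r := law (srcWeight p) (fun v : Fin (2 ^ m) → ZMod 2 => ∑ i, v i) 1
  rw [div_le_iff₀ (by positivity), ← hs]
  have ha := mul_one_sub_le_negMulLog hq0
  have hb := mul_one_sub_le_negMulLog hq1
  have : r = 1 - q := by linarith
  rw [this] at hb hent ⊢
  nlinarith

/-! ### Successive cancellation -/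

/-- The decision on the bit `j` given the true past of `v`. -/
def genieBit (p : ℝ) {m : ℕ} (j : Fin (2 ^ m)) (x : {i : Fin (2 ^ m) // i < j} → ZMod 2) :
    ZMod 2 :=
  if law (srcWeight p) (fun v => (polarize v j, polarPrefix j v)) (0, x)
      < law (srcWeight p) (fun v => (polarize v j, polarPrefix j v)) (1, x) then 1 else 0

/-- The smaller mass is at most L/2, so its information content -log₂(q/L) is at least one bit. -/
lemma min_le_entropy_two {q r L : ℝ} (hq : 0 ≤ q) (hr : 0 ≤ r) (hL : q + r = L) :
    min q r ≤ L * (Real.negMulLog (q / L) / Real.log 2 + Real.negMulLog (r / L) / Real.log 2) := by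
  wlog hqr : q ≤ r generalizing q r
  · rw [min_comm, add_comm (Real.negMulLog (q / L) / _)]
    exact this hr hq (by linarith) (by linarith)
  rw [min_eq_left hqr]
  have hl : 0 < Real.log 2 := Real.log_pos one_lt_two
  rcases hq.eq_or_lt with rfl | hq0
  · simp only [zero_add] at hL
    subst hL
    simp only [zero_div, Real.negMulLog_zero, zero_add]
    refine mul_nonneg hr (div_nonneg (Real.negMulLog_nonneg ?_ ?_) hl.le)
    · positivity
    · exact div_self_le_one r
  have hLpos : 0 < L := by linarith
  have h1 : 0 ≤ Real.negMulLog (r / L) / Real.log 2 :=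
    div_nonneg (Real.negMulLog_nonneg (by positivity) ((div_le_one hLpos).2 (by linarith))) hl.le
  have h2 : q / L ≤ Real.negMulLog (q / L) / Real.log 2 := by
    rw [le_div_iff₀ hl, Real.negMulLog, neg_mul, ← mul_neg]
    refine mul_le_mul_of_nonneg_left ?_ (by positivity)
    rw [← Real.log_inv]
    refine Real.log_le_log two_pos ?_
    rw [inv_div, le_div_iff₀ hq0]
    linarith
  calc q = L * (q / L) := by field_simp
    _ ≤ _ := mul_le_mul_of_nonneg_left (by linarith) hLpos.le

/-- Given a past `x`, choosing the likelier value errs exactly with the smaller of the two joint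
masses, also at a tie. That mass is at most the contribution of `x` to the conditional entropy. -/
theorem genie_error_le {p : ℝ} (h0 : 0 ≤ p) (h1 : p ≤ 1) {m : ℕ} (j : Fin (2 ^ m)) :
    ∑ v : Fin (2 ^ m) → ZMod 2, (if genieBit p j (polarPrefix j v) ≠ polarize v j
      then srcWeight p v else 0) ≤ polarEntropy p m j := by
  set J : ZMod 2 × ({i : Fin (2 ^ m) // i < j} → ZMod 2) → ℝ :=
    law (srcWeight p) (fun v => (polarize v j, polarPrefix j v)) with hJ
  have hw : ∀ v : Fin (2 ^ m) → ZMod 2, 0 ≤ srcWeight p v := srcWeight_nonneg h0 h1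
  have e := sum_law_mul (srcWeight p) (fun v : Fin (2 ^ m) → ZMod 2 =>
    (polarize v j, polarPrefix j v)) (fun y => if genieBit p j y.2 ≠ y.1 then 1 else 0)
  simp only [mul_ite, mul_one, mul_zero] at e
  rw [← e, Fintype.sum_prod_type_right, polarEntropy, condEntropy]
  refine Finset.sum_le_sum fun x _ => ?_
  rw [sum_zmod_two, sum_zmod_two]
  have hs := sum_law_prod (srcWeight p) (fun v => polarize v j) (polarPrefix j) x
  rw [sum_zmod_two] at hs
  refine le_trans (le_of_eq ?_) (min_le_entropy_two (law_nonneg hw _ _) (law_nonneg hw _ _) hs)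
  unfold genieBit
  split_ifs <;> simp_all [le_of_lt]

/-- As long as no decision is wrong, the decoder sees the true past and decides like the genie;
hence correctness of all genie decisions propagates by induction on the position. -/
lemma scBit_eq_polarize {p β : ℝ} {m : ℕ} {v b : Fin (2 ^ m) → ZMod 2}
    (hb : ∀ j, j ∉ lowSet p β m → b j = polarize v j)
    (hg : ∀ j ∈ lowSet p β m, genieBit p j (polarPrefix j v) = polarize v j) (j : Fin (2 ^ m)) :
    scBit p β m b j = polarize v j := by
  induction j using WellFoundedLT.induction with
  | ind j ih =>
    rw [scBit]
    split_ifs with hj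
    · have hp : (fun i : {i : Fin (2 ^ m) // i < j} => scBit p β m b i.1) = polarPrefix j v :=
        funext fun i => ih i.1 i.2
      simp only [hp]
      exact hg j hj
    · exact hb j hj

lemma zmod_two_add_self (a : ZMod 2) : a + a = 0 := CharTwo.add_self_eq_zero a

lemma unpad_srcEnc {p β : ℝ} {m d : ℕ} (σ : ↥(midSet p β m) ↪ Fin d)
    (v : Fin (2 ^ m) → ZMod 2) (u : Fin d → ZMod 2) {j : Fin (2 ^ m)} (hj : j ∉ lowSet p β m) :
    unpad σ (srcEnc σ v u) u j = polarize v j := by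
  unfold unpad srcEnc
  split_ifs with hH hM
  · rfl
  · simp [add_assoc, zmod_two_add_self]
  · simp [midSet, hj, hH] at hM

lemma srcDec_srcEnc {p β : ℝ} {m d : ℕ} (σ : ↥(midSet p β m) ↪ Fin d)
    (v : Fin (2 ^ m) → ZMod 2) (u : Fin d → ZMod 2)
    (hg : ∀ j ∈ lowSet p β m, genieBit p j (polarPrefix j v) = polarize v j) :
    srcDec σ (srcEnc σ v u) u = v := by
  unfold srcDec
  have : scBit p β m (unpad σ (srcEnc σ v u) u) = polarize v :=
    funext fun j => scBit_eq_polarize (fun j hj => unpad_srcEnc σ v u hj) hg j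
  rw [this, vecMul_polarize_inv]

/-! ### Bijective codebooks -/

/-- Injectivity makes every codeword unique in the codebook. This is why no channel error term
survives. -/
lemma chanDec_chanEnc {ks kw ℓ : ℕ} (h : ks + kw = ℓ) (B : Codebook ks kw ℓ)
    (hB : Function.Injective (chanEnc h B)) (c : Fin ℓ → ZMod 2) :
    chanDec h B (chanEnc h B c) = some c := by
  have hy : ∃! c', chanEnc h B c' = chanEnc h B c := ⟨c, rfl, fun c' hc => hB hc⟩
  rw [chanDec, dif_pos hy]
  exact congrArg some (hB hy.choose_spec.1)

lemma decode_transmit {p β : ℝ} {m ℓ d ks kw : ℕ} (h : ks + kw = ℓ) (B : Codebook ks kw ℓ)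
    (hB : Function.Injective (chanEnc h B)) (σ : ↥(midSet p β m) ↪ Fin d) (ω : Sample m ℓ d) :
    decode h B σ (transmit h B σ ω) ω.2
      = some fun i => srcDec σ (srcEnc σ (ω.1 i) (ω.2 i)) (ω.2 i) := by
  have hc : ∀ j, chanDec h B (fun i => transmit h B σ ω i j)
      = some (fun i' => srcEnc σ (ω.1 i') (ω.2 i') j) :=
    fun j => chanDec_chanEnc h B hB _
  unfold decode
  rw [dif_pos fun j => by rw [hc j]; rfl]
  refine congrArg some (funext fun i => ?_)
  congr 1
  funext j
  rw [Option.get_of_eq_some _ (hc j)]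

lemma weight_nonneg {p : ℝ} (h0 : 0 ≤ p) (h1 : p ≤ 1) {m ℓ d : ℕ} (ω : Sample m ℓ d) :
    0 ≤ weight p ω :=
  mul_nonneg (Finset.prod_nonneg fun _ _ => srcWeight_nonneg h0 h1 _) (by positivity)

lemma sum_weight_mul_row (p : ℝ) {m ℓ d : ℕ} (i : Fin ℓ)
    (g : (Fin (2 ^ m) → ZMod 2) → ℝ) :
    ∑ ω : Sample m ℓ d, weight p ω * g (ω.1 i) = ∑ v, srcWeight p v * g v := by
  rw [Fintype.sum_prod_type]
  have hc : (Fintype.card (Fin ℓ → Fin d → ZMod 2) : ℝ) ≠ 0 := by positivity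
  rw [← sum_prod_pi_mul (fun _ : Fin ℓ => srcWeight p) (fun _ => sum_srcWeight p _) i g]
  refine Finset.sum_congr rfl fun v _ => ?_
  simp only [weight, Finset.sum_const, Finset.card_univ, nsmul_eq_mul]
  field_simp

/-- With an injective column encoder only successive cancellation can fail. -/
theorem errProb_le {p β : ℝ} (h0 : 0 ≤ p) (h1 : p ≤ 1) {m ℓ d ks kw : ℕ} (h : ks + kw = ℓ)
    (B : Codebook ks kw ℓ) (hB : Function.Injective (chanEnc h B))
    (σ : ↥(midSet p β m) ↪ Fin d) :
    errProb h B σ ≤ ℓ * ∑ j ∈ lowSet p β m, polarEntropy p m j := by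
  set bad : Fin (2 ^ m) → (Fin (2 ^ m) → ZMod 2) → ℝ := fun j v =>
    if genieBit p j (polarPrefix j v) ≠ polarize v j then 1 else 0 with hbad
  have hbad0 : ∀ j v, 0 ≤ bad j v := fun j v => by simp only [hbad]; split_ifs <;> norm_num
  -- Union bound over rows and low positions: a failure forces at least one wrong genie decision.
  have step : errProb h B σ
      ≤ ∑ ω : Sample m ℓ d, ∑ i, ∑ j ∈ lowSet p β m, weight p ω * bad j (ω.1 i) := by
    unfold errProb
    rw [Finset.sum_filter]
    refine Finset.sum_le_sum fun ω _ => ?_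
    have hw := weight_nonneg h0 h1 ω
    have hnn : ∀ i, 0 ≤ ∑ j ∈ lowSet p β m, weight p ω * bad j (ω.1 i) := fun i =>
      Finset.sum_nonneg fun j _ => mul_nonneg hw (hbad0 _ _)
    split_ifs with hne
    · rw [decode_transmit h B hB] at hne
      have : ∃ i, ∃ j ∈ lowSet p β m,
          genieBit p j (polarPrefix j (ω.1 i)) ≠ polarize (ω.1 i) j := by
        by_contra! hall
        exact hne (congrArg some (funext fun i => srcDec_srcEnc σ _ _ (hall i)))
      obtain ⟨i, j, hj, hij⟩ := this
      calc weight p ω = weight p ω * bad j (ω.1 i) := by simp [hbad, hij]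
        _ ≤ ∑ j ∈ lowSet p β m, weight p ω * bad j (ω.1 i) :=
          Finset.single_le_sum (f := fun j => weight p ω * bad j (ω.1 i))
            (fun j _ => mul_nonneg hw (hbad0 _ _)) hj
        _ ≤ _ := Finset.single_le_sum
            (f := fun i => ∑ j ∈ lowSet p β m, weight p ω * bad j (ω.1 i))
            (fun i _ => hnn i) (Finset.mem_univ i)
    · exact Finset.sum_nonneg fun i _ => hnn i
  refine step.trans ?_
  rw [Finset.sum_comm]
  have : ∀ i : Fin ℓ, ∑ ω : Sample m ℓ d, ∑ j ∈ lowSet p β m, weight p ω * bad j (ω.1 i)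
      ≤ ∑ j ∈ lowSet p β m, polarEntropy p m j := by
    intro i
    rw [Finset.sum_comm]
    refine Finset.sum_le_sum fun j _ => ?_
    rw [sum_weight_mul_row p i (bad j)]
    refine le_trans (le_of_eq ?_) (genie_error_le h0 h1 j)
    simp only [hbad, mul_ite, mul_one, mul_zero]
  refine (Finset.sum_le_sum fun i _ => this i).trans_eq ?_
  simp

/-! ### Counting types -/

lemma card_fiber_mul_card {G H : Type*} [AddGroup G] [AddGroup H] [Fintype G] [Fintype H]
    [DecidableEq H] (f : G →+ H) (hf : Function.Surjective f) (y : H) :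
    (Finset.univ.filter fun x => f x = y).card * Fintype.card H = Fintype.card G := by
  have h : ∀ z : H, (Finset.univ.filter fun x => f x = z).card
      = (Finset.univ.filter fun x => f x = y).card := fun z =>
    AddMonoidHom.card_fiber_eq_of_mem_range f (hf z) (hf y)
  have := Finset.card_eq_sum_card_fiberwise (f := f) (s := Finset.univ) (t := Finset.univ)
    fun _ _ => Finset.mem_univ _
  rw [← Finset.card_univ (α := G), this, Finset.sum_congr rfl fun z _ => h z]
  simp [mul_comm]

section Types

variable {T : Type*} [Fintype T] [DecidableEq T]

/-- `N` times the relative entropy of the type `n` of a sequence of length `N` with respect to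
the uniform law. -/
def typeDiv (N : ℕ) (n : T → ℕ) : ℝ :=
  ∑ z, (n z : ℝ) * Real.log (n z * Fintype.card T / N)

lemma prod_pow_eq_exp_typeDiv [Nonempty T] {N : ℕ} (hN : 0 < N) (n : T → ℕ) :
    ∏ z, ((n z : ℝ) * Fintype.card T / N) ^ n z = Real.exp (typeDiv N n) := by
  rw [typeDiv, Real.exp_sum]
  refine Finset.prod_congr rfl fun z _ => ?_
  rcases Nat.eq_zero_or_pos (n z) with h | h
  · simp [h]
  · have : 0 < (n z : ℝ) * Fintype.card T / N := by
      have : 0 < Fintype.card T := Fintype.card_pos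
      positivity
    rw [Real.exp_nat_mul, Real.exp_log this]

/-- Under independent geometric weights (1 - x)x^k on the letters, all types together weigh at most
1, and each weighs (1 - x)^b x^N. The value x = N/(N + b) maximizes this weight. The cruder count (N
+ 1)^b would later put w into κ, which is too much when w is close to ℓ. -/
lemma card_types_le [Nonempty T] {N : ℕ} (hN : 0 < N) :
    ((Finset.piAntidiag (Finset.univ : Finset T) N).card : ℝ)
      ≤ (Real.exp 1 * (1 + N / Fintype.card T)) ^ Fintype.card T := by
  set b := Fintype.card T with hb
  have hb0 : 0 < b := Fintype.card_pos
  have hbR : (0 : ℝ) < b := by exact_mod_cast hb0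
  have hNR : (0 : ℝ) < N := by exact_mod_cast hN
  set x : ℝ := N / (N + b) with hx
  have hx0 : 0 < x := by positivity
  have hx1 : 1 - x = b / (N + b) := by rw [hx]; field_simp; ring
  have hx2 : 0 < 1 - x := by rw [hx1]; positivity
  have key : ((Finset.piAntidiag (Finset.univ : Finset T) N).card : ℝ)
      * ((1 - x) ^ b * x ^ N) ≤ 1 := by
    have h1 : ∀ n ∈ Finset.piAntidiag (Finset.univ : Finset T) N,
        ∏ z, ((1 - x) * x ^ n z) = (1 - x) ^ b * x ^ N := by
      intro n hn
      rw [Finset.prod_mul_distrib, Finset.prod_const, Finset.card_univ, Finset.prod_pow_eq_pow_sum,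
        (Finset.mem_piAntidiag.1 hn).1]
    rw [← nsmul_eq_mul, ← Finset.sum_const, ← Finset.sum_congr rfl h1]
    have hsub : Finset.piAntidiag (Finset.univ : Finset T) N
        ⊆ Fintype.piFinset fun _ : T => Finset.range (N + 1) := by
      intro n hn
      rw [Fintype.mem_piFinset]
      intro z
      rw [Finset.mem_range, Nat.lt_succ_iff, ← (Finset.mem_piAntidiag.1 hn).1]
      exact Finset.single_le_sum (f := n) (fun _ _ => Nat.zero_le _) (Finset.mem_univ z)
    refine (Finset.sum_le_sum_of_subset_of_nonneg hsub fun n _ _ =>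
      Finset.prod_nonneg fun z _ => by positivity).trans ?_
    rw [← Finset.prod_univ_sum (fun _ : T => Finset.range (N + 1)) fun _ i => (1 - x) * x ^ i]
    refine Finset.prod_le_one (fun z _ => Finset.sum_nonneg fun i _ => by positivity) fun z _ => ?_
    rw [← Finset.mul_sum, mul_neg_geom_sum]
    have : 0 < x ^ (N + 1) := by positivity
    linarith
  have hinv : Real.exp b * (1 + N / b) ^ b * ((1 - x) ^ b * x ^ N) ≥ 1 := by
    have e1 : (1 + N / b : ℝ) ^ b * (1 - x) ^ b = 1 := by
      rw [← mul_pow, hx1]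
      have : (1 + N / b : ℝ) * (b / (N + b)) = 1 := by field_simp; ring
      rw [this, one_pow]
    have e2 : 1 ≤ Real.exp b * x ^ N := by
      have : Real.exp b = Real.exp (b / N) ^ N := by
        rw [← Real.exp_nat_mul]; congr 1; field_simp
      rw [this, ← mul_pow]
      refine one_le_pow₀ ?_
      have h1 := Real.add_one_le_exp ((b : ℝ) / N)
      calc (1 : ℝ) = (b / N + 1) * x := by rw [hx]; field_simp; ring
        _ ≤ _ := mul_le_mul_of_nonneg_right h1 hx0.le
    calc Real.exp b * (1 + N / b) ^ b * ((1 - x) ^ b * x ^ N)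
        = (Real.exp b * x ^ N) * ((1 + N / b : ℝ) ^ b * (1 - x) ^ b) := by ring
      _ ≥ 1 := by rw [e1, mul_one]; exact e2
  have hpos : 0 < (1 - x) ^ b * x ^ N := by positivity
  rw [mul_pow, ← Real.exp_nat_mul, mul_one]
  exact le_of_mul_le_mul_right (key.trans hinv) hpos

/-- Large deviations of a random type, by the method of types. -/
theorem card_typeDiv_gt_le [Nonempty T] {Ω : Type*} [Fintype Ω] {N : ℕ} (hN : 0 < N)
    (cnt : Ω → T → ℕ) (hcnt : ∀ ω, ∑ z, cnt ω z = N) {P : ℝ} (hP0 : 0 ≤ P)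
    (hP : ∀ n : T → ℕ, ∑ z, n z = N →
      ((Finset.univ.filter fun ω => cnt ω = n).card : ℝ)
      * ∏ z, ((n z : ℝ) * Fintype.card T / N) ^ n z ≤ P) (L : ℝ)
    [DecidablePred fun ω => L < typeDiv N (cnt ω)] :
    ((Finset.univ.filter fun ω => L < typeDiv N (cnt ω)).card : ℝ)
      ≤ P * Real.exp (-L) * (Real.exp 1 * (1 + N / Fintype.card T)) ^ Fintype.card T := by
  classical
  have hmaps : ∀ ω ∈ Finset.univ.filter fun ω => L < typeDiv N (cnt ω),
      cnt ω ∈ Finset.piAntidiag (Finset.univ : Finset T) N := fun ω _ =>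
    Finset.mem_piAntidiag.2 ⟨hcnt ω, fun _ _ => Finset.mem_univ _⟩
  rw [Finset.card_eq_sum_card_fiberwise hmaps]
  push_cast
  calc ∑ n ∈ Finset.piAntidiag (Finset.univ : Finset T) N,
        ((Finset.filter (fun ω => cnt ω = n)
          (Finset.univ.filter fun ω => L < typeDiv N (cnt ω))).card : ℝ)
      ≤ ∑ n ∈ Finset.piAntidiag (Finset.univ : Finset T) N, P * Real.exp (-L) := by
        refine Finset.sum_le_sum fun n hn => ?_
        -- A type of divergence above `L` is hit by at most P·exp(-L) outcomes, by hypothesis; any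
        -- other type meets no outcome in the filter.
        by_cases hL : L < typeDiv N n
        · have h1 := hP n (Finset.mem_piAntidiag.1 hn).1
          rw [prod_pow_eq_exp_typeDiv hN] at h1
          have h2 : ((Finset.filter (fun ω => cnt ω = n)
              (Finset.univ.filter fun ω => L < typeDiv N (cnt ω))).card : ℝ)
              ≤ ((Finset.univ.filter fun ω => cnt ω = n).card : ℝ) := by
            exact_mod_cast Finset.card_le_card
              (Finset.filter_subset_filter _ (Finset.filter_subset _ _))
          have h3 : Real.exp L ≤ Real.exp (typeDiv N n) := Real.exp_le_exp.2 hL.le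
          have h4 : ((Finset.univ.filter fun ω => cnt ω = n).card : ℝ) * Real.exp L ≤ P :=
            (mul_le_mul_of_nonneg_left h3 (Nat.cast_nonneg _)).trans h1
          rw [Real.exp_neg, ← div_eq_mul_inv, le_div_iff₀ (Real.exp_pos _)]
          exact (mul_le_mul_of_nonneg_right h2 (Real.exp_pos _).le).trans h4
        · rw [Finset.filter_eq_empty_iff.2]
          · simp only [Finset.card_empty, Nat.cast_zero]
            positivity
          · intro ω hω h
            rw [Finset.mem_filter, h] at hω
            exact hL hω.2
    _ = (Finset.piAntidiag (Finset.univ : Finset T) N).card * (P * Real.exp (-L)) := by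
        rw [Finset.sum_const, nsmul_eq_mul]
    _ ≤ _ := by
        rw [mul_comm]
        exact mul_le_mul_of_nonneg_left (card_types_le hN) (by positivity)

/-- The probability that independent uniform letters have a given type. -/
theorem card_function_type_le {A G C : Type*} [Fintype A] [DecidableEq A] [Fintype G]
    [DecidableEq G] [Nonempty T]
    (S : Finset C) (hS : 0 < S.card) (h : C → A) (hinj : Set.InjOn h S) (θ : C → G → T)
    (hθ : ∀ c ∈ S, ∀ z, (Finset.univ.filter fun y => θ c y = z).card * Fintype.card T
      = Fintype.card G) (n : T → ℕ) (hn : ∑ z, n z = S.card) :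
    ((Finset.univ.filter fun φ : A → G =>
        (fun z => (S.filter fun c => θ c (φ (h c)) = z).card) = n).card : ℝ)
      * ∏ z, ((n z : ℝ) * Fintype.card T / S.card) ^ n z ≤ Fintype.card (A → G) := by
  have hb : (0 : ℝ) < Fintype.card T := by exact_mod_cast Fintype.card_pos
  have hN : (0 : ℝ) < S.card := by exact_mod_cast hS
  -- The density of the type with respect to the uniform law. The product of the densities of the
  -- letters has mean 1, and on the event that the type is `n` it is the constant ∏ q^n; Markov's
  -- inequality follows.
  set q : T → ℝ := fun z => (n z : ℝ) * Fintype.card T / S.card with hq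
  have hq0 : ∀ z, 0 ≤ q z := fun z => by positivity
  have hqs : ∑ z, q z = Fintype.card T := by
    simp only [hq]
    rw [← Finset.sum_div, ← Finset.sum_mul, ← Nat.cast_sum, hn]
    field_simp
  have hsum : ∑ φ : A → G, ∏ c ∈ S, q (θ c (φ (h c))) = Fintype.card (A → G) := by
    -- Independence: since `h` is injective on `S`, each coordinate of φ enters at most one letter.
    have h1 : ∀ φ : A → G, ∏ c ∈ S, q (θ c (φ (h c)))
        = ∏ a, ∏ c ∈ S.filter (fun c => h c = a), q (θ c (φ a)) := by
      intro φ
      rw [← Finset.prod_fiberwise (s := S) (g := h)]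
      refine Finset.prod_congr rfl fun a _ => Finset.prod_congr rfl fun c hc => ?_
      rw [(Finset.mem_filter.1 hc).2]
    simp_rw [h1]
    rw [sum_prod_pi fun a y => ∏ c ∈ S.filter (fun c => h c = a), q (θ c y)]
    have h2 : ∀ a, ∑ y : G, ∏ c ∈ S.filter (fun c => h c = a), q (θ c y) = Fintype.card G := by
      intro a
      rcases (S.filter fun c => h c = a).eq_empty_or_nonempty with he | ⟨c, hc⟩
      · simp [he]
      · have hs : S.filter (fun c => h c = a) = {c} := by
          ext c'
          rw [Finset.mem_singleton]
          constructor
          · intro hc'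
            rw [Finset.mem_filter] at hc hc'
            exact hinj hc'.1 hc.1 (hc'.2.trans hc.2.symm)
          · rintro rfl; exact hc
        rw [hs]
        simp only [Finset.prod_singleton]
        have hcS := (Finset.mem_filter.1 hc).1
        rw [← Finset.sum_fiberwise (s := Finset.univ) (g := θ c)]
        have : ∀ z, ∑ y ∈ Finset.univ.filter (fun y => θ c y = z), q (θ c y)
            = (Fintype.card G / Fintype.card T : ℝ) * q z := by
          intro z
          rw [Finset.sum_congr rfl fun y hy => by rw [(Finset.mem_filter.1 hy).2],
            Finset.sum_const, nsmul_eq_mul]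
          congr 1
          rw [eq_div_iff hb.ne']
          exact_mod_cast hθ c hcS z
        simp_rw [this]
        rw [← Finset.mul_sum, hqs]
        field_simp
    simp_rw [h2]
    simp
  rw [← hsum, ← nsmul_eq_mul, ← Finset.sum_const]
  refine (Finset.sum_le_sum fun φ hφ => le_of_eq ?_).trans
    (Finset.sum_le_sum_of_subset_of_nonneg (Finset.filter_subset _ _)
      fun φ _ _ => Finset.prod_nonneg fun c _ => hq0 _)
  rw [← Finset.prod_fiberwise (s := S) (g := fun c => θ c (φ (h c)))]
  refine Finset.prod_congr rfl fun z _ => ?_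
  rw [Finset.prod_congr rfl fun c hc => by rw [(Finset.mem_filter.1 hc).2], Finset.prod_const]
  exact congrArg _ (congrFun (Finset.mem_filter.1 hφ).2 z).symm

end Types

/-- The largest term of the binomial expansion of `M ^ M = (N + (M - N)) ^ M`. -/
lemma pow_self_le_choose_mul {M N : ℕ} (hNM : N ≤ M) :
    M ^ M ≤ (M + 1) * (M.choose N * (N ^ N * (M - N) ^ (M - N))) := by
  obtain ⟨D, rfl⟩ := Nat.exists_eq_add_of_le hNM
  set t : ℕ → ℕ := fun i => N ^ i * D ^ (N + D - i) * (N + D).choose i with ht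
  -- The ratio of consecutive terms, cleared of denominators. The terms do not decrease up to index
  -- N and do not increase after it.
  have hrec : ∀ i < N + D, t (i + 1) * ((i + 1) * D) = t i * ((N + D - i) * N) := by
    intro i hi
    have h1 := Nat.choose_succ_right_eq (N + D) i
    have h2 : D ^ (N + D - i) = D ^ (N + D - (i + 1)) * D := by
      rw [← pow_succ]; congr 1; omega
    simp only [ht]
    rw [h2, pow_succ]
    calc N ^ i * N * D ^ (N + D - (i + 1)) * (N + D).choose (i + 1) * ((i + 1) * D)
        = N ^ i * N * D ^ (N + D - (i + 1)) * D * ((N + D).choose (i + 1) * (i + 1)) := by ring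
      _ = _ := by rw [h1]; ring
  have hup : ∀ i < N, t i ≤ t (i + 1) := by
    intro i hi
    have h := hrec i (by omega)
    rcases Nat.eq_zero_or_pos D with hD | hD
    · subst hD
      have : t i = 0 := by
        simp only [ht]
        rw [zero_pow (by omega)]; simp
      omega
    have h1 : (i + 1) * D ≤ (N + D - i) * N := by
      rw [mul_comm]
      exact Nat.mul_le_mul (by omega) hi
    refine Nat.le_of_mul_le_mul_right ?_ (Nat.mul_pos (Nat.succ_pos i) hD)
    calc t i * ((i + 1) * D) ≤ t i * ((N + D - i) * N) := Nat.mul_le_mul_left _ h1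
      _ = _ := h.symm
  have hdown : ∀ i, N ≤ i → i < N + D → t (i + 1) ≤ t i := by
    intro i hi hi'
    have h := hrec i hi'
    have hD : 0 < D := by omega
    have h1 : (N + D - i) * N ≤ (i + 1) * D := by
      rw [mul_comm (i + 1)]
      exact Nat.mul_le_mul (by omega) (by omega)
    refine Nat.le_of_mul_le_mul_right ?_ (Nat.mul_pos (Nat.succ_pos i) hD)
    calc t (i + 1) * ((i + 1) * D) = _ := h
      _ ≤ _ := Nat.mul_le_mul_left _ h1
  have hA : ∀ k ≤ N, t (N - k) ≤ t N := by
    intro k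
    induction k with
    | zero => intro _; simp
    | succ k ih =>
      intro hk
      have := hup (N - (k + 1)) (by omega)
      rw [show N - (k + 1) + 1 = N - k by omega] at this
      exact this.trans (ih (by omega))
  have hB : ∀ k ≤ D, t (N + k) ≤ t N := by
    intro k
    induction k with
    | zero => intro _; simp
    | succ k ih =>
      intro hk
      exact (hdown (N + k) (by omega) (by omega)).trans (ih (by omega))
  have hmax : ∀ i ∈ Finset.range (N + D + 1), t i ≤ t N := by
    intro i hi
    rw [Finset.mem_range] at hi
    rcases le_total i N with h | h
    · have := hA (N - i) (by omega)
      rwa [show N - (N - i) = i by omega] at this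
    · have := hB (i - N) (by omega)
      rwa [show N + (i - N) = i by omega] at this
  have hbin := add_pow N D (N + D)
  have := Finset.sum_le_card_nsmul _ _ _ hmax
  rw [Finset.card_range, smul_eq_mul] at this
  calc (N + D) ^ (N + D) = ∑ i ∈ Finset.range (N + D + 1), t i := by
        rw [hbin]
        refine Finset.sum_congr rfl fun i _ => ?_
        simp only [ht]; norm_cast
    _ ≤ (N + D + 1) * t N := this
    _ = _ := by
        simp only [ht, Nat.add_sub_cancel_left]
        ring

/-! ### Random permutations -/

section Perm

variable {X : Type*} [Fintype X] [DecidableEq X]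

lemma exists_perm_map_eq {S A : Finset X} (h : S.card = A.card) :
    ∃ g : Equiv.Perm X, S.map g.toEmbedding = A := by
  have e : {x // x ∈ S} ≃ {x // x ∈ A} := Finset.equivOfCardEq h
  refine ⟨e.extendSubtype, ?_⟩
  refine Finset.eq_of_subset_of_card_le ?_ (by rw [Finset.card_map, h])
  intro y hy
  obtain ⟨x, hx, rfl⟩ := Finset.mem_map.1 hy
  exact e.extendSubtype_mem x hx

/-- The image of a fixed set under a uniform permutation is a uniform set of the same size. -/
lemma choose_mul_sum_perm (S : Finset X) (f : Finset X → ℝ) :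
    ((Fintype.card X).choose S.card : ℝ) * ∑ π : Equiv.Perm X, f (S.map π.toEmbedding)
      = (Fintype.card X).factorial * ∑ A ∈ Finset.powersetCard S.card Finset.univ, f A := by
  -- Permutations act transitively on sets of a given size, so the sum over permutations is the same
  -- for each starting set. Summing over all starting sets and exchanging the sums gives the claim.
  have h1 : ∀ A ∈ Finset.powersetCard S.card (Finset.univ : Finset X),
      ∑ π : Equiv.Perm X, f (A.map π.toEmbedding) = ∑ π : Equiv.Perm X, f (S.map π.toEmbedding) := by
    intro A hA
    obtain ⟨g, rfl⟩ := exists_perm_map_eq (Finset.mem_powersetCard.1 hA).2.symm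
    rw [← Equiv.sum_comp (Equiv.mulRight g) fun π : Equiv.Perm X => f (S.map π.toEmbedding)]
    refine Finset.sum_congr rfl fun π _ => ?_
    rw [Finset.map_map]
    rfl
  have h2 := Finset.sum_congr rfl h1
  rw [Finset.sum_const, Finset.card_powersetCard, Finset.card_univ, nsmul_eq_mul,
    Finset.sum_comm] at h2
  rw [← h2]
  have h3 : ∀ π : Equiv.Perm X,
      ∑ A ∈ Finset.powersetCard S.card (Finset.univ : Finset X), f (A.map π.toEmbedding)
        = ∑ A ∈ Finset.powersetCard S.card Finset.univ, f A := by
    intro π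
    refine Finset.sum_equiv π.finsetCongr (fun A => ?_) fun A _ => rfl
    simp [Finset.mem_powersetCard]
  simp_rw [h3]
  rw [Finset.sum_const, Finset.card_univ, Fintype.card_perm, nsmul_eq_mul]

variable {T : Type*} [Fintype T] [DecidableEq T]

/-- The number of subsets with a given type, weighted. -/
lemma card_subset_type_mul_le (pr : X → T) {R : ℕ}
    (hpr : ∀ z, (Finset.univ.filter fun x => pr x = z).card = R) (N : ℕ) (n : T → ℕ) (s : T → ℝ)
    (hs : ∀ z, 0 ≤ s z) :
    (((Finset.powersetCard N (Finset.univ : Finset X)).filter fun A =>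
        (fun z => (A.filter fun x => pr x = z).card) = n).card : ℝ) * ∏ z, s z ^ n z
      ≤ ∏ z, (1 + s z) ^ R := by
  have h1 : ∏ x : X, (1 + s (pr x)) = ∏ z, (1 + s z) ^ R := by
    rw [← Finset.prod_fiberwise (s := Finset.univ) (g := pr)]
    refine Finset.prod_congr rfl fun z _ => ?_
    rw [Finset.prod_congr rfl fun x hx => by rw [(Finset.mem_filter.1 hx).2], Finset.prod_const,
      hpr]
  -- The product of 1 + s over all points expands into a sum over all subsets, in which a subset of
  -- type `n` contributes ∏ s^n.
  rw [← h1, Finset.prod_one_add, ← nsmul_eq_mul, ← Finset.sum_const]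
  refine (Finset.sum_le_sum fun A hA => le_of_eq ?_).trans
    (Finset.sum_le_sum_of_subset_of_nonneg (t := Finset.univ.powerset) (fun A _ => ?_)
      fun A _ _ => Finset.prod_nonneg fun c _ => hs _)
  · rw [← Finset.prod_fiberwise (s := A) (g := pr)]
    refine Finset.prod_congr rfl fun z _ => ?_
    rw [Finset.prod_congr rfl fun x hx => by rw [(Finset.mem_filter.1 hx).2], Finset.prod_const]
    exact congrArg _ (congrFun (Finset.mem_filter.1 hA).2 z).symm
  · simp

/-- The probability that a set has a given type after a uniform permutation. -/
theorem card_perm_type_le [Nonempty T] (S : Finset X) (hS : 0 < S.card) (pr : X → T) {R : ℕ}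
    (hpr : ∀ z, (Finset.univ.filter fun x => pr x = z).card = R) (n : T → ℕ)
    (hn : ∑ z, n z = S.card) :
    ((Finset.univ.filter fun π : Equiv.Perm X =>
        (fun z => (S.filter fun c => pr (π c) = z).card) = n).card : ℝ)
      * ∏ z, ((n z : ℝ) * Fintype.card T / S.card) ^ n z
      ≤ Fintype.card (Equiv.Perm X) * (Fintype.card X + 1) := by
  set b := Fintype.card T with hb
  set M := Fintype.card X with hM
  set N := S.card with hN
  have hb0 : 0 < b := Fintype.card_pos
  have hbR : (0 : ℝ) < b := by exact_mod_cast hb0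
  have hNR : (0 : ℝ) < N := by exact_mod_cast hS
  have hMR : M = b * R := by
    rw [hM, ← Finset.card_univ, Finset.card_eq_sum_card_fiberwise (f := pr) (t := Finset.univ)
      fun _ _ => Finset.mem_univ _, Finset.sum_congr rfl fun z _ => hpr z]
    simp [hb]
  have hNM : N ≤ M := Finset.card_le_univ S
  have hM0 : (0 : ℝ) < M := by exact_mod_cast hS.trans_le hNM
  rw [Fintype.card_perm]
  -- If `S` is everything, its type is forced to be uniform; the weights used below would divide by
  -- M - N = 0.
  rcases hNM.eq_or_lt with hEq | hlt
  · have hSu : S = Finset.univ := Finset.eq_univ_of_card S hEq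
    rcases (Finset.univ.filter fun π : Equiv.Perm X =>
        (fun z => (S.filter fun c => pr (π c) = z).card) = n).eq_empty_or_nonempty with he | ⟨π, hπ⟩
    · rw [he]; simp only [Finset.card_empty, Nat.cast_zero, zero_mul]; positivity
    · have hnR : ∀ z, n z = R := by
        intro z
        rw [← congrFun (Finset.mem_filter.1 hπ).2 z, ← hpr z, hSu]
        refine Finset.card_equiv π fun c => ?_
        simp
      have h1 : ∏ z, ((n z : ℝ) * b / N) ^ n z = 1 := by
        refine Finset.prod_eq_one fun z _ => ?_
        rw [hnR z, hEq, hMR]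
        push_cast
        rw [mul_comm (R : ℝ), div_self, one_pow]
        have : (M : ℝ) = b * R := by exact_mod_cast hMR
        rw [← this]; exact hM0.ne'
      rw [h1, mul_one]
      calc ((Finset.univ.filter fun π : Equiv.Perm X =>
            (fun z => (S.filter fun c => pr (π c) = z).card) = n).card : ℝ)
          ≤ (Fintype.card (Equiv.Perm X) : ℝ) := by exact_mod_cast Finset.card_le_univ _
        _ = M.factorial * 1 := by rw [Fintype.card_perm, mul_one]
        _ ≤ _ := mul_le_mul_of_nonneg_left (by linarith) (by positivity)
  obtain ⟨D, hD⟩ := Nat.exists_eq_add_of_lt hlt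
  have hDM : M - N = D + 1 := by omega
  set d : ℝ := (D : ℝ) + 1 with hd
  have hd0 : 0 < d := by positivity
  have hMd : (M : ℝ) = N + d := by rw [hD, hd]; push_cast; ring
  have hMbR : (M : ℝ) = b * R := by exact_mod_cast hMR
  have hR0 : (0 : ℝ) < R := by
    by_contra! h
    have : (M : ℝ) ≤ 0 := by rw [hMbR]; exact mul_nonpos_of_nonneg_of_nonpos hbR.le h
    linarith
  -- The tilt n_z b/(M - N): ∏ s^n is then the wanted density product times (N/d)^N, and the factors
  -- 1 + s have mean M/d.
  set s : T → ℝ := fun z => n z * b / d with hs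
  have hs0 : ∀ z, 0 ≤ s z := fun z => by positivity
  set cA : ℝ := (((Finset.powersetCard N (Finset.univ : Finset X)).filter fun A =>
        (fun z => (A.filter fun x => pr x = z).card) = n).card : ℝ) with hcA
  have hA : cA * ∏ z, s z ^ n z ≤ ∏ z, (1 + s z) ^ R := card_subset_type_mul_le pr hpr N n s hs0
  have hB : ∏ z, (1 + s z) ^ R ≤ ((M : ℝ) / d) ^ M := by
    -- From 1 + x ≤ exp x around the mean; the exponents n_z - N/b cancel in the product because the
    -- n_z sum to N.
    have h1 : ∀ z, (1 + s z) ^ R ≤ (M / d) ^ R * Real.exp (n z - N / b) := by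
      intro z
      have e : 1 + s z = (M / d) * ((n z - N / b) / R + 1) := by
        simp only [hs]
        have : (R : ℝ) = M / b := by rw [hMbR]; field_simp
        rw [this]
        field_simp
        rw [hMd]
        ring
      have h2 := Real.add_one_le_exp ((n z - N / b) / (R : ℝ))
      have h3 : 0 ≤ 1 + s z := by have := hs0 z; positivity
      calc (1 + s z) ^ R ≤ ((M / d) * Real.exp ((n z - N / b) / R)) ^ R := by
            refine pow_le_pow_left₀ h3 ?_ R
            rw [e]
            exact mul_le_mul_of_nonneg_left h2 (by positivity)
        _ = _ := by
            rw [mul_pow, ← Real.exp_nat_mul]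
            congr 2
            field_simp
    refine (Finset.prod_le_prod (fun z _ => by have := hs0 z; positivity) fun z _ => h1 z).trans_eq ?_
    rw [Finset.prod_mul_distrib, Finset.prod_const, ← Real.exp_sum, Finset.sum_sub_distrib,
      ← Nat.cast_sum, hn, Finset.sum_const, Finset.card_univ, nsmul_eq_mul, ← pow_mul, ← hb,
      mul_div_cancel₀ _ hbR.ne', sub_self, Real.exp_zero, mul_one, hMR, mul_comm R b]
  have hC : ∏ z, s z ^ n z = (∏ z, ((n z : ℝ) * b / N) ^ n z) * (N / d) ^ N := by
    rw [← hn, ← Finset.prod_pow_eq_pow_sum, ← Finset.prod_mul_distrib]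
    refine Finset.prod_congr rfl fun z _ => ?_
    rw [← mul_pow, hn]
    congr 1
    simp only [hs]
    field_simp
  set q : ℝ := ∏ z, ((n z : ℝ) * b / N) ^ n z with hq
  have hq0 : 0 ≤ q := Finset.prod_nonneg fun z _ => by positivity
  have hD1 := choose_mul_sum_perm S fun A =>
    if (fun z => (A.filter fun x => pr x = z).card) = n then (1 : ℝ) else 0
  rw [Finset.sum_boole, Finset.sum_boole] at hD1
  have hD2 : (Finset.univ.filter fun π : Equiv.Perm X =>
      (fun z => ((S.map π.toEmbedding).filter fun x => pr x = z).card) = n)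
      = Finset.univ.filter fun π : Equiv.Perm X =>
        (fun z => (S.filter fun c => pr (π c) = z).card) = n := by
    ext π
    simp only [Finset.filter_map, Finset.card_map]
    rfl
  rw [hD2] at hD1
  set cP : ℝ := ((Finset.univ.filter fun π : Equiv.Perm X =>
        (fun z => (S.filter fun c => pr (π c) = z).card) = n).card : ℝ) with hcP
  change (M.choose N : ℝ) * cP = M.factorial * cA at hD1
  -- Returns from the generating function to the number of N-subsets. Its factor M + 1 is the whole
  -- cost of drawing without replacement.
  have hE : (M : ℝ) ^ M ≤ (M + 1) * (M.choose N * ((N : ℝ) ^ N * d ^ (M - N))) := by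
    have := pow_self_le_choose_mul hNM
    rw [hDM] at this ⊢
    have h2 : ((M ^ M : ℕ) : ℝ) ≤ (((M + 1) * (M.choose N * (N ^ N * (D + 1) ^ (D + 1))) : ℕ) : ℝ) := by
      exact_mod_cast this
    push_cast at h2
    exact h2
  have hch : (0 : ℝ) < M.choose N := by exact_mod_cast Nat.choose_pos hNM
  have hF : cA * q * (N : ℝ) ^ N * d ^ (M - N) ≤ (M : ℝ) ^ M := by
    have h1 := hA.trans hB
    rw [hC, div_pow, div_pow] at h1
    have h2 : d ^ M = d ^ (M - N) * d ^ N := by rw [← pow_add]; congr 1; omega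
    rw [h2] at h1
    have h3 := mul_le_mul_of_nonneg_right h1 (by positivity : 0 ≤ d ^ (M - N) * d ^ N)
    rw [div_mul_cancel₀ _ (by positivity)] at h3
    refine le_trans (le_of_eq ?_) h3
    field_simp
  have hG : cA * q ≤ (M + 1) * M.choose N := by
    have hpos : 0 < (N : ℝ) ^ N * d ^ (M - N) := by positivity
    refine le_of_mul_le_mul_right ?_ hpos
    calc cA * q * ((N : ℝ) ^ N * d ^ (M - N)) = cA * q * (N : ℝ) ^ N * d ^ (M - N) := by ring
      _ ≤ _ := hF
      _ ≤ _ := hE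
      _ = _ := by ring
  refine le_of_mul_le_mul_left ?_ hch
  calc (M.choose N : ℝ) * (cP * q) = M.factorial * (cA * q) := by rw [← mul_assoc, hD1]; ring
    _ ≤ M.factorial * ((M + 1) * M.choose N) := mul_le_mul_of_nonneg_left hG (by positivity)
    _ = _ := by ring

end Perm

/-! ### Types of the restrictions of a bijection to subcubes -/

lemma exists_forall_not_of_sum_card_lt {Ω E : Type*} [Fintype Ω] (s : Finset E)
    (bad : E → Ω → Prop) [∀ e, DecidablePred (bad e)]
    (h : ∑ e ∈ s, ((Finset.univ.filter fun ω => bad e ω).card : ℝ) < Fintype.card Ω) :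
    ∃ ω, ∀ e ∈ s, ¬ bad e ω := by
  classical
  by_contra! hall
  have h1 : (Finset.univ : Finset Ω) ⊆ s.biUnion fun e => Finset.univ.filter fun ω => bad e ω := by
    intro ω _
    obtain ⟨e, he, hb⟩ := hall ω
    exact Finset.mem_biUnion.2 ⟨e, he, Finset.mem_filter.2 ⟨Finset.mem_univ _, hb⟩⟩
  have h2 := (Finset.card_le_card h1).trans Finset.card_biUnion_le
  rw [Finset.card_univ] at h2
  have h3 : (Fintype.card Ω : ℝ) ≤ ∑ e ∈ s, ((Finset.univ.filter fun ω => bad e ω).card : ℝ) := by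
    exact_mod_cast h2
  linarith

section Cube

variable {ι : Type*} [Fintype ι] [DecidableEq ι]

/-- The vectors that agree with `c₀` off `F`. -/
def cube (F : Finset ι) (c₀ : ι → ZMod 2) : Finset (ι → ZMod 2) :=
  Finset.univ.filter fun c => ∀ i, i ∉ F → c i = c₀ i

lemma mem_cube {F : Finset ι} {c₀ c : ι → ZMod 2} : c ∈ cube F c₀ ↔ ∀ i, i ∉ F → c i = c₀ i := by
  simp [cube]

lemma card_cube (F : Finset ι) (c₀ : ι → ZMod 2) : (cube F c₀).card = 2 ^ F.card := by
  have : cube F c₀ = Fintype.piFinset fun i => if i ∈ F then Finset.univ else {c₀ i} := by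
    ext c
    rw [mem_cube, Fintype.mem_piFinset]
    refine forall_congr' fun i => ?_
    by_cases hi : i ∈ F <;> simp [hi]
  rw [this, Fintype.card_piFinset]
  have h2 : ∀ i, (if i ∈ F then (Finset.univ : Finset (ZMod 2)) else {c₀ i}).card
      = if i ∈ F then 2 else 1 := by
    intro i
    split_ifs
    · rw [Finset.card_univ, ZMod.card]
    · rfl
  simp_rw [h2]
  rw [Finset.prod_ite_mem, Finset.univ_inter, Finset.prod_const]

/-- For every `z`, the number of points of the subcube whose image under `π` shows `z` on `W`. -/
def cubeType (π : (ι → ZMod 2) → (ι → ZMod 2)) (W F : Finset ι) (c₀ : ι → ZMod 2)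
    (z : ↥W → ZMod 2) : ℕ :=
  ((cube F c₀).filter fun c => (fun i : ↥W => π c i) = z).card

lemma sum_cubeType (π : (ι → ZMod 2) → (ι → ZMod 2)) (W F : Finset ι) (c₀ : ι → ZMod 2) :
    ∑ z, cubeType π W F c₀ z = 2 ^ F.card := by
  rw [← card_cube F c₀]
  exact (Finset.card_eq_sum_card_fiberwise fun _ _ => Finset.mem_univ _).symm

lemma card_bits (ι : Type*) [Fintype ι] [DecidableEq ι] :
    Fintype.card (ι → ZMod 2) = 2 ^ Fintype.card ι := by
  rw [Fintype.card_fun, ZMod.card]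

lemma restrict_surjective (W : Finset ι) :
    Function.Surjective fun (c : ι → ZMod 2) (i : ↥W) => c i := by
  intro z
  refine ⟨fun i => if h : i ∈ W then z ⟨i, h⟩ else 0, funext fun i => ?_⟩
  simp

/-- The restriction of vectors to `W`. -/
def restrictHom (W : Finset ι) : (ι → ZMod 2) →+ (↥W → ZMod 2) where
  toFun c i := c i
  map_zero' := rfl
  map_add' _ _ := rfl

lemma card_restrict_fiber (W : Finset ι) (z : ↥W → ZMod 2) :
    (Finset.univ.filter fun c : ι → ZMod 2 => (fun i : ↥W => c i) = z).card * 2 ^ W.card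
      = 2 ^ Fintype.card ι := by
  have := card_fiber_mul_card (restrictHom W) (restrict_surjective W) z
  rw [card_bits, card_bits, Fintype.card_coe] at this
  exact this

lemma two_pow_le_exp (n : ℕ) : (2 : ℝ) ^ n ≤ Real.exp n := by
  rw [← mul_one (n : ℝ), Real.exp_nat_mul]
  refine pow_le_pow_left₀ two_pos.le ?_ n
  have := Real.add_one_le_exp (1 : ℝ)
  linarith

/-- Per letter the number of types costs e(1 + 2^u) ≤ exp(u + 2), with no dependence on w. -/
lemma types_factor_le (w u : ℕ) :
    (Real.exp 1 * (1 + (2 ^ (w + u) : ℕ) / (2 ^ w : ℕ) : ℝ)) ^ (2 ^ w)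
      ≤ Real.exp ((2 ^ w : ℕ) * (u + 2)) := by
  rw [Real.exp_nat_mul]
  refine pow_le_pow_left₀ (by positivity) ?_ _
  have h1 : ((2 ^ (w + u) : ℕ) / (2 ^ w : ℕ) : ℝ) = 2 ^ u := by
    push_cast
    rw [pow_add]
    field_simp
  have h2 : (1 : ℝ) ≤ 2 ^ u := one_le_pow₀ one_le_two
  have h3 := two_pow_le_exp (u + 1)
  rw [pow_succ] at h3
  push_cast at h3
  rw [h1, show (u : ℝ) + 2 = 1 + (u + 1) by ring, Real.exp_add]
  refine mul_le_mul_of_nonneg_left ?_ (Real.exp_pos _).le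
  linarith

/-- A random permutation is good on all subcubes when many links are observed. -/
theorem exists_perm_typeDiv_le_of_large {w u : ℕ} (hw : Fintype.card ι ≤ 2 ^ w) {κ : ℝ}
    (hκ : u + 8 ≤ κ) :
    ∃ π : Equiv.Perm (ι → ZMod 2), ∀ W F : Finset ι, W.card = w → F.card = w + u →
      ∀ c₀, typeDiv (2 ^ (w + u)) (cubeType π W F c₀) ≤ 2 ^ w * κ := by
  classical
  set ℓ := Fintype.card ι with hℓ
  set E : Finset (Finset ι × Finset ι × (ι → ZMod 2)) := Finset.univ.filter fun e =>
    e.1.card = w ∧ e.2.1.card = w + u with hE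
  set bad : (Finset ι × Finset ι × (ι → ZMod 2)) → Equiv.Perm (ι → ZMod 2) → Prop :=
    fun e π => 2 ^ w * κ < typeDiv (2 ^ (w + u)) (cubeType π e.1 e.2.1 e.2.2) with hbad
  have hcard : Fintype.card (ι → ZMod 2) = 2 ^ ℓ := card_bits ι
  have hP : (0 : ℝ) < Fintype.card (Equiv.Perm (ι → ZMod 2)) := by
    exact_mod_cast Fintype.card_pos
  have hone : ∀ e ∈ E, ((Finset.univ.filter fun π => bad e π).card : ℝ)
      ≤ Fintype.card (Equiv.Perm (ι → ZMod 2)) * (2 ^ ℓ + 1)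
        * Real.exp (-(2 ^ w * κ)) * Real.exp ((2 ^ w : ℕ) * (u + 2)) := by
    rintro ⟨W, F, c₀⟩ he
    obtain ⟨hW, hF⟩ : W.card = w ∧ F.card = w + u := (Finset.mem_filter.1 he).2
    have hb : Fintype.card (↥W → ZMod 2) = 2 ^ w := by rw [card_bits, Fintype.card_coe, hW]
    have hfib : ∀ z : ↥W → ZMod 2, (Finset.univ.filter fun c : ι → ZMod 2 =>
        (fun i : ↥W => c i) = z).card = 2 ^ (ℓ - w) := by
      intro z
      have h := card_restrict_fiber W z
      have hle : w ≤ ℓ := hW ▸ Finset.card_le_univ W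
      rw [hW] at h
      refine Nat.eq_of_mul_eq_mul_right (pow_pos two_pos w) (h.trans ?_)
      rw [← pow_add, Nat.sub_add_cancel hle]
    have h := card_typeDiv_gt_le (T := ↥W → ZMod 2) (N := 2 ^ (w + u)) (by positivity)
      (fun π : Equiv.Perm (ι → ZMod 2) => cubeType π W F c₀)
      (fun π => by rw [sum_cubeType, hF])
      (P := Fintype.card (Equiv.Perm (ι → ZMod 2)) * (2 ^ ℓ + 1)) (by positivity)
      (fun n hn => by
        have h := card_perm_type_le (cube F c₀) (by rw [card_cube]; positivity)
          (fun c (i : ↥W) => c i) hfib n (by rw [hn, card_cube, hF])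
        rw [card_cube, hF, hcard] at h
        push_cast at h ⊢
        exact h) (2 ^ w * κ)
    rw [hb] at h
    exact h.trans (mul_le_mul_of_nonneg_left (types_factor_le w u) (by positivity))
  have hEcard : (E.card : ℝ) ≤ 2 ^ (3 * ℓ) := by
    have h1 : E.card ≤ Fintype.card (Finset ι × Finset ι × (ι → ZMod 2)) := Finset.card_le_univ E
    rw [Fintype.card_prod, Fintype.card_prod, Fintype.card_finset, hcard] at h1
    have h2 : E.card ≤ 2 ^ (3 * ℓ) := h1.trans_eq (by rw [← hℓ]; ring)
    exact_mod_cast h2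
  obtain ⟨π, hπ⟩ := exists_forall_not_of_sum_card_lt E bad (by
    refine (Finset.sum_le_sum hone).trans_lt ?_
    rw [Finset.sum_const, nsmul_eq_mul]
    have h1 : (2 : ℝ) ^ ℓ + 1 ≤ 2 ^ (ℓ + 1) := by
      have : (1 : ℝ) ≤ 2 ^ ℓ := one_le_pow₀ one_le_two
      rw [pow_succ]; linarith
    have h2 : (E.card : ℝ) * (2 ^ ℓ + 1) ≤ Real.exp (4 * ℓ + 1) := by
      calc (E.card : ℝ) * (2 ^ ℓ + 1) ≤ 2 ^ (3 * ℓ) * 2 ^ (ℓ + 1) :=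
            mul_le_mul hEcard h1 (by positivity) (by positivity)
        _ = 2 ^ (4 * ℓ + 1) := by rw [← pow_add]; congr 1; ring
        _ ≤ Real.exp ((4 * ℓ + 1 : ℕ)) := two_pow_le_exp _
        _ = _ := by push_cast; rfl
    have h3 : (ℓ : ℝ) ≤ 2 ^ w := by exact_mod_cast hw
    have h4 : (1 : ℝ) ≤ 2 ^ w := one_le_pow₀ one_le_two
    calc (E.card : ℝ) * (Fintype.card (Equiv.Perm (ι → ZMod 2)) * (2 ^ ℓ + 1)
          * Real.exp (-(2 ^ w * κ)) * Real.exp ((2 ^ w : ℕ) * (u + 2)))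
        = Fintype.card (Equiv.Perm (ι → ZMod 2)) * (((E.card : ℝ) * (2 ^ ℓ + 1))
          * (Real.exp (-(2 ^ w * κ)) * Real.exp ((2 ^ w : ℕ) * (u + 2)))) := by ring
      _ ≤ Fintype.card (Equiv.Perm (ι → ZMod 2)) * (Real.exp (4 * ℓ + 1)
          * (Real.exp (-(2 ^ w * κ)) * Real.exp ((2 ^ w : ℕ) * (u + 2)))) := by
          refine mul_le_mul_of_nonneg_left (mul_le_mul_of_nonneg_right h2 ?_) hP.le
          positivity
      _ < Fintype.card (Equiv.Perm (ι → ZMod 2)) * 1 := by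
          refine mul_lt_mul_of_pos_left ?_ hP
          -- With ℓ ≤ 2^w and κ ≥ u + 8 the exponent is at most 1 - 2·2^w: of the 8, the 4 pays for
          -- the events and the factor 2^ℓ + 1, and 2 for the types.
          rw [← Real.exp_add, ← Real.exp_add, Real.exp_lt_one_iff]
          push_cast
          nlinarith
      _ = _ := mul_one _)
  refine ⟨π, fun W F hW hF c₀ => not_lt.1 ?_⟩
  exact hπ (W, F, c₀) (Finset.mem_filter.2 ⟨Finset.mem_univ _, hW, hF⟩)

end Cube

/-! ### Binary linear codes with large distance and dual distance -/

section LinearCode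

variable {I J : Type*} [Fintype I] [Fintype J] [DecidableEq I] [DecidableEq J]

lemma zmod_two_eq_one {a : ZMod 2} (h : a ≠ 0) : a = 1 := by
  revert a; decide

lemma card_mulVec_eq_mul {v : I → ZMod 2} (hv : v ≠ 0) (c : J → ZMod 2) :
    (Finset.univ.filter fun A : Matrix J I (ZMod 2) => A.mulVec v = c).card * 2 ^ Fintype.card J
      = Fintype.card (Matrix J I (ZMod 2)) := by
  obtain ⟨i₀, hi₀⟩ := Function.ne_iff.1 hv
  let f : Matrix J I (ZMod 2) →+ (J → ZMod 2) :=
    { toFun := fun A => A.mulVec v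
      map_zero' := Matrix.zero_mulVec v
      map_add' := fun A B => Matrix.add_mulVec A B v }
  have hf : Function.Surjective f := by
    intro c
    refine ⟨fun j i => if i = i₀ then c j else 0, funext fun j => ?_⟩
    change ∑ i, (if i = i₀ then c j else 0) * v i = c j
    simp [ite_mul, zmod_two_eq_one hi₀]
  have := card_fiber_mul_card f hf c
  rw [card_bits] at this
  exact this

lemma card_vecMul_eq_mul {v : J → ZMod 2} (hv : v ≠ 0) (c : I → ZMod 2) :
    (Finset.univ.filter fun A : Matrix J I (ZMod 2) => Matrix.vecMul v A = c).card
      * 2 ^ Fintype.card I = Fintype.card (Matrix J I (ZMod 2)) := by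
  have h := card_mulVec_eq_mul (I := J) (J := I) hv c
  have h1 : (Finset.univ.filter fun A : Matrix J I (ZMod 2) => Matrix.vecMul v A = c).card
      = (Finset.univ.filter fun A : Matrix I J (ZMod 2) => A.mulVec v = c).card := by
    refine Finset.card_equiv (Matrix.transposeAddEquiv J I (ZMod 2)).toEquiv fun A => ?_
    simp [Matrix.mulVec_transpose]
  have h2 : Fintype.card (Matrix J I (ZMod 2)) = Fintype.card (Matrix I J (ZMod 2)) :=
    Fintype.card_congr (Matrix.transposeAddEquiv J I (ZMod 2)).toEquiv
  rw [h1, h, h2]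

/-- The syndrome of the systematic code with redundancy `A`. -/
def syndrome (A : Matrix J I (ZMod 2)) (x : I ⊕ J → ZMod 2) : J → ZMod 2 :=
  A.mulVec (fun i => x (.inl i)) + fun j => x (.inr j)

/-- The syndrome of the dual of the systematic code with redundancy `A`. -/
def dualSyndrome (A : Matrix J I (ZMod 2)) (x : I ⊕ J → ZMod 2) : I → ZMod 2 :=
  (fun i => x (.inl i)) + Matrix.vecMul (fun j => x (.inr j)) A

/-- The codeword of the systematic code with information bits `y`. -/
def codeword (A : Matrix J I (ZMod 2)) : (I → ZMod 2) →+ (I ⊕ J → ZMod 2) where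
  toFun y := Sum.elim y (A.mulVec y)
  map_zero' := by ext (i | j) <;> simp
  map_add' y z := by ext (i | j) <;> simp [Matrix.mulVec_add]

lemma bits_add_self {ι : Type*} (x : ι → ZMod 2) : x + x = 0 := funext fun _ => zmod_two_add_self _

lemma bits_sub_eq_add {ι : Type*} (x y : ι → ZMod 2) : x - y = x + y := by
  rw [sub_eq_iff_eq_add, add_assoc, bits_add_self, add_zero]

lemma syndrome_codeword (A : Matrix J I (ZMod 2)) (y : I → ZMod 2) :
    syndrome A (codeword A y) = 0 := bits_add_self _

lemma syndrome_add (A : Matrix J I (ZMod 2)) (x y : I ⊕ J → ZMod 2) :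
    syndrome A (x + y) = syndrome A x + syndrome A y := by
  unfold syndrome
  have : (fun i => (x + y) (.inl i)) = (fun i => x (.inl i)) + fun i : I => y (.inl i) := rfl
  rw [this, Matrix.mulVec_add]
  funext j
  simp only [Pi.add_apply]
  ring

/-- If the information part of `x` is zero the syndrome is its nonzero check part; otherwise a
uniform `A` makes the syndrome uniform. -/
lemma card_syndrome_eq_zero_le {x : I ⊕ J → ZMod 2} (hx : x ≠ 0) :
    (Finset.univ.filter fun A : Matrix J I (ZMod 2) => syndrome A x = 0).card
      * 2 ^ Fintype.card J ≤ Fintype.card (Matrix J I (ZMod 2)) := by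
  by_cases h : (fun i => x (.inl i)) = 0
  · rw [Finset.filter_eq_empty_iff.2]
    · simp
    · intro A _ hA
      rw [syndrome, h, Matrix.mulVec_zero, zero_add] at hA
      exact hx (funext fun
        | .inl i => congrFun h i
        | .inr j => congrFun hA j)
  · rw [← card_mulVec_eq_mul h fun j => x (.inr j)]
    refine Nat.mul_le_mul_right _ (Finset.card_le_card fun A hA => ?_)
    rw [Finset.mem_filter] at hA ⊢
    refine ⟨hA.1, ?_⟩
    rw [← sub_eq_zero, bits_sub_eq_add]
    exact hA.2

lemma card_dualSyndrome_eq_zero_le {x : I ⊕ J → ZMod 2} (hx : x ≠ 0) :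
    (Finset.univ.filter fun A : Matrix J I (ZMod 2) => dualSyndrome A x = 0).card
      * 2 ^ Fintype.card I ≤ Fintype.card (Matrix J I (ZMod 2)) := by
  by_cases h : (fun j => x (.inr j)) = 0
  · rw [Finset.filter_eq_empty_iff.2]
    · simp
    · intro A _ hA
      rw [dualSyndrome, h, Matrix.zero_vecMul, add_zero] at hA
      exact hx (funext fun
        | .inl i => congrFun hA i
        | .inr j => congrFun h j)
  · rw [← card_vecMul_eq_mul h fun i => x (.inl i)]
    refine Nat.mul_le_mul_right _ (Finset.card_le_card fun A hA => ?_)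
    rw [Finset.mem_filter] at hA ⊢
    refine ⟨hA.1, ?_⟩
    rw [← sub_eq_zero, bits_sub_eq_add, add_comm]
    exact hA.2

/-- If no nonzero dual codeword is supported on `W`, the code projects onto `W`. -/
lemma codeword_restrict_surjective (A : Matrix J I (ZMod 2)) (W : Finset (I ⊕ J))
    (hA : ∀ x : I ⊕ J → ZMod 2, (∀ i, i ∉ W → x i = 0) → x ≠ 0 → dualSyndrome A x ≠ 0) :
    Function.Surjective ((restrictHom W).comp (codeword A)) := by
  let f : (I → ZMod 2) →ₗ[ZMod 2] (↥W → ZMod 2) :=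
    ((restrictHom W).comp (codeword A)).toZModLinearMap 2
  suffices h : Function.Injective f.dualMap from LinearMap.dualMap_injective_iff.1 h
  rw [← LinearMap.ker_eq_bot, LinearMap.ker_eq_bot']
  intro g hg
  by_contra hg0
  -- A functional killing the projected code, written as a vector and extended by zero off `W`. It
  -- is a nonzero dual codeword supported on `W`, which is excluded.
  let x : I ⊕ J → ZMod 2 := fun i => if h : i ∈ W then g (Pi.single ⟨i, h⟩ 1) else 0
  have hgx : ∀ c : I ⊕ J → ZMod 2, g (fun i : ↥W => c i) = ∑ i, x i * c i := by
    intro c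
    have h1 : (fun i : ↥W => c i) = ∑ i : ↥W, c i • (Pi.single i 1 : ↥W → ZMod 2) := by
      funext k
      simp [Finset.sum_apply, Pi.single_apply]
    rw [h1, map_sum, ← Finset.sum_subset (Finset.subset_univ W) (fun i _ hi => by simp [x, hi]),
      ← Finset.sum_coe_sort W]
    refine Finset.sum_congr rfl fun i _ => ?_
    rw [map_smul, smul_eq_mul, mul_comm]
    simp [x]
  have hx0 : x ≠ 0 := by
    intro hx
    refine hg0 (LinearMap.ext fun z => ?_)
    obtain ⟨c, rfl⟩ := restrict_surjective W z
    rw [hgx c, hx]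
    simp
  refine hA x (fun i hi => dif_neg hi) hx0 ?_
  funext i
  have h2 : g (f (Pi.single i 1)) = 0 := LinearMap.congr_fun hg (Pi.single i 1)
  have h3 : f (Pi.single i 1) = fun k : ↥W => codeword A (Pi.single i 1) k := rfl
  rw [h3, hgx, Fintype.sum_sum_type] at h2
  have h4 : ∀ i', codeword A (Pi.single i 1) (.inl i') = (Pi.single i 1 : I → ZMod 2) i' :=
    fun _ => rfl
  have h5 : ∀ j, codeword A (Pi.single i 1) (.inr j) = A j i := by
    intro j
    change A.mulVec (Pi.single i 1) j = A j i
    simp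
  simp_rw [h4, h5] at h2
  simp only [Pi.single_apply, mul_ite, mul_one, mul_zero, Finset.sum_ite_eq', Finset.mem_univ,
    if_true] at h2
  exact h2

lemma card_pairs_le (k lam : ℕ) (hlam : 2 * Fintype.card I ≤ 2 ^ lam) :
    ((Finset.powersetCard k (Finset.univ : Finset I)).sigma
      fun F => cube F (0 : I → ZMod 2)).card ≤ 2 ^ (lam * k) := by
  rw [Finset.card_sigma, Finset.sum_congr rfl fun F hF => by
    rw [card_cube, (Finset.mem_powersetCard.1 hF).2], Finset.sum_const, Finset.card_powersetCard,
    smul_eq_mul, Finset.card_univ]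
  calc (Fintype.card I).choose k * 2 ^ k ≤ Fintype.card I ^ k * 2 ^ k :=
        Nat.mul_le_mul_right _ (Nat.choose_le_pow _ _)
    _ = (2 * Fintype.card I) ^ k := by rw [mul_pow, mul_comm]
    _ ≤ (2 ^ lam) ^ k := Nat.pow_le_pow_left hlam k
    _ = _ := (pow_mul 2 lam k).symm

lemma card_bad_le {Ω : Type*} [Fintype Ω] {q : Prop} (P : Ω → Prop) [DecidablePred P]
    [DecidablePred fun ω => q ∧ P ω] (k : ℕ)
    (h : q → (Finset.univ.filter P).card * 2 ^ k ≤ Fintype.card Ω) :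
    ((Finset.univ.filter fun ω => q ∧ P ω).card : ℝ) ≤ Fintype.card Ω / 2 ^ k := by
  rw [le_div_iff₀ (by positivity)]
  by_cases hq : q
  · have h2 : (Finset.univ.filter fun ω => q ∧ P ω) = Finset.univ.filter P :=
      Finset.filter_congr fun A _ => and_iff_right hq
    rw [h2]
    exact_mod_cast h hq
  · have : (Finset.univ.filter fun ω => q ∧ P ω) = ∅ :=
      Finset.filter_eq_empty_iff.2 fun A _ h => hq h.1
    rw [this]
    simp

/-- Gilbert-Varshamov bound for the distance and the dual distance at once. -/
theorem exists_code (k w lam : ℕ) (hlam : 2 * Fintype.card (I ⊕ J) ≤ 2 ^ lam)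
    (hJ : lam * k + 1 ≤ Fintype.card J) (hI : lam * w + 2 ≤ Fintype.card I) :
    ∃ A : Matrix J I (ZMod 2),
      (∀ F : Finset (I ⊕ J), F.card = k → ∀ x, (∀ i, i ∉ F → x i = 0) → x ≠ 0 → syndrome A x ≠ 0) ∧
      ∀ W : Finset (I ⊕ J), W.card = w → ∀ x, (∀ i, i ∉ W → x i = 0) → x ≠ 0 →
        dualSyndrome A x ≠ 0 := by
  classical
  let E : ℕ → Finset (Σ _ : Finset (I ⊕ J), I ⊕ J → ZMod 2) := fun k =>
    (Finset.powersetCard k Finset.univ).sigma fun F => cube F 0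
  have hE : ∀ k, ((E k).card : ℝ) ≤ 2 ^ (lam * k) := fun k => by
    exact_mod_cast card_pairs_le k lam hlam
  let bad : (Σ _ : Finset (I ⊕ J), I ⊕ J → ZMod 2) ⊕ (Σ _ : Finset (I ⊕ J), I ⊕ J → ZMod 2) →
      Matrix J I (ZMod 2) → Prop := fun e A => e.elim
    (fun e => e.2 ≠ 0 ∧ syndrome A e.2 = 0) fun e => e.2 ≠ 0 ∧ dualSyndrome A e.2 = 0
  have h1 : ∀ e, ((Finset.univ.filter fun A => bad (.inl e) A).card : ℝ)
      ≤ Fintype.card (Matrix J I (ZMod 2)) / 2 ^ Fintype.card J := fun e =>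
    by
    convert card_bad_le (q := e.2 ≠ 0) (fun A : Matrix J I (ZMod 2) => syndrome A e.2 = 0)
      (Fintype.card J) fun h => card_syndrome_eq_zero_le h
    exact Iff.rfl
  have h2 : ∀ e, ((Finset.univ.filter fun A => bad (.inr e) A).card : ℝ)
      ≤ Fintype.card (Matrix J I (ZMod 2)) / 2 ^ Fintype.card I := fun e =>
    by
    convert card_bad_le (q := e.2 ≠ 0) (fun A : Matrix J I (ZMod 2) => dualSyndrome A e.2 = 0)
      (Fintype.card I) fun h => card_dualSyndrome_eq_zero_le h
    exact Iff.rfl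
  have hM : (0 : ℝ) < (Fintype.card (Matrix J I (ZMod 2)) : ℕ) := by
    exact_mod_cast Fintype.card_pos
  -- The +1 and +2 in the dimension hypotheses bound the two failure probabilities by 1/2 and 1/4.
  have num : ∀ M : ℝ, 0 < M → ((E k).card : ℝ) * (M / 2 ^ Fintype.card J)
      + ((E w).card : ℝ) * (M / 2 ^ Fintype.card I) < M := by
    intro M hM
    have d1 : ((E k).card : ℝ) * (M / 2 ^ Fintype.card J) ≤ M / 2 := by
      have h3 : (2 : ℝ) ^ (lam * k + 1) ≤ 2 ^ Fintype.card J := pow_le_pow_right₀ one_le_two hJ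
      rw [pow_succ] at h3
      rw [mul_div_assoc', div_le_div_iff₀ (by positivity) two_pos]
      have := hE k
      nlinarith
    have d2 : ((E w).card : ℝ) * (M / 2 ^ Fintype.card I) ≤ M / 4 := by
      have h3 : (2 : ℝ) ^ (lam * w + 2) ≤ 2 ^ Fintype.card I := pow_le_pow_right₀ one_le_two hI
      rw [pow_add] at h3
      rw [mul_div_assoc', div_le_div_iff₀ (by positivity) four_pos]
      have := hE w
      nlinarith
    linarith
  obtain ⟨A, hA⟩ := exists_forall_not_of_sum_card_lt ((E k).disjSum (E w)) bad (by
    rw [Finset.sum_disjSum]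
    refine (add_le_add (Finset.sum_le_sum fun e _ => h1 e)
      (Finset.sum_le_sum fun e _ => h2 e)).trans_lt ?_
    rw [Finset.sum_const, Finset.sum_const, nsmul_eq_mul, nsmul_eq_mul]
    exact num _ hM)
  refine ⟨A, fun F hF x hx hx0 h => ?_, fun W hW x hx hx0 h => ?_⟩
  · refine hA (.inl ⟨F, x⟩) ?_ ⟨hx0, h⟩
    rw [Finset.inl_mem_disjSum, Finset.mem_sigma]
    exact ⟨Finset.mem_powersetCard.2 ⟨Finset.subset_univ _, hF⟩, mem_cube.2 hx⟩
  · refine hA (.inr ⟨W, x⟩) ?_ ⟨hx0, h⟩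
    rw [Finset.inr_mem_disjSum, Finset.mem_sigma]
    exact ⟨Finset.mem_powersetCard.2 ⟨Finset.subset_univ _, hW⟩, mem_cube.2 hx⟩

/-- Translation by a codeword that depends on the syndrome only. -/
def cosetShift (A : Matrix J I (ZMod 2)) (φ : (J → ZMod 2) → (I → ZMod 2))
    (c : I ⊕ J → ZMod 2) : I ⊕ J → ZMod 2 := c + codeword A (φ (syndrome A c))

/-- The shift is a codeword, so the syndrome survives and the shift can be read off the image. -/
lemma cosetShift_injective (A : Matrix J I (ZMod 2)) (φ : (J → ZMod 2) → (I → ZMod 2)) :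
    Function.Injective (cosetShift A φ) := by
  have hs : ∀ c, syndrome A (cosetShift A φ c) = syndrome A c := fun c => by
    rw [cosetShift, syndrome_add, syndrome_codeword, add_zero]
  intro c c' h
  have h1 : syndrome A c = syndrome A c' := by rw [← hs c, h, hs c']
  unfold cosetShift at h
  rw [h1] at h
  exact add_right_cancel h

/-- Translation by a codeword commutes with the coset shift and merely relabels the patterns on `W`.
Hence the union bound runs over syndromes of base points instead of all 2^ℓ of them. -/
lemma typeDiv_cosetShift_add (A : Matrix J I (ZMod 2)) (φ : (J → ZMod 2) → (I → ZMod 2))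
    (W F : Finset (I ⊕ J)) (N : ℕ) (c t : I ⊕ J → ZMod 2) (ht : syndrome A t = 0) :
    typeDiv N (cubeType (cosetShift A φ) W F (c + t))
      = typeDiv N (cubeType (cosetShift A φ) W F c) := by
  have h : ∀ z : ↥W → ZMod 2, cubeType (cosetShift A φ) W F (c + t) (z + fun i : ↥W => t i)
      = cubeType (cosetShift A φ) W F c z := by
    intro z
    refine (Finset.card_equiv (Equiv.addRight t) fun x => ?_).symm
    have hx : cosetShift A φ (x + t) = cosetShift A φ x + t := by
      unfold cosetShift
      rw [syndrome_add, ht, add_zero]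
      abel
    rw [Finset.mem_filter, Finset.mem_filter, mem_cube, mem_cube, Equiv.coe_addRight, hx]
    refine and_congr (forall₂_congr fun i _ => ?_) ?_
    · exact (add_left_inj (t i)).symm
    · exact (add_left_inj (fun i : ↥W => t i) (b := fun i : ↥W => cosetShift A φ x i)).symm
  unfold typeDiv
  rw [← Equiv.sum_comp (Equiv.addRight fun i : ↥W => t i)]
  refine Finset.sum_congr rfl fun z _ => ?_
  rw [Equiv.coe_addRight, h z]

/-- Random translation along a good linear code works when few links are observed. -/
theorem exists_typeDiv_le_of_code {w u lam : ℕ}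
    (hlam : 2 * Fintype.card (I ⊕ J) ≤ 2 ^ lam)
    (hJ : lam * (w + u) + 1 ≤ Fintype.card J) (hI : lam * w + 2 ≤ Fintype.card I) {κ : ℝ}
    (hκ : u + 2 + lam * (w + (w + u)) + Fintype.card J < κ) :
    ∃ π : (I ⊕ J → ZMod 2) → (I ⊕ J → ZMod 2), Function.Injective π ∧
      ∀ W F : Finset (I ⊕ J), W.card = w → F.card = w + u →
        ∀ c₀, typeDiv (2 ^ (w + u)) (cubeType π W F c₀) ≤ 2 ^ w * κ := by
  classical
  obtain ⟨A, hdist, hdual⟩ := exists_code (I := I) (J := J) (w + u) w lam hlam hJ hI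
  set Φ := (J → ZMod 2) → (I → ZMod 2)
  set base : (J → ZMod 2) → (I ⊕ J → ZMod 2) := fun q => Sum.elim 0 q with hbase
  have hsb : ∀ q, syndrome A (base q) = q := by
    intro q
    have : (fun i => base q (.inl i)) = (0 : I → ZMod 2) := rfl
    rw [syndrome, this, Matrix.mulVec_zero, zero_add]
    rfl
  set E : Finset (Finset (I ⊕ J) × Finset (I ⊕ J) × (J → ZMod 2)) :=
    Finset.powersetCard w Finset.univ ×ˢ Finset.powersetCard (w + u) Finset.univ ×ˢ Finset.univ
    with hE
  set bad : (Finset (I ⊕ J) × Finset (I ⊕ J) × (J → ZMod 2)) → Φ → Prop :=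
    fun e φ => 2 ^ w * κ < typeDiv (2 ^ (w + u)) (cubeType (cosetShift A φ) e.1 e.2.1 (base e.2.2))
    with hbad
  have hP : (0 : ℝ) < Fintype.card Φ := by exact_mod_cast Fintype.card_pos
  have hone : ∀ e ∈ E, ((Finset.univ.filter fun φ => bad e φ).card : ℝ)
      ≤ Fintype.card Φ * Real.exp (-(2 ^ w * κ)) * Real.exp ((2 ^ w : ℕ) * (u + 2)) := by
    rintro ⟨W, F, q⟩ he
    rw [Finset.mem_product, Finset.mem_product, Finset.mem_powersetCard,
      Finset.mem_powersetCard] at he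
    obtain ⟨⟨-, hW : W.card = w⟩, ⟨-, hF : F.card = w + u⟩, -⟩ := he
    have hb : Fintype.card (↥W → ZMod 2) = 2 ^ w := by rw [card_bits, Fintype.card_coe, hW]
    -- Two points of the subcube with one syndrome would differ by a nonzero codeword supported on
    -- `F`. Distinct syndromes make the random shifts independent along the subcube.
    have hinj : Set.InjOn (syndrome A) (cube F (base q) : Set (I ⊕ J → ZMod 2)) := by
      intro c hc c' hc' h
      rw [Finset.mem_coe, mem_cube] at hc hc'
      by_contra hne
      refine hdist F hF (c + c') (fun i hi => ?_) (fun h0 => hne ?_) ?_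
      · rw [Pi.add_apply, hc i hi, hc' i hi, zmod_two_add_self]
      · rw [← sub_eq_zero, bits_sub_eq_add, h0]
      · rw [syndrome_add, h, bits_add_self]
    -- Surjectivity onto `W` makes every single shifted point uniform there.
    have hsurj := codeword_restrict_surjective A W (hdual W hW)
    have h := card_typeDiv_gt_le (T := ↥W → ZMod 2) (N := 2 ^ (w + u)) (by positivity)
      (fun φ : Φ => cubeType (cosetShift A φ) W F (base q))
      (fun φ => by rw [sum_cubeType, hF])
      (P := Fintype.card Φ) (by positivity)
      (fun n hn => by
        have h := card_function_type_le (cube F (base q)) (by rw [card_cube]; positivity)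
          (syndrome A) hinj (fun c y => (fun i : ↥W => c i) + (restrictHom W).comp (codeword A) y)
          (fun c _ z => by
            have h := card_fiber_mul_card _ hsurj (z - fun i : ↥W => c i)
            rw [← h]
            congr 2
            ext y
            rw [Finset.mem_filter, Finset.mem_filter, eq_sub_iff_add_eq, add_comm]) n
          (by rw [hn, card_cube, hF])
        rw [card_cube, hF] at h
        exact h) (2 ^ w * κ)
    rw [hb] at h
    exact h.trans (mul_le_mul_of_nonneg_left (types_factor_le w u) (by positivity))
  have hpow : ∀ k, (Finset.powersetCard k (Finset.univ : Finset (I ⊕ J))).card ≤ 2 ^ (lam * k) := by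
    intro k
    rw [Finset.card_powersetCard, Finset.card_univ, pow_mul]
    exact (Nat.choose_le_pow _ _).trans (Nat.pow_le_pow_left (by omega) k)
  have hEcard : (E.card : ℝ) ≤ 2 ^ (lam * w + lam * (w + u) + Fintype.card J) := by
    have h1 : E.card ≤ 2 ^ (lam * w) * (2 ^ (lam * (w + u)) * 2 ^ Fintype.card J) := by
      rw [hE, Finset.card_product, Finset.card_product, Finset.card_univ, card_bits]
      exact Nat.mul_le_mul (hpow _) (Nat.mul_le_mul_right _ (hpow _))
    rw [← pow_add, ← pow_add, ← add_assoc] at h1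
    exact_mod_cast h1
  obtain ⟨φ, hφ⟩ := exists_forall_not_of_sum_card_lt E bad (by
    refine (Finset.sum_le_sum hone).trans_lt ?_
    rw [Finset.sum_const, nsmul_eq_mul]
    have h2 := hEcard.trans (two_pow_le_exp _)
    have h4 : (1 : ℝ) ≤ 2 ^ w := one_le_pow₀ one_le_two
    calc (E.card : ℝ) * (Fintype.card Φ
          * Real.exp (-(2 ^ w * κ)) * Real.exp ((2 ^ w : ℕ) * (u + 2)))
        = Fintype.card Φ * ((E.card : ℝ)
          * (Real.exp (-(2 ^ w * κ)) * Real.exp ((2 ^ w : ℕ) * (u + 2)))) := by ring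
      _ ≤ Fintype.card Φ * (Real.exp ((lam * w + lam * (w + u) + Fintype.card J : ℕ))
          * (Real.exp (-(2 ^ w * κ)) * Real.exp ((2 ^ w : ℕ) * (u + 2)))) := by
          refine mul_le_mul_of_nonneg_left (mul_le_mul_of_nonneg_right h2 ?_) hP.le
          positivity
      _ < Fintype.card Φ * 1 := by
          refine mul_lt_mul_of_pos_left ?_ hP
          rw [← Real.exp_add, ← Real.exp_add, Real.exp_lt_one_iff]
          push_cast
          have h5 : (0 : ℝ) ≤ lam * w + lam * (w + u) + Fintype.card J := by positivity
          nlinarith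
      _ = _ := mul_one _)
  refine ⟨cosetShift A φ, cosetShift_injective A φ, fun W F hW hF c₀ => ?_⟩
  -- Every base point differs from the representative of its syndrome by a codeword.
  have ht : syndrome A (c₀ + base (syndrome A c₀)) = 0 := by
    rw [syndrome_add, hsb, bits_add_self]
  have hc : c₀ = base (syndrome A c₀) + (c₀ + base (syndrome A c₀)) := by
    rw [add_left_comm, bits_add_self, add_zero]
  rw [hc, typeDiv_cosetShift_add A φ W F _ _ _ ht]
  refine not_lt.1 (hφ (W, F, syndrome A c₀) ?_)
  rw [Finset.mem_product, Finset.mem_product, Finset.mem_powersetCard, Finset.mem_powersetCard]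
  exact ⟨⟨Finset.subset_univ _, hW⟩, ⟨Finset.subset_univ _, hF⟩, Finset.mem_univ _⟩

end LinearCode

/-! ### The codebook -/

lemma cubeType_reindex {ι ι' : Type*} [Fintype ι] [DecidableEq ι] [Fintype ι'] [DecidableEq ι']
    (e : ι ≃ ι') (π : (ι → ZMod 2) → (ι → ZMod 2)) (W F : Finset ι') (c₀ : ι' → ZMod 2)
    (z : ↥W → ZMod 2) :
    cubeType (fun c i => π (fun k => c (e k)) (e.symm i)) W F c₀ z
      = cubeType π (W.map e.symm.toEmbedding) (F.map e.symm.toEmbedding) (fun k => c₀ (e k))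
        (fun k => z ⟨e k, by
          obtain ⟨i, hi, h⟩ := Finset.mem_map.1 k.2
          rw [← h]
          simpa using hi⟩) := by
  refine Finset.card_equiv (Equiv.arrowCongr e.symm (Equiv.refl (ZMod 2))) fun c => ?_
  rw [Finset.mem_filter, Finset.mem_filter, mem_cube, mem_cube]
  have hc : (Equiv.arrowCongr e.symm (Equiv.refl (ZMod 2))) c = fun k => c (e k) := rfl
  rw [hc]
  refine and_congr ?_ ?_
  · rw [← e.forall_congr_right]
    refine forall_congr' fun k => ?_
    have : e k ∈ F ↔ k ∈ F.map e.symm.toEmbedding := by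
      simp
    rw [this]
  · constructor
    · intro h
      funext k
      have hk := k.2
      obtain ⟨i, hi, h'⟩ := Finset.mem_map.1 k.2
      have := congrFun h ⟨e k, by rw [← h']; simpa using hi⟩
      simpa using this
    · intro h
      funext i
      have := congrFun h ⟨e.symm i, Finset.mem_map_of_mem e.symm.toEmbedding i.2⟩
      simpa using this

lemma typeDiv_reindex {T T' : Type*} [Fintype T] [Fintype T'] (g : T ≃ T') (N : ℕ) (n : T' → ℕ) :
    typeDiv N (fun z => n (g z)) = typeDiv N n := by
  unfold typeDiv
  rw [Fintype.card_congr g]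
  exact Equiv.sum_comp g fun z => (n z : ℝ) * Real.log (n z * Fintype.card T' / N)

/-- A bijection of the binary cube that extracts almost uniform bits from all subcubes. -/
theorem exists_perm_typeDiv_le {ℓ w u lam : ℕ} (hwu : w + u ≤ ℓ) (hlam : 2 * ℓ ≤ 2 ^ lam)
    (hℓ : lam * (2 * lam + u) + 3 ≤ ℓ) {κ : ℝ}
    (hκ : u + 8 + lam * (3 * lam + 2 * u) ≤ κ) :
    ∃ π : (Fin ℓ → ZMod 2) → (Fin ℓ → ZMod 2), Function.Injective π ∧
      ∀ W F : Finset (Fin ℓ), W.card = w → F.card = w + u →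
        ∀ c₀, typeDiv (2 ^ (w + u)) (cubeType π W F c₀) ≤ 2 ^ w * κ := by
  rcases le_or_gt ℓ (2 ^ w) with h | h
  · obtain ⟨π, hπ⟩ := exists_perm_typeDiv_le_of_large (ι := Fin ℓ) (w := w) (u := u)
      (by rwa [Fintype.card_fin]) (κ := κ) (by
        have : (0 : ℝ) ≤ lam * (3 * lam + 2 * u) := by positivity
        linarith)
    exact ⟨π, π.injective, hπ⟩
  · have hwl : w ≤ lam := by
      by_contra! hlt
      have := Nat.pow_lt_pow_right one_lt_two hlt
      omega
    -- The least redundancy that `exists_typeDiv_le_of_code` accepts: 2^r syndromes enter the union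
    -- bound. Since w ≤ lam here, both r and the remaining dimension condition are of order log²ℓ.
    set r := lam * (w + u) + 1 with hr
    have hrl : r + (lam * w + 2) ≤ ℓ := by
      have : lam * (w + u) + lam * w ≤ lam * (2 * lam + u) := by
        rw [← mul_add]
        exact Nat.mul_le_mul_left _ (by omega)
      omega
    obtain ⟨s, hs⟩ := Nat.exists_eq_add_of_le (show r ≤ ℓ by omega)
    have e : Fin s ⊕ Fin r ≃ Fin ℓ := finSumFinEquiv.trans (finCongr (by omega))
    have hcard : Fintype.card (Fin s ⊕ Fin r) = ℓ := by simp; omega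
    obtain ⟨π, hinj, hπ⟩ := exists_typeDiv_le_of_code (I := Fin s) (J := Fin r) (w := w) (u := u)
      (lam := lam) (by rwa [hcard]) (by rw [Fintype.card_fin]) (by rw [Fintype.card_fin]; omega)
      (κ := κ) (by
        rw [Fintype.card_fin, hr]
        push_cast
        have h1 : (w : ℝ) ≤ lam := by exact_mod_cast hwl
        have h2 : (lam : ℝ) * (w + (w + u)) + lam * (w + u) ≤ lam * (3 * lam + 2 * u) := by
          rw [← mul_add]
          exact mul_le_mul_of_nonneg_left (by linarith) (by positivity)
        linarith)
    refine ⟨fun c i => π (fun k => c (e k)) (e.symm i), ?_, fun W F hW hF c₀ => ?_⟩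
    · intro c c' h
      have h1 : π (fun k => c (e k)) = π fun k => c' (e k) := by
        funext k
        have := congrFun h (e k)
        simpa using this
      have h2 := hinj h1
      funext i
      have := congrFun h2 (e.symm i)
      simpa using this
    · have hmem : ∀ k : ↥(W.map e.symm.toEmbedding), e k ∈ W := fun k => by
        obtain ⟨i, hi, h⟩ := Finset.mem_map.1 k.2
        rw [← h]
        simpa using hi
      let f : ↥(W.map e.symm.toEmbedding) ≃ ↥W :=
        { toFun := fun k => ⟨e k, hmem k⟩
          invFun := fun i => ⟨e.symm i, Finset.mem_map_of_mem e.symm.toEmbedding i.2⟩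
          left_inv := fun k => Subtype.ext (e.symm_apply_apply k)
          right_inv := fun i => Subtype.ext (e.apply_symm_apply i) }
      have h1 := hπ (W.map e.symm.toEmbedding) (F.map e.symm.toEmbedding)
        (by rw [Finset.card_map, hW]) (by rw [Finset.card_map, hF]) (fun k => c₀ (e k))
      rw [← typeDiv_reindex (Equiv.arrowCongr f.symm (Equiv.refl (ZMod 2)))] at h1
      refine le_trans (le_of_eq ?_) h1
      congr 1
      funext z
      exact cubeType_reindex e π W F c₀ z

/-! ### Law of the observation of one column -/

section Column

variable {ℓ : ℕ}

/-- Law of a bit of a column: fixed to `a i` for `i ∈ K`, uniform otherwise. -/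
def bitLaw (K : Finset (Fin ℓ)) (a : Fin ℓ → ZMod 2) (i : Fin ℓ) (x : ZMod 2) : ℝ :=
  if i ∈ K then (if x = a i then 1 else 0) else 1 / 2

lemma bitLaw_nonneg (K : Finset (Fin ℓ)) (a : Fin ℓ → ZMod 2) (i : Fin ℓ) (x : ZMod 2) :
    0 ≤ bitLaw K a i x := by
  unfold bitLaw; split_ifs <;> norm_num

lemma sum_bitLaw (K : Finset (Fin ℓ)) (a : Fin ℓ → ZMod 2) (i : Fin ℓ) :
    ∑ x, bitLaw K a i x = 1 := by
  unfold bitLaw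
  split_ifs
  · simp
  · rw [sum_zmod_two]; norm_num

/-- Law of the bits of an encoded column that are seen on `W` when the bits in `K` are `a`. -/
def colLaw (π : (Fin ℓ → ZMod 2) → (Fin ℓ → ZMod 2)) (W K : Finset (Fin ℓ)) (a : Fin ℓ → ZMod 2) :
    (↥W → ZMod 2) → ℝ :=
  law (fun c => ∏ i, bitLaw K a i (c i)) (fun c (i : ↥W) => π c i)

lemma colLaw_nonneg (π : (Fin ℓ → ZMod 2) → (Fin ℓ → ZMod 2)) (W K : Finset (Fin ℓ))
    (a : Fin ℓ → ZMod 2) (z : ↥W → ZMod 2) : 0 ≤ colLaw π W K a z :=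
  law_nonneg (fun _ => Finset.prod_nonneg fun _ _ => bitLaw_nonneg _ _ _ _) _ _

lemma sum_colLaw (π : (Fin ℓ → ZMod 2) → (Fin ℓ → ZMod 2)) (W K : Finset (Fin ℓ))
    (a : Fin ℓ → ZMod 2) : ∑ z, colLaw π W K a z = 1 := by
  unfold colLaw
  rw [sum_law, sum_prod_pi]
  exact Finset.prod_eq_one fun i _ => sum_bitLaw K a i

lemma prod_bitLaw (K : Finset (Fin ℓ)) (a c : Fin ℓ → ZMod 2) :
    ∏ i, bitLaw K a i (c i) = if c ∈ cube Kᶜ a then (1 / 2 : ℝ) ^ Kᶜ.card else 0 := by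
  split_ifs with h
  · rw [mem_cube] at h
    have : ∀ i, bitLaw K a i (c i) = if i ∈ Kᶜ then (1 / 2 : ℝ) else 1 := by
      intro i
      by_cases hi : i ∈ K
      · simp [bitLaw, hi, h i (by simpa using hi)]
      · simp [bitLaw, hi]
    simp_rw [this]
    rw [Finset.prod_ite_mem, Finset.univ_inter, Finset.prod_const]
  · rw [mem_cube] at h
    push Not at h
    obtain ⟨i, hi, hne⟩ := h
    refine Finset.prod_eq_zero (Finset.mem_univ i) ?_
    have : i ∈ K := by simpa using hi
    simp [bitLaw, this, hne]

lemma colLaw_eq_cubeType (π : (Fin ℓ → ZMod 2) → (Fin ℓ → ZMod 2)) (W K : Finset (Fin ℓ))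
    (a : Fin ℓ → ZMod 2) (z : ↥W → ZMod 2) :
    colLaw π W K a z = cubeType π W Kᶜ a z / 2 ^ Kᶜ.card := by
  unfold colLaw cubeType
  rw [law]
  simp_rw [prod_bitLaw]
  rw [← Finset.sum_filter, Finset.filter_filter, Finset.sum_const, nsmul_eq_mul]
  have : (Finset.univ.filter fun c => (fun i : ↥W => π c i) = z ∧ c ∈ cube Kᶜ a)
      = (cube Kᶜ a).filter fun c => (fun i : ↥W => π c i) = z := by
    ext c; simp [and_comm]
  rw [this, one_div, inv_pow, div_eq_mul_inv]

/-- The law of a column is the mean of the laws obtained by fixing one more bit. -/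
lemma colLaw_eq_mean_insert (π : (Fin ℓ → ZMod 2) → (Fin ℓ → ZMod 2)) (W K : Finset (Fin ℓ))
    (a : Fin ℓ → ZMod 2) {k : Fin ℓ} (hk : k ∉ K) (z : ↥W → ZMod 2) :
    colLaw π W K a z = 1 / 2 * colLaw π W (insert k K) (Function.update a k 0) z
      + 1 / 2 * colLaw π W (insert k K) (Function.update a k 1) z := by
  have h : ∀ c : Fin ℓ → ZMod 2, ∏ i, bitLaw K a i (c i)
      = 1 / 2 * ∏ i, bitLaw (insert k K) (Function.update a k 0) i (c i)
        + 1 / 2 * ∏ i, bitLaw (insert k K) (Function.update a k 1) i (c i) := by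
    intro c
    have hrest : ∀ b : ZMod 2, ∏ i ∈ Finset.univ.erase k,
        bitLaw (insert k K) (Function.update a k b) i (c i)
        = ∏ i ∈ Finset.univ.erase k, bitLaw K a i (c i) := by
      intro b
      refine Finset.prod_congr rfl fun i hi => ?_
      have hne : i ≠ k := (Finset.mem_erase.1 hi).1
      simp [bitLaw, hne]
    rw [← Finset.mul_prod_erase _ _ (Finset.mem_univ k),
      ← Finset.mul_prod_erase _ (fun i => bitLaw (insert k K) (Function.update a k 0) i (c i))
        (Finset.mem_univ k),
      ← Finset.mul_prod_erase _ (fun i => bitLaw (insert k K) (Function.update a k 1) i (c i))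
        (Finset.mem_univ k), hrest, hrest]
    have hb : ∀ x : ZMod 2, bitLaw K a k x
        = 1 / 2 * bitLaw (insert k K) (Function.update a k 0) k x
          + 1 / 2 * bitLaw (insert k K) (Function.update a k 1) k x := by
      intro x
      have : x = 0 ∨ x = 1 := by revert x; decide
      rcases this with rfl | rfl <;> simp [bitLaw, hk]
    rw [hb]
    ring
  unfold colLaw
  simp_rw [law, h]
  rw [Finset.sum_add_distrib, Finset.mul_sum, Finset.mul_sum]

lemma kl_mean_le {α : Type*} [Fintype α] {P Q : α → ℝ} (hP : ∀ a, 0 ≤ P a) (hQ : ∀ a, 0 ≤ Q a)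
    {q : ℝ} (hq : 0 < q) :
    kl (fun a => 1 / 2 * P a + 1 / 2 * Q a) (fun _ => q)
      ≤ 1 / 2 * kl P (fun _ => q) + 1 / 2 * kl Q (fun _ => q) := by
  unfold kl
  rw [Finset.mul_sum, Finset.mul_sum, ← Finset.sum_add_distrib]
  refine Finset.sum_le_sum fun a _ => ?_
  have h := Real.convexOn_mul_log.2 (div_nonneg (hP a) hq.le : P a / q ∈ Set.Ici (0 : ℝ))
    (div_nonneg (hQ a) hq.le : Q a / q ∈ Set.Ici (0 : ℝ)) (by norm_num : (0 : ℝ) ≤ 1 / 2)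
    (by norm_num : (0 : ℝ) ≤ 1 / 2) (by norm_num)
  simp only [smul_eq_mul] at h
  have e : (1 / 2 * P a + 1 / 2 * Q a) / q = 1 / 2 * (P a / q) + 1 / 2 * (Q a / q) := by ring
  rw [e]
  have h' := mul_le_mul_of_nonneg_left h hq.le
  have hp : q * (P a / q) = P a := by field_simp
  have hq' : q * (Q a / q) = Q a := by field_simp
  calc (1 / 2 * P a + 1 / 2 * Q a) * Real.log (1 / 2 * (P a / q) + 1 / 2 * (Q a / q))
      = q * ((1 / 2 * (P a / q) + 1 / 2 * (Q a / q))
          * Real.log (1 / 2 * (P a / q) + 1 / 2 * (Q a / q))) := by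
        rw [← mul_assoc, mul_add, mul_left_comm, hp, mul_left_comm, hq']
    _ ≤ _ := h'
    _ = 1 / 2 * ((q * (P a / q)) * Real.log (P a / q))
        + 1 / 2 * ((q * (Q a / q)) * Real.log (Q a / q)) := by ring
    _ = _ := by rw [hp, hq']

/-- Columns with few fixed bits look almost uniform on `W`. -/
theorem kl_colLaw_le {w u : ℕ} {κ : ℝ} {π : (Fin ℓ → ZMod 2) → (Fin ℓ → ZMod 2)}
    {W : Finset (Fin ℓ)} (hW : W.card = w)
    (hπ : ∀ F : Finset (Fin ℓ), F.card = w + u →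
      ∀ c₀, typeDiv (2 ^ (w + u)) (cubeType π W F c₀) ≤ 2 ^ w * κ)
    (K : Finset (Fin ℓ)) (hK : K.card + w + u ≤ ℓ) (a : Fin ℓ → ZMod 2) :
    kl (colLaw π W K a) (fun _ => (1 / 2 : ℝ) ^ w) ≤ κ / 2 ^ u := by
  -- Induction on the number of free bits beyond w + u. Fixing a surplus bit writes the law as a
  -- mean of two laws, and relative entropy is convex.
  obtain ⟨k, hk⟩ := Nat.exists_eq_add_of_le hK
  induction k generalizing K a with
  | zero =>
    have hc : Kᶜ.card = w + u := by rw [Finset.card_compl, Fintype.card_fin]; omega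
    have h := hπ Kᶜ hc a
    rw [typeDiv, card_bits, Fintype.card_coe, hW] at h
    unfold kl
    have e : ∀ z, colLaw π W K a z * Real.log (colLaw π W K a z / (1 / 2) ^ w)
        = ((cubeType π W Kᶜ a z : ℝ) * Real.log (cubeType π W Kᶜ a z * (2 ^ w : ℕ)
          / (2 ^ (w + u) : ℕ))) / 2 ^ (w + u) := by
      intro z
      rw [colLaw_eq_cubeType, hc]
      have : (cubeType π W Kᶜ a z : ℝ) / 2 ^ (w + u) / (1 / 2) ^ w
          = cubeType π W Kᶜ a z * (2 ^ w : ℕ) / (2 ^ (w + u) : ℕ) := by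
        push_cast
        rw [one_div, inv_pow, div_inv_eq_mul]
        ring
      rw [this]
      ring
    simp_rw [e]
    rw [← Finset.sum_div, div_le_div_iff₀ (by positivity) (by positivity)]
    calc _ ≤ 2 ^ w * κ * 2 ^ u := mul_le_mul_of_nonneg_right h (by positivity)
      _ = _ := by rw [pow_add]; ring
  | succ k ih =>
    have hne : ∃ i, i ∉ K := by
      by_contra! hall
      have : K = Finset.univ := Finset.eq_univ_of_forall hall
      rw [this, Finset.card_univ, Fintype.card_fin] at hk
      omega
    obtain ⟨i, hi⟩ := hne
    have hcard := Finset.card_insert_of_notMem hi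
    have h0 := ih (insert i K) (by omega) (Function.update a i 0) (by omega)
    have h1 := ih (insert i K) (by omega) (Function.update a i 1) (by omega)
    have e : colLaw π W K a = fun z =>
        1 / 2 * colLaw π W (insert i K) (Function.update a i 0) z
        + 1 / 2 * colLaw π W (insert i K) (Function.update a i 1) z :=
      funext fun z => colLaw_eq_mean_insert π W K a hi z
    rw [e]
    have := kl_mean_le (colLaw_nonneg π W (insert i K) (Function.update a i 0))
      (colLaw_nonneg π W (insert i K) (Function.update a i 1))
      (by positivity : (0 : ℝ) < (1 / 2) ^ w)
    linarith

/-- A bijection maps uniform columns to uniform columns. -/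
lemma colLaw_empty {π : (Fin ℓ → ZMod 2) → (Fin ℓ → ZMod 2)} (hπ : Function.Injective π)
    (W : Finset (Fin ℓ)) (a : Fin ℓ → ZMod 2) :
    colLaw π W ∅ a = fun _ => (1 / 2 : ℝ) ^ W.card := by
  funext z
  rw [colLaw_eq_cubeType, Finset.compl_empty, Finset.card_univ, Fintype.card_fin]
  have h : cubeType π W Finset.univ a z
      = (Finset.univ.filter fun c : Fin ℓ → ZMod 2 => (fun i : ↥W => c i) = z).card := by
    have hc : cube Finset.univ a = Finset.univ := by ext c; simp [mem_cube]
    rw [cubeType, hc]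
    refine Finset.card_equiv (Equiv.ofBijective π ⟨hπ, Finite.surjective_of_injective hπ⟩)
      fun c => ?_
    simp only [Finset.mem_filter, Finset.mem_univ, true_and]
    exact Iff.rfl
  have h2 := card_restrict_fiber W z
  rw [Fintype.card_fin] at h2
  rw [h, div_eq_iff (by positivity), one_div, inv_pow, eq_inv_mul_iff_mul_eq₀ (by positivity),
    mul_comm]
  exact_mod_cast h2

end Column

/-! ### Leakage -/

section Leakage

variable {p β : ℝ} {m ℓ d : ℕ}

/-- Law of a source row with one-time pad: the high-entropy bits are independent of the
uniform padded bits. -/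
lemma law_srcEnc (σ : ↥(midSet p β m) ↪ Fin d) (wt : (Fin (2 ^ m) → ZMod 2) → ℝ)
    (y : MsgIdx p β m → ZMod 2) :
    law (fun x : (Fin (2 ^ m) → ZMod 2) × (Fin d → ZMod 2) => wt x.1 * (1 / 2) ^ d)
        (fun x => srcEnc σ x.1 x.2) y
      = law wt (restrictTo polarize (highSet p β m)) (fun j => y (.inl j))
        * (1 / 2) ^ (midSet p β m).card := by
  let f : (Fin d → ZMod 2) →+ (↥(midSet p β m) → ZMod 2) :=
    { toFun := fun u j => u (σ j)
      map_zero' := rfl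
      map_add' := fun _ _ => rfl }
  have hf : Function.Surjective f := fun z =>
    ⟨Function.extend σ z 0, funext fun j => σ.injective.extend_apply z 0 j⟩
  have hiff : ∀ v u, srcEnc σ v u = y ↔ restrictTo polarize (highSet p β m) v
      = (fun j => y (.inl j)) ∧ f u = fun j => y (.inr j) - polarize v j.1 := by
    intro v u
    constructor
    · rintro rfl
      refine ⟨rfl, funext fun j => ?_⟩
      change u (σ j) = polarize v j.1 + u (σ j) - polarize v j.1
      ring
    · rintro ⟨h1, h2⟩
      funext j
      rcases j with j | j
      · exact congrFun h1 j
      · have := congrFun h2 j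
        change u (σ j) = y (.inr j) - polarize v j.1 at this
        change polarize v j.1 + u (σ j) = y (.inr j)
        rw [this]; ring
  rw [law_eq_sum_ite, law_eq_sum_ite, Fintype.sum_prod_type, Finset.sum_mul]
  refine Finset.sum_congr rfl fun v _ => ?_
  simp only [hiff]
  by_cases h : restrictTo polarize (highSet p β m) v = fun j => y (.inl j)
  · simp only [h, true_and, if_true]
    rw [← Finset.sum_filter, Finset.sum_const, nsmul_eq_mul]
    have hc := card_fiber_mul_card f hf fun j => y (.inr j) - polarize v j.1
    rw [card_bits, card_bits, Fintype.card_coe, Fintype.card_fin] at hc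
    have hc' : ((Finset.univ.filter fun u => f u = fun j => y (.inr j) - polarize v j.1).card : ℝ)
        * 2 ^ (midSet p β m).card = 2 ^ d := by exact_mod_cast hc
    rw [one_div, inv_pow, inv_pow, ← hc']
    have hne : ((Finset.univ.filter fun u =>
        f u = fun j => y (.inr j) - polarize v j.1).card : ℝ) ≠ 0 := by
      intro h0
      rw [h0, zero_mul] at hc'
      exact (pow_ne_zero d two_ne_zero) hc'.symm
    field_simp
  · simp [h]

/-- Law of the source row `i` given that the rows in `K` are `v`. -/
def srcRow (p : ℝ) (K : Finset (Fin ℓ)) (v : Fin ℓ → Fin (2 ^ m) → ZMod 2) (i : Fin ℓ)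
    (x : Fin (2 ^ m) → ZMod 2) : ℝ :=
  if i ∈ K then (if x = v i then 1 else 0) else srcWeight p x

lemma srcRow_nonneg (h0 : 0 ≤ p) (h1 : p ≤ 1) (K : Finset (Fin ℓ))
    (v : Fin ℓ → Fin (2 ^ m) → ZMod 2) (i : Fin ℓ) (x) : 0 ≤ srcRow p K v i x := by
  unfold srcRow
  split_ifs
  exacts [zero_le_one, le_rfl, srcWeight_nonneg h0 h1 x]

lemma sum_srcRow (p : ℝ) (K : Finset (Fin ℓ)) (v : Fin ℓ → Fin (2 ^ m) → ZMod 2) (i : Fin ℓ) :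
    ∑ x, srcRow p K v i x = 1 := by
  unfold srcRow
  split_ifs
  · simp
  · exact sum_srcWeight p _

/-- Law of the compressed row `i` given that the source rows in `K` are `v`. -/
def msgRow (p β : ℝ) (K : Finset (Fin ℓ)) (v : Fin ℓ → Fin (2 ^ m) → ZMod 2) (i : Fin ℓ)
    (y : MsgIdx p β m → ZMod 2) : ℝ :=
  law (srcRow p K v i) (restrictTo polarize (highSet p β m)) (fun j => y (.inl j))
    * (1 / 2) ^ (midSet p β m).card

/-- Law of one bit of a compressed row `i` in the idealized model in which the rows outside `K`
are uniform. -/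
def cellLaw (p β : ℝ) (K : Finset (Fin ℓ)) (v : Fin ℓ → Fin (2 ^ m) → ZMod 2) (i : Fin ℓ) :
    MsgIdx p β m → ZMod 2 → ℝ :=
  Sum.elim (fun j => bitLaw K (fun i => polarize (v i) j.1) i) (fun _ => bitLaw ∅ 0 i)

lemma cellLaw_nonneg (K : Finset (Fin ℓ)) (v : Fin ℓ → Fin (2 ^ m) → ZMod 2) (i : Fin ℓ)
    (j : MsgIdx p β m) (b : ZMod 2) : 0 ≤ cellLaw p β K v i j b := by
  rcases j with j | j
  · exact bitLaw_nonneg K (fun i => polarize (v i) j.1) i b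
  · exact bitLaw_nonneg ∅ 0 i b

lemma sum_cellLaw (K : Finset (Fin ℓ)) (v : Fin ℓ → Fin (2 ^ m) → ZMod 2) (i : Fin ℓ)
    (j : MsgIdx p β m) : ∑ b, cellLaw p β K v i j b = 1 := by
  rcases j with j | j
  · exact sum_bitLaw K (fun i => polarize (v i) j.1) i
  · exact sum_bitLaw ∅ 0 i

lemma prod_cellLaw (K : Finset (Fin ℓ)) (v : Fin ℓ → Fin (2 ^ m) → ZMod 2) (i : Fin ℓ)
    (y : MsgIdx p β m → ZMod 2) :
    ∏ j, cellLaw p β K v i j (y j) = (if i ∈ K then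
      law (srcRow p K v i) (restrictTo polarize (highSet p β m)) (fun j => y (.inl j))
      else (1 / 2) ^ (highSet p β m).card) * (1 / 2) ^ (midSet p β m).card := by
  rw [Fintype.prod_sum_type]
  congr 1
  · simp only [cellLaw, Sum.elim_inl, bitLaw]
    split_ifs with hi
    · have hlaw : law (srcRow p K v i) (restrictTo polarize (highSet p β m)) (fun j => y (.inl j))
          = if restrictTo polarize (highSet p β m) (v i) = (fun j => y (.inl j)) then 1 else 0 := by
        rw [law_eq_sum_ite, Finset.sum_eq_single (v i)]
        · simp [srcRow, hi]
        · intro x _ hx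
          simp [srcRow, hi, hx]
        · simp
      rw [hlaw]
      split_ifs with h
      · refine Finset.prod_eq_one fun j _ => if_pos ?_
        exact (congrFun h j).symm
      · obtain ⟨j, hj⟩ := Function.ne_iff.1 h
        exact Finset.prod_eq_zero (Finset.mem_univ j) (if_neg fun h' => hj h'.symm)
    · rw [Finset.prod_const, Finset.card_univ, Fintype.card_coe]
  · simp [cellLaw, bitLaw]

lemma msgRow_nonneg (h0 : 0 ≤ p) (h1 : p ≤ 1) (K : Finset (Fin ℓ))
    (v : Fin ℓ → Fin (2 ^ m) → ZMod 2) (i : Fin ℓ) (y) : 0 ≤ msgRow p β K v i y :=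
  mul_nonneg (law_nonneg (srcRow_nonneg h0 h1 K v i) _ _) (by positivity)

lemma sum_msg (g : (↥(highSet p β m) → ZMod 2) → ℝ) :
    ∑ y : MsgIdx p β m → ZMod 2, g (fun j => y (.inl j)) * (1 / 2) ^ (midSet p β m).card
      = ∑ x, g x := by
  rw [← Equiv.sum_comp (Equiv.sumArrowEquivProdArrow _ _ _).symm, Fintype.sum_prod_type]
  refine Finset.sum_congr rfl fun x _ => ?_
  have h : ∀ z : ↥(midSet p β m) → ZMod 2,
      g (fun j => (Equiv.sumArrowEquivProdArrow _ _ _).symm (x, z) (.inl j)) = g x := fun _ => rfl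
  simp_rw [h]
  rw [Finset.sum_const, Finset.card_univ, card_bits, Fintype.card_coe, nsmul_eq_mul]
  push_cast
  rw [one_div, inv_pow]
  field_simp

lemma sum_msgRow (K : Finset (Fin ℓ)) (v : Fin ℓ → Fin (2 ^ m) → ZMod 2) (i : Fin ℓ) :
    ∑ y, msgRow p β K v i y = 1 := by
  unfold msgRow
  rw [sum_msg, sum_law, sum_srcRow]

/-- For a row in `K` the true and the idealized law coincide. For another row the uniform pad
cancels and the deficit of the high-entropy bits remains. -/
lemma kl_msgRow_le (h0 : 0 ≤ p) (h1 : p ≤ 1) (K : Finset (Fin ℓ))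
    (v : Fin ℓ → Fin (2 ^ m) → ZMod 2) (i : Fin ℓ) :
    kl (msgRow p β K v i) (fun y => ∏ j, cellLaw p β K v i j (y j))
      ≤ msgLen p β m * (delta β m * Real.log 2) := by
  have hδ : 0 ≤ delta β m := Real.rpow_nonneg two_pos.le _
  have hl : 0 ≤ Real.log 2 := Real.log_nonneg one_le_two
  simp_rw [prod_cellLaw]
  by_cases hi : i ∈ K
  · simp only [hi, if_true]
    refine (kl_self _).trans_le ?_
    positivity
  · simp only [hi, if_false]
    have hs : srcRow p K v i = srcWeight p := by funext x; simp [srcRow, hi]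
    unfold kl msgRow
    rw [hs]
    have e : ∀ y : MsgIdx p β m → ZMod 2,
        law (srcWeight p) (restrictTo polarize (highSet p β m)) (fun j => y (.inl j))
          * (1 / 2) ^ (midSet p β m).card
          * Real.log (law (srcWeight p) (restrictTo polarize (highSet p β m)) (fun j => y (.inl j))
            * (1 / 2) ^ (midSet p β m).card
            / ((1 / 2) ^ (highSet p β m).card * (1 / 2) ^ (midSet p β m).card))
        = (fun x => highLaw p β m x * Real.log (highLaw p β m x / (1 / 2) ^ (highSet p β m).card))
            (fun j => y (.inl j)) * (1 / 2) ^ (midSet p β m).card := by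
      intro y
      rw [mul_div_mul_right _ _ (by positivity)]
      simp only [highLaw]
      ring
    rw [Finset.sum_congr rfl fun y _ => e y, sum_msg fun x =>
      highLaw p β m x * Real.log (highLaw p β m x / (1 / 2) ^ (highSet p β m).card)]
    refine (kl_highLaw_le h0 h1 β m).trans ?_
    refine mul_le_mul_of_nonneg_right ?_ (by positivity)
    exact_mod_cast Nat.le_add_right _ _

/-- The encoded columns, as seen on `W`. -/
def columnView (π : (Fin ℓ → ZMod 2) → (Fin ℓ → ZMod 2)) (W : Finset (Fin ℓ)) (M : Type*)
    (x : Fin ℓ → M → ZMod 2) (i : ↥W) (j : M) : ZMod 2 := π (fun i' => x i' j) i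

/-- The purpose of the idealized model: true rows are independent but their bits are not, so columns
become independent only when all cells are. -/
lemma law_columnView {M : Type*} [Fintype M] [DecidableEq M]
    (π : (Fin ℓ → ZMod 2) → (Fin ℓ → ZMod 2)) (W : Finset (Fin ℓ))
    (r : Fin ℓ → M → ZMod 2 → ℝ) (z : ↥W → M → ZMod 2) :
    law (fun x : Fin ℓ → M → ZMod 2 => ∏ i, ∏ j, r i j (x i j)) (columnView π W M) z
      = ∏ j, law (fun c : Fin ℓ → ZMod 2 => ∏ i, r i j (c i)) (fun c (i : ↥W) => π c i)
          (fun i => z i j) := by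
  have h1 := law_comp_equiv (Equiv.piComm fun (_ : Fin ℓ) (_ : M) => ZMod 2)
    (fun y : M → Fin ℓ → ZMod 2 => ∏ j, ∏ i, r i j (y j i))
    (fun y => (Equiv.piComm fun (_ : M) (_ : ↥W) => ZMod 2) fun j (i : ↥W) => π (y j) i) z
  have h2 := law_equiv_comp (fun y : M → Fin ℓ → ZMod 2 => ∏ j, ∏ i, r i j (y j i))
    (fun y j (i : ↥W) => π (y j) i) (Equiv.piComm fun (_ : M) (_ : ↥W) => ZMod 2) z
  have h3 := law_prod_pi (fun j (c : Fin ℓ → ZMod 2) => ∏ i, r i j (c i))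
    (fun (_ : M) c (i : ↥W) => π c i) ((Equiv.piComm fun (_ : M) (_ : ↥W) => ZMod 2).symm z)
  refine Eq.trans ?_ (h1.trans (h2.trans h3))
  unfold law
  refine Finset.sum_congr (Finset.filter_congr fun x _ => Iff.rfl) fun x _ => ?_
  exact Finset.prod_comm

lemma prod_pi_nonneg {ι α : Type*} [Fintype ι] {P : ι → α → ℝ} (hP : ∀ i a, 0 ≤ P i a)
    (x : ι → α) : 0 ≤ ∏ i, P i (x i) := Finset.prod_nonneg fun i _ => hP i _

/-- The observation is almost uniform. -/
theorem varDist_msgRow_uniform_le (h0 : 0 ≤ p) (h1 : p ≤ 1)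
    {π : (Fin ℓ → ZMod 2) → (Fin ℓ → ZMod 2)} (hπ : Function.Injective π) (W K : Finset (Fin ℓ))
    (v : Fin ℓ → Fin (2 ^ m) → ZMod 2) {ε : ℝ} (hε0 : 0 ≤ ε)
    (hε : ∀ j : ↥(highSet p β m), kl (colLaw π W K fun i => polarize (v i) j.1)
      (fun _ => (1 / 2 : ℝ) ^ W.card) ≤ ε) :
    varDist (law (fun x : Fin ℓ → MsgIdx p β m → ZMod 2 => ∏ i, msgRow p β K v i (x i))
        (columnView π W (MsgIdx p β m))) (fun _ => ∏ _j : MsgIdx p β m, (1 / 2 : ℝ) ^ W.card)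
      ≤ √(2 * msgLen p β m * ε) + √(2 * msgLen p β m * ℓ * delta β m) := by
  have hδ : 0 ≤ delta β m := Real.rpow_nonneg two_pos.le _
  set P : Fin ℓ → (MsgIdx p β m → ZMod 2) → ℝ := msgRow p β K v with hP
  set Q : Fin ℓ → (MsgIdx p β m → ZMod 2) → ℝ :=
    fun i y => ∏ j, cellLaw p β K v i j (y j) with hQ
  have hQ0 : ∀ i y, 0 ≤ Q i y := fun i y => prod_pi_nonneg (cellLaw_nonneg K v i) y
  have hQ1 : ∀ i, ∑ y, Q i y = 1 := fun i => by
    rw [hQ, sum_prod_pi (cellLaw p β K v i)]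
    exact Finset.prod_eq_one fun j _ => sum_cellLaw K v i j
  have hP0 : ∀ i y, 0 ≤ P i y := msgRow_nonneg h0 h1 K v
  have hP1 : ∀ i, ∑ y, P i y = 1 := sum_msgRow K v
  have hPQ : ∀ i y, Q i y = 0 → P i y = 0 := by
    intro i y h
    simp only [hQ, prod_cellLaw] at h
    by_cases hi : i ∈ K
    · simp only [hi, if_true] at h
      exact h
    · simp only [hi, if_false] at h
      exact absurd h (by positivity)
  -- The replacement is made before encoding; encoding and restriction to `W` cannot increase the
  -- distance.
  have step1 : varDist (fun x : Fin ℓ → MsgIdx p β m → ZMod 2 => ∏ i, P i (x i))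
      (fun x => ∏ i, Q i (x i)) ≤ √(2 * msgLen p β m * ℓ * delta β m) := by
    refine (varDist_le_sqrt_two_mul_kl (prod_pi_nonneg hP0) (prod_pi_nonneg hQ0) ?_ ?_ ?_).trans ?_
    · rw [sum_prod_pi]; exact Finset.prod_eq_one fun i _ => hP1 i
    · rw [sum_prod_pi]; exact Finset.prod_eq_one fun i _ => hQ1 i
    · intro x hx
      obtain ⟨i, _, hi⟩ := Finset.prod_eq_zero_iff.1 hx
      exact Finset.prod_eq_zero (Finset.mem_univ i) (hPQ i _ hi)
    · refine Real.sqrt_le_sqrt ?_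
      rw [kl_prod_pi hP1 hPQ]
      have h2 : ∑ i, kl (P i) (Q i) ≤ ℓ * (msgLen p β m * (delta β m * Real.log 2)) := by
        refine (Finset.sum_le_sum fun i _ => kl_msgRow_le h0 h1 K v i).trans_eq ?_
        simp
      have h3 : Real.log 2 ≤ 1 := by
        have := Real.log_two_lt_d9; linarith
      have h4 : (ℓ : ℝ) * (msgLen p β m * (delta β m * Real.log 2))
          ≤ ℓ * (msgLen p β m * (delta β m * 1)) := by gcongr
      nlinarith
  have hcol : ∀ z : ↥W → MsgIdx p β m → ZMod 2,
      law (fun x : Fin ℓ → MsgIdx p β m → ZMod 2 => ∏ i, Q i (x i))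
        (columnView π W (MsgIdx p β m)) z
      = ∏ j, law (fun c : Fin ℓ → ZMod 2 => ∏ i, cellLaw p β K v i j (c i))
          (fun c (i : ↥W) => π c i) (fun i => z i j) := fun z =>
    law_columnView π W (fun i j => cellLaw p β K v i j) z
  set R : MsgIdx p β m → (↥W → ZMod 2) → ℝ := fun j =>
    law (fun c : Fin ℓ → ZMod 2 => ∏ i, cellLaw p β K v i j (c i)) (fun c (i : ↥W) => π c i)
    with hR
  have hRl : ∀ j, R (.inl j) = colLaw π W K fun i => polarize (v i) j.1 := fun _ => rfl
  have hRr : ∀ j, R (.inr j) = fun _ => (1 / 2 : ℝ) ^ W.card := fun j => by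
    rw [← colLaw_empty hπ W 0]; rfl
  have hR0 : ∀ j z, 0 ≤ R j z := fun j z =>
    law_nonneg (fun c => Finset.prod_nonneg fun i _ => cellLaw_nonneg K v i j _) _ _
  have hu1 : ∑ _z : ↥W → ZMod 2, (1 / 2 : ℝ) ^ W.card = 1 := by
    rw [Finset.sum_const, Finset.card_univ, card_bits, Fintype.card_coe, nsmul_eq_mul]
    push_cast
    rw [← mul_pow]; norm_num
  have hR1 : ∀ j, ∑ z, R j z = 1 := by
    rintro (j | j)
    · rw [hRl, sum_colLaw]
    · rw [hRr, hu1]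
  -- In the idealized model relative entropy adds over the columns; the padded columns contribute 0.
  have step2 : varDist (law (fun x : Fin ℓ → MsgIdx p β m → ZMod 2 => ∏ i, Q i (x i))
        (columnView π W (MsgIdx p β m))) (fun _ => ∏ _j : MsgIdx p β m, (1 / 2 : ℝ) ^ W.card)
      ≤ √(2 * msgLen p β m * ε) := by
    have e1 : law (fun x : Fin ℓ → MsgIdx p β m → ZMod 2 => ∏ i, Q i (x i))
        (columnView π W (MsgIdx p β m)) = fun z => (fun y : MsgIdx p β m → ↥W → ZMod 2 =>
          ∏ j, R j (y j)) ((Equiv.piComm fun (_ : ↥W) (_ : MsgIdx p β m) => ZMod 2) z) :=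
      funext hcol
    rw [e1]
    rw [varDist_comp_equiv (Equiv.piComm fun (_ : ↥W) (_ : MsgIdx p β m) => ZMod 2)
      (fun y : MsgIdx p β m → ↥W → ZMod 2 => ∏ j, R j (y j))
      (fun _ => ∏ _j : MsgIdx p β m, (1 / 2 : ℝ) ^ W.card)]
    have hpos : ∀ y : MsgIdx p β m → ↥W → ZMod 2,
        ∏ _j : MsgIdx p β m, (1 / 2 : ℝ) ^ W.card ≠ 0 := fun _ => by positivity
    refine (varDist_le_sqrt_two_mul_kl (prod_pi_nonneg hR0) (fun _ => by positivity) ?_ ?_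
      fun y hy => absurd hy (hpos y)).trans ?_
    · rw [sum_prod_pi]; exact Finset.prod_eq_one fun i _ => hR1 i
    · rw [sum_prod_pi fun (_ : MsgIdx p β m) (_ : ↥W → ZMod 2) => (1 / 2 : ℝ) ^ W.card]
      exact Finset.prod_eq_one fun i _ => hu1
    · refine Real.sqrt_le_sqrt ?_
      rw [kl_prod_pi (Q := fun (_ : MsgIdx p β m) (_ : ↥W → ZMod 2) => (1 / 2 : ℝ) ^ W.card) hR1
        fun _ _ h => absurd h (by positivity)]
      rw [mul_assoc]
      refine mul_le_mul_of_nonneg_left ?_ two_pos.le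
      have h2 : ∀ j, kl (R j) (fun _ => (1 / 2 : ℝ) ^ W.card) ≤ ε := by
        rintro (j | j)
        · exact hε j
        · rw [hRr, kl_self]; exact hε0
      refine (Finset.sum_le_sum fun j _ => h2 j).trans_eq ?_
      rw [Finset.sum_const, Finset.card_univ, Fintype.card_sum, Fintype.card_coe, Fintype.card_coe,
        nsmul_eq_mul, msgLen]
  have h := varDist_triangle
    (law (fun x : Fin ℓ → MsgIdx p β m → ZMod 2 => ∏ i, P i (x i)) (columnView π W (MsgIdx p β m)))
    (law (fun x : Fin ℓ → MsgIdx p β m → ZMod 2 => ∏ i, Q i (x i)) (columnView π W (MsgIdx p β m)))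
    (fun _ => ∏ _j : MsgIdx p β m, (1 / 2 : ℝ) ^ W.card)
  have h2 := (varDist_law_le (fun x : Fin ℓ → MsgIdx p β m → ZMod 2 => ∏ i, P i (x i))
    (fun x => ∏ i, Q i (x i)) (columnView π W (MsgIdx p β m))).trans step1
  linarith

end Leakage

/-! ### The conditional law of the observation and the leakage -/

section LeakageBound

variable {p β : ℝ} {m ℓ d ks kw : ℕ}

lemma weight_eq_prod (p : ℝ) (ω : Sample m ℓ d) :
    weight p ω = ∏ i, srcWeight p (ω.1 i) * (1 / 2) ^ d := by
  have hc : (Fintype.card (Fin ℓ → Fin d → ZMod 2) : ℝ) = (2 ^ d) ^ ℓ := by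
    rw [Fintype.card_fun, card_bits, Fintype.card_fin, Fintype.card_fin]
    push_cast
    rfl
  rw [weight, hc, Finset.prod_mul_distrib, Finset.prod_const, Finset.card_univ, Fintype.card_fin]
  rw [one_div, one_div, inv_pow, inv_pow]

/-- Rows of source bits paired with rows of seed bits. -/
def rowsEquiv (m ℓ d : ℕ) :
    (Fin ℓ → (Fin (2 ^ m) → ZMod 2) × (Fin d → ZMod 2)) ≃ Sample m ℓ d :=
  Equiv.arrowProdEquivProdArrow _ _ _

lemma law_observe_srcRow (h : ks + kw = ℓ) (B : Codebook ks kw ℓ)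
    (σ : ↥(midSet p β m) ↪ Fin d) (W K : Finset (Fin ℓ)) (v : Fin ℓ → Fin (2 ^ m) → ZMod 2) :
    law (fun x : Fin ℓ → (Fin (2 ^ m) → ZMod 2) × (Fin d → ZMod 2) =>
        ∏ i, srcRow p K v i (x i).1 * (1 / 2) ^ d)
      (fun x => observe h B σ W (rowsEquiv m ℓ d x))
      = law (fun x : Fin ℓ → MsgIdx p β m → ZMod 2 => ∏ i, msgRow p β K v i (x i))
        (columnView (chanEnc h B) W (MsgIdx p β m)) := by
  funext z
  have e : (fun x : Fin ℓ → MsgIdx p β m → ZMod 2 => ∏ i, msgRow p β K v i (x i))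
      = law (fun x : Fin ℓ → (Fin (2 ^ m) → ZMod 2) × (Fin d → ZMod 2) =>
          ∏ i, srcRow p K v i (x i).1 * (1 / 2) ^ d) (fun x i => srcEnc σ (x i).1 (x i).2) := by
    funext y
    have := law_prod_pi (fun i (x : (Fin (2 ^ m) → ZMod 2) × (Fin d → ZMod 2)) =>
      srcRow p K v i x.1 * (1 / 2) ^ d) (fun _ x => srcEnc σ x.1 x.2) y
    rw [this]
    exact Finset.prod_congr rfl fun i _ => (law_srcEnc σ (srcRow p K v i) (y i)).symm
  rw [e, law_law]
  rfl

lemma law_observe (h : ks + kw = ℓ) (B : Codebook ks kw ℓ)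
    (σ : ↥(midSet p β m) ↪ Fin d) (W : Finset (Fin ℓ)) :
    law (weight p) (observe h B σ W)
      = law (fun x : Fin ℓ → MsgIdx p β m → ZMod 2 => ∏ i, msgRow p β ∅ 0 i (x i))
        (columnView (chanEnc h B) W (MsgIdx p β m)) := by
  rw [← law_observe_srcRow h B σ W ∅ 0]
  funext z
  rw [← law_comp_equiv (rowsEquiv m ℓ d)]
  congr 1
  funext x
  rw [weight_eq_prod]
  rfl

/-- Extension by zero of the values of the secret messages. -/
def extendRows (K : Finset (Fin ℓ)) (v : ↥K → Fin (2 ^ m) → ZMod 2) (i : Fin ℓ) :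
    Fin (2 ^ m) → ZMod 2 := if h : i ∈ K then v ⟨i, h⟩ else 0

/-- By independence of the rows, restriction to V_K = v factors into the probability of that event
and the product law with the rows in `K` frozen. -/
lemma weight_ite_secret (p : ℝ) (K : Finset (Fin ℓ)) (v : ↥K → Fin (2 ^ m) → ZMod 2)
    (x : Fin ℓ → (Fin (2 ^ m) → ZMod 2) × (Fin d → ZMod 2)) :
    (if secretPart d K (rowsEquiv m ℓ d x) = v then weight p (rowsEquiv m ℓ d x) else 0)
      = (∏ i ∈ K, srcWeight p (extendRows K v i))
        * ∏ i, srcRow p K (extendRows K v) i (x i).1 * (1 / 2) ^ d := by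
  split_ifs with hs
  · have hK : ∏ i ∈ K, srcWeight p (extendRows K v i)
        = ∏ i, if i ∈ K then srcWeight p (extendRows K v i) else 1 := by
      rw [Finset.prod_ite_mem, Finset.univ_inter]
    rw [weight_eq_prod, hK, ← Finset.prod_mul_distrib]
    refine Finset.prod_congr rfl fun i _ => ?_
    change srcWeight p (x i).1 * _ = _
    by_cases hi : i ∈ K
    · have : (x i).1 = extendRows K v i := by
        rw [extendRows, dif_pos hi, ← hs]; rfl
      simp [srcRow, hi, this]
    · simp [srcRow, hi]
  · obtain ⟨i, hi⟩ := Function.ne_iff.1 hs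
    have : ∏ i, srcRow p K (extendRows K v) i (x i).1 * (1 / 2) ^ d = 0 := by
      refine Finset.prod_eq_zero (Finset.mem_univ i.1) ?_
      have hne : (x i).1 ≠ extendRows K v i := by
        rw [extendRows, dif_pos i.2]; exact hi
      simp [srcRow, i.2, hne]
    rw [this, mul_zero]

lemma law_secret_prod (p : ℝ) {γ : Type*} [DecidableEq γ] (K : Finset (Fin ℓ))
    (v : ↥K → Fin (2 ^ m) → ZMod 2) (X : Sample m ℓ d → γ) (z : γ) :
    law (weight p) (fun ω => (X ω, secretPart d K ω)) (z, v)
      = (∏ i ∈ K, srcWeight p (extendRows K v i))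
        * law (fun x : Fin ℓ → (Fin (2 ^ m) → ZMod 2) × (Fin d → ZMod 2) =>
            ∏ i, srcRow p K (extendRows K v) i (x i).1 * (1 / 2) ^ d)
          (fun x => X (rowsEquiv m ℓ d x)) z := by
  rw [← law_comp_equiv (rowsEquiv m ℓ d), law_eq_sum_ite, law_eq_sum_ite, Finset.mul_sum]
  refine Finset.sum_congr rfl fun x _ => ?_
  have h := weight_ite_secret p K v x
  by_cases hz : X (rowsEquiv m ℓ d x) = z
  · simp only [Prod.mk.injEq, hz, true_and, if_true]
    exact h
  · simp [hz]

lemma sum_prod_srcRow (p : ℝ) (K : Finset (Fin ℓ)) (v : Fin ℓ → Fin (2 ^ m) → ZMod 2) :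
    ∑ x : Fin ℓ → (Fin (2 ^ m) → ZMod 2) × (Fin d → ZMod 2),
      ∏ i, srcRow p K v i (x i).1 * (1 / 2) ^ d = 1 := by
  rw [sum_prod_pi fun i (x : (Fin (2 ^ m) → ZMod 2) × (Fin d → ZMod 2)) =>
    srcRow p K v i x.1 * (1 / 2) ^ d]
  refine Finset.prod_eq_one fun i _ => ?_
  rw [Fintype.sum_prod_type]
  simp only [Finset.sum_const, Finset.card_univ, card_bits, Fintype.card_fin, nsmul_eq_mul]
  rw [← Finset.mul_sum, ← Finset.sum_mul, sum_srcRow, one_mul]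
  push_cast
  rw [← mul_pow]; norm_num

lemma law_secret (p : ℝ) (K : Finset (Fin ℓ)) (v : ↥K → Fin (2 ^ m) → ZMod 2) :
    law (weight p) (secretPart d K) v = ∏ i ∈ K, srcWeight p (extendRows K v i) := by
  -- A constant observation turns the joint law into the marginal of the secret part.
  have h := sum_law_prod (weight p) (fun _ : Sample m ℓ d => ()) (secretPart d K) v
  rw [← h]
  simp only [law_secret_prod, Finset.univ_unique, Finset.sum_singleton]
  have h2 := sum_law (fun x : Fin ℓ → (Fin (2 ^ m) → ZMod 2) × (Fin d → ZMod 2) =>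
            ∏ i, srcRow p K (extendRows K v) i (x i).1 * (1 / 2) ^ d) (fun _ => ())
  rw [sum_prod_srcRow] at h2
  simp only [Finset.univ_unique, Finset.sum_singleton] at h2
  rw [h2, mul_one]

lemma condLaw_observe (h : ks + kw = ℓ) (B : Codebook ks kw ℓ)
    (σ : ↥(midSet p β m) ↪ Fin d) (W K : Finset (Fin ℓ)) (v : ↥K → Fin (2 ^ m) → ZMod 2)
    (hv : 0 < law (weight p) (secretPart d K) v) :
    condLaw (weight p) (observe h B σ W) (secretPart d K) v
      = law (fun x : Fin ℓ → MsgIdx p β m → ZMod 2 =>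
          ∏ i, msgRow p β K (extendRows K v) i (x i))
        (columnView (chanEnc h B) W (MsgIdx p β m)) := by
  rw [← law_observe_srcRow h B σ W]
  funext z
  rw [condLaw, law_secret_prod, law_secret]
  rw [law_secret] at hv
  rw [mul_div_cancel_left₀ _ hv.ne']

/-- The leakage of the scheme with a bijective codebook. -/
theorem leakage_le (h0 : 0 ≤ p) (h1 : p ≤ 1) (h : ks + kw = ℓ) (B : Codebook ks kw ℓ)
    (hB : Function.Injective (chanEnc h B)) (σ : ↥(midSet p β m) ↪ Fin d)
    (W K : Finset (Fin ℓ)) (v : ↥K → Fin (2 ^ m) → ZMod 2)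
    (hv : 0 < law (weight p) (secretPart d K) v) {ε : ℝ} (hε0 : 0 ≤ ε)
    (hε : ∀ _j : ↥(highSet p β m), ∀ a,
      kl (colLaw (chanEnc h B) W K a) (fun _ => (1 / 2 : ℝ) ^ W.card) ≤ ε) :
    leakage h B σ W K v
      ≤ √(2 * msgLen p β m * ε) + 2 * √(2 * msgLen p β m * ℓ * delta β m) := by
  have a1 := varDist_msgRow_uniform_le (β := β) h0 h1 hB W K (extendRows K v) hε0
    (fun j => hε j _)
  -- The unconditional law is the case K = ∅, where ε = 0 is allowed because a bijection keeps
  -- uniform columns uniform. This yields the factor 2 on one root only.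
  have a2 := varDist_msgRow_uniform_le (β := β) (m := m) h0 h1 hB W ∅ 0 le_rfl
    (fun j => by rw [colLaw_empty hB, kl_self])
  rw [mul_zero, Real.sqrt_zero, zero_add, varDist_comm] at a2
  rw [leakage, condLaw_observe h B σ W K v hv, law_observe]
  refine (varDist_triangle _ (fun _ => ∏ _j : MsgIdx p β m, (1 / 2 : ℝ) ^ W.card) _).trans ?_
  linarith

/-- The codebook given by a map of columns. -/
def codebookOf (h : ks + kw = ℓ) (π : (Fin ℓ → ZMod 2) → (Fin ℓ → ZMod 2)) : Codebook ks kw ℓ :=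
  fun a b => π fun i => Fin.append a b (Fin.cast h.symm i)

/-- Bin and codeword index together form the whole column, so every map of columns is a binning
codebook for every split into k_s and k_w. -/
lemma chanEnc_codebookOf (h : ks + kw = ℓ) (π : (Fin ℓ → ZMod 2) → (Fin ℓ → ZMod 2)) :
    chanEnc h (codebookOf h π) = π := by
  subst h
  funext c
  unfold chanEnc codebookOf
  congr 1
  funext i
  refine Fin.addCases (fun j => ?_) (fun j => ?_) i <;> simp

end LeakageBound

/-! ### Number of transmitted symbols per row -/

lemma binary_entropy_le {x y : ℝ} (h : x + y = 1) :
    Real.negMulLog x / Real.log 2 + Real.negMulLog y / Real.log 2 ≤ 1 := by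
  have hl : 0 < Real.log 2 := Real.log_pos one_lt_two
  obtain rfl : y = 1 - x := by linarith
  rw [← add_div, div_le_one hl, ← Real.binEntropy_eq_negMulLog_add_negMulLog_one_sub]
  exact Real.binEntropy_le_log_two

lemma polarEntropy_le_one {p : ℝ} (h0 : 0 ≤ p) (h1 : p ≤ 1) {m : ℕ} (j : Fin (2 ^ m)) :
    polarEntropy p m j ≤ 1 := by
  have hw : ∀ v : Fin (2 ^ m) → ZMod 2, 0 ≤ srcWeight p v := srcWeight_nonneg h0 h1
  have hone : ∑ b, law (srcWeight p) (polarPrefix j) b = 1 :=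
    (sum_law _ _).trans (sum_srcWeight p _)
  rw [polarEntropy, condEntropy, ← hone]
  refine Finset.sum_le_sum fun b _ => ?_
  rw [sum_zmod_two]
  have hL := law_nonneg hw (polarPrefix j) b
  rcases hL.eq_or_lt with hz | hz
  · rw [← hz, zero_mul]
  · refine (mul_le_mul_of_nonneg_left (binary_entropy_le ?_) hL).trans_eq (mul_one _)
    have hs := sum_law_prod (srcWeight p) (fun v => polarize v j) (polarPrefix j) b
    rw [sum_zmod_two] at hs
    rw [condLaw, condLaw, ← add_div, hs, div_self hz.ne']

lemma card_compl_lowSet_le (p β : ℝ) (m : ℕ) : (lowSet p β m)ᶜ.card ≤ msgLen p β m := by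
  refine (Finset.card_le_card ?_).trans (Finset.card_union_le (highSet p β m) (midSet p β m))
  intro j hj
  rw [Finset.mem_compl] at hj
  by_cases h : j ∈ highSet p β m
  · exact Finset.mem_union_left _ h
  · refine Finset.mem_union_right _ ?_
    simp [midSet, hj, h]

lemma delta_pos (β : ℝ) (m : ℕ) : 0 < delta β m := Real.rpow_pos_of_pos two_pos _

lemma sum_lowSet_le (p β : ℝ) (m : ℕ) :
    ∑ j ∈ lowSet p β m, polarEntropy p m j ≤ 2 ^ m * delta β m := by
  have h : ∀ j ∈ lowSet p β m, polarEntropy p m j ≤ delta β m := fun j hj =>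
    (Finset.mem_filter.1 hj).2.le
  refine (Finset.sum_le_card_nsmul _ _ _ h).trans ?_
  rw [nsmul_eq_mul]
  refine mul_le_mul_of_nonneg_right ?_ (delta_pos β m).le
  have := Finset.card_le_univ (lowSet p β m)
  rw [Fintype.card_fin] at this
  exact_mod_cast this

/-- The entropy of a bit of the source. -/
def bitEntropy (p : ℝ) : ℝ := (Real.negMulLog p + Real.negMulLog (1 - p)) / Real.log 2

lemma bitEntropy_pos {p : ℝ} (h0 : 0 < p) (h1 : p < 1) : 0 < bitEntropy p := by
  refine div_pos ?_ (Real.log_pos one_lt_two)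
  have a := mul_one_sub_le_negMulLog h0.le
  have b := mul_one_sub_le_negMulLog (show 0 ≤ 1 - p by linarith)
  nlinarith

lemma sum_polarEntropy {p : ℝ} (h0 : 0 ≤ p) (h1 : p ≤ 1) (m : ℕ) :
    ∑ j, polarEntropy p m j = 2 ^ m * bitEntropy p := by
  have := sum_polarEntropy_mul_log_two h0 h1 m
  rw [bitEntropy, mul_div_assoc', eq_div_iff (Real.log_pos one_lt_two).ne', this]

/-- The total entropy nH(p) is at most nδ_n from the low positions plus one bit from each other
position. Hence ñ grows linearly in n for 0 < p < 1 and β > 0. -/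
lemma bitEntropy_mul_le_msgLen {p : ℝ} (h0 : 0 ≤ p) (h1 : p ≤ 1) (β : ℝ) (m : ℕ) :
    2 ^ m * (bitEntropy p - delta β m) ≤ msgLen p β m := by
  have h := sum_polarEntropy h0 h1 m
  rw [← Finset.sum_add_sum_compl (lowSet p β m)] at h
  have h2 := sum_lowSet_le p β m
  have h3 : ∑ j ∈ (lowSet p β m)ᶜ, polarEntropy p m j ≤ msgLen p β m := by
    refine (Finset.sum_le_card_nsmul _ _ 1 fun j _ => polarEntropy_le_one h0 h1 j).trans ?_
    rw [nsmul_eq_mul, mul_one]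
    exact_mod_cast card_compl_lowSet_le p β m
  linarith

lemma polarEntropy_eq_zero {p : ℝ} (hp : p = 0 ∨ p = 1) {m : ℕ} (j : Fin (2 ^ m)) :
    polarEntropy p m j = 0 := by
  have h0 : 0 ≤ p := by rcases hp with rfl | rfl <;> norm_num
  have h1 : p ≤ 1 := by rcases hp with rfl | rfl <;> norm_num
  have h := sum_polarEntropy h0 h1 m
  have hb : bitEntropy p = 0 := by
    rcases hp with rfl | rfl <;> simp [bitEntropy]
  rw [hb, mul_zero] at h
  exact (Finset.sum_eq_zero_iff_of_nonneg fun j _ => polarEntropy_nonneg h0 h1 j).1 h j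
    (Finset.mem_univ j)

lemma lowSet_eq_univ {p : ℝ} (hp : p = 0 ∨ p = 1) (β : ℝ) (m : ℕ) :
    lowSet p β m = Finset.univ := by
  ext j
  simp [lowSet, polarEntropy_eq_zero hp, delta_pos]

lemma delta_le_one {β : ℝ} (m : ℕ) : delta β m ≤ 1 := by
  refine Real.rpow_le_one_of_one_le_of_nonpos one_le_two ?_
  have : (0 : ℝ) ≤ ((2 : ℝ) ^ m) ^ β := by positivity
  linarith

lemma msgLen_eq_zero {p : ℝ} (hp : p = 0 ∨ p = 1) (β : ℝ) (m : ℕ) : msgLen p β m = 0 := by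
  have h1 : highSet p β m = ∅ := by
    refine Finset.filter_eq_empty_iff.2 fun j _ => ?_
    rw [polarEntropy_eq_zero hp]
    have := delta_le_one (β := β) m
    linarith
  have h2 : midSet p β m = ∅ := by
    rw [midSet, lowSet_eq_univ hp, h1, Finset.union_empty, Finset.compl_univ]
  rw [msgLen, h1, h2]
  rfl

/-- For β = 0 the threshold is 1/2, and the entropy of the parity bit is eventually above (3/4)/(2
log 2) > 1/2. -/
lemma eventually_one_le_msgLen_zero {p : ℝ} (h0 : 0 < p) (h1 : p < 1) :
    ∀ᶠ m : ℕ in atTop, 1 ≤ msgLen p 0 m := by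
  have hx : |1 - 2 * p| < 1 := by rw [abs_lt]; constructor <;> linarith
  have ht : Tendsto (fun m : ℕ => ((1 - 2 * p) ^ 2 ^ m) ^ 2) atTop (𝓝 (0 ^ 2)) :=
    ((tendsto_pow_atTop_nhds_zero_of_abs_lt_one hx).comp
      (tendsto_pow_atTop_atTop_of_one_lt one_lt_two)).pow 2
  rw [zero_pow two_ne_zero] at ht
  filter_upwards [ht.eventually_lt_const (show (0 : ℝ) < 1 / 4 by norm_num)] with m hm
  have h := polarEntropy_zero_ge h0.le h1.le m
  have hl : 0 < Real.log 2 := Real.log_pos one_lt_two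
  have hl2 : Real.log 2 < 0.7 := by have := Real.log_two_lt_d9; linarith
  have hbig : 1 / 2 < polarEntropy p m 0 := by
    refine lt_of_lt_of_le ?_ h
    rw [lt_div_iff₀ (by positivity)]
    linarith
  have hδ : delta 0 m = 1 / 2 := by
    rw [delta, Real.rpow_zero, Real.rpow_neg_one]; norm_num
  have hmem : (0 : Fin (2 ^ m)) ∈ highSet p 0 m := by
    refine Finset.mem_filter.2 ⟨Finset.mem_univ _, ?_⟩
    rw [hδ]; linarith
  exact (Finset.card_pos.2 ⟨0, hmem⟩).trans_le (Nat.le_add_right _ _)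

/-! ### The codebook for given parameters -/

/-- Here lam and u are of order log ℓ, so the demands on ℓ and on κ are both quadratic in log ℓ. A
single codebook serves all `W` and `K` of the given sizes. -/
theorem exists_codebook {ℓ : ℕ} (hℓ : 1 ≤ ℓ) {t κ : ℝ} (ht : 1 ≤ t)
    (h1 : (42 + 7 * t) * (Real.logb 2 ℓ ^ 2 + 1) ≤ ℓ)
    (h2 : (42 + 7 * t) * (Real.logb 2 ℓ ^ 2 + 1) ≤ κ)
    {w ks kw : ℕ} (hw : ks + w + ⌈t * Real.logb 2 (ℓ : ℝ)⌉₊ ≤ ℓ) (hk : ks + kw = ℓ) :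
    ∃ B : Codebook ks kw ℓ, Function.Injective (chanEnc hk B) ∧
      ∀ W K : Finset (Fin ℓ), W.card = w → K.card = ks → ∀ a,
        kl (colLaw (chanEnc hk B) W K a) (fun _ => (1 / 2 : ℝ) ^ W.card)
          ≤ κ / 2 ^ ⌈t * Real.logb 2 (ℓ : ℝ)⌉₊ := by
  set L := Real.logb 2 (ℓ : ℝ) with hL
  set u := ⌈t * L⌉₊ with hu
  have hℓR : (1 : ℝ) ≤ ℓ := by exact_mod_cast hℓ
  have hL0 : 0 ≤ L := Real.logb_nonneg one_lt_two hℓR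
  have huR : (u : ℝ) ≤ t * L + 1 := (Nat.ceil_lt_add_one (by positivity)).le
  set lam := ⌈L⌉₊ + 1 with hlam
  have hlamR : (lam : ℝ) ≤ L + 2 := by
    have := (Nat.ceil_lt_add_one hL0).le
    rw [hlam]; push_cast; linarith
  have hlam2 : 2 * ℓ ≤ 2 ^ lam := by
    have h3 : (ℓ : ℝ) ≤ 2 ^ ⌈L⌉₊ := by
      rw [← Real.rpow_natCast]
      calc (ℓ : ℝ) = 2 ^ L := (Real.rpow_logb two_pos (by norm_num) (by linarith)).symm
        _ ≤ _ := Real.rpow_le_rpow_of_exponent_le one_le_two (Nat.le_ceil L)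
    have h4 : ℓ ≤ 2 ^ ⌈L⌉₊ := by exact_mod_cast h3
    rw [hlam, pow_succ]
    omega
  have hlam0 : (0 : ℝ) ≤ lam := Nat.cast_nonneg _
  have hu0 : (0 : ℝ) ≤ u := Nat.cast_nonneg _
  -- The left side is at most (3 + 2t)L² + (14 + 5t)L + 25, and 2L ≤ L² + 1; the constants are
  -- generous.
  have hpoly : (u : ℝ) + 8 + lam * (3 * lam + 2 * u) ≤ (42 + 7 * t) * (L ^ 2 + 1) := by
    have h5 : (lam : ℝ) * (3 * lam + 2 * u) ≤ (L + 2) * (3 * (L + 2) + 2 * (t * L + 1)) :=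
      mul_le_mul hlamR (by linarith) (by positivity) (by linarith)
    nlinarith [sq_nonneg (L - 1), mul_nonneg (show 0 ≤ t by linarith) (sq_nonneg (L - 1)),
      mul_nonneg (show 0 ≤ t by linarith) (sq_nonneg L)]
  obtain ⟨π, hinj, hπ⟩ := exists_perm_typeDiv_le (ℓ := ℓ) (w := w) (u := u) (lam := lam) (κ := κ)
    (by omega) hlam2 (by
      have h6 : ((lam * (2 * lam + u) + 3 : ℕ) : ℝ) ≤ ℓ := by
        push_cast
        have : (lam : ℝ) * (2 * lam + u) ≤ lam * (3 * lam + 2 * u) :=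
          mul_le_mul_of_nonneg_left (by linarith) hlam0
        linarith
      exact_mod_cast h6) (hpoly.trans h2)
  refine ⟨codebookOf hk π, ?_, fun W K hW hK a => ?_⟩
  · rw [chanEnc_codebookOf]; exact hinj
  · rw [chanEnc_codebookOf, hW]
    exact kl_colLaw_le hW (fun F hF c₀ => hπ W F hW hF c₀) K (by omega) a

/-! ### Asymptotics -/

lemma eventually_quadratic_log_le (D : ℝ) {ℓ : ℕ → ℕ} (hℓ : Tendsto ℓ atTop atTop) :
    ∀ᶠ m in atTop, D * (Real.logb 2 (ℓ m) ^ 2 + 1) ≤ ℓ m := by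
  have h1 : (fun x : ℝ => D * (Real.logb 2 x ^ 2 + 1)) =o[atTop] (id : ℝ → ℝ) := by
    refine IsLittleO.const_mul_left (IsLittleO.add ?_ (isLittleO_const_id_atTop 1)) D
    have h2 : (fun x : ℝ => Real.logb 2 x ^ 2)
        = fun x => (1 / Real.log 2 ^ 2) * Real.log x ^ 2 := by
      funext x
      rw [Real.logb, div_pow]; ring
    rw [h2]
    exact (Real.isLittleO_pow_log_id_atTop (n := 2)).const_mul_left _
  have h3 := h1.bound one_pos
  have h4 : Tendsto (fun m => (ℓ m : ℝ)) atTop atTop := tendsto_natCast_atTop_atTop.comp hℓ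
  filter_upwards [h4.eventually h3] with m hm
  rw [one_mul, Real.norm_eq_abs, Real.norm_eq_abs, id, Nat.abs_cast] at hm
  exact (le_abs_self _).trans hm

lemma tendsto_two_pow_atTop : Tendsto (fun m : ℕ => (2 : ℝ) ^ m) atTop atTop :=
  tendsto_pow_atTop_atTop_of_one_lt one_lt_two

/-- The place where β < 1/2 is essential: n^(2β) = o(n). -/
lemma eventually_quadratic_rpow_le (D : ℝ) {c β : ℝ} (hc : 0 < c) (hβ : β < 1 / 2) :
    ∀ᶠ m : ℕ in atTop, D * ((((2 : ℝ) ^ m) ^ β) ^ 2 + 1) ≤ c * 2 ^ m := by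
  have h1 : (fun x : ℝ => D * ((x ^ β) ^ 2 + 1)) =o[atTop] (id : ℝ → ℝ) := by
    refine IsLittleO.const_mul_left (IsLittleO.add ?_ (isLittleO_const_id_atTop 1)) D
    refine (isLittleO_iff_tendsto' ?_).2 ?_
    · filter_upwards [eventually_gt_atTop 0] with x hx h
      exact absurd h hx.ne'
    · refine (tendsto_rpow_neg_atTop (show 0 < 1 - 2 * β by linarith)).congr' ?_
      filter_upwards [eventually_gt_atTop 0] with x hx
      rw [id, ← Real.rpow_natCast, ← Real.rpow_mul hx.le, ← Real.rpow_sub_one hx.ne']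
      congr 1
      push_cast
      ring
  filter_upwards [tendsto_two_pow_atTop.eventually (h1.bound hc)] with m hm
  rw [Real.norm_eq_abs, Real.norm_eq_abs, id, abs_of_pos (by positivity : (0 : ℝ) < 2 ^ m)] at hm
  exact (le_abs_self _).trans hm

lemma tendsto_delta {β : ℝ} (hβ : 0 < β) : Tendsto (delta β) atTop (𝓝 0) := by
  have h1 : Tendsto (fun m : ℕ => ((2 : ℝ) ^ m) ^ β) atTop atTop :=
    (tendsto_rpow_atTop hβ).comp tendsto_two_pow_atTop
  exact (tendsto_rpow_atBot_of_base_gt_one 2 one_lt_two).comp (tendsto_neg_atTop_atBot.comp h1)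

end NUHUNCC

end

/-! ### Choice of the constants and proof of the theorem -/

theorem theorem1 :
    ∃ C : ℝ, ∀ (p β t : ℝ), 0 ≤ p → p ≤ 1 → 0 ≤ β → β < 1 / 2 → 1 ≤ t →
    ∀ ℓ : ℕ → ℕ,
    (fun m : ℕ => (NUHUNCC.msgLen p β m : ℝ) ^ (2 / t)) =o[atTop] (fun m : ℕ => (ℓ m : ℝ)) →
    (fun m : ℕ => (ℓ m : ℝ) * (NUHUNCC.msgLen p β m : ℝ))
      =o[atTop] (fun m : ℕ => (2 : ℝ) ^ (((2 : ℝ) ^ m) ^ β)) →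
    ∀ εe εs : ℝ, 0 < εe → 0 < εs →
    ∀ᶠ m : ℕ in atTop, ∀ w ks kw : ℕ, w < ℓ m →
    ks + w + ⌈t * Real.logb 2 (ℓ m : ℝ)⌉₊ ≤ ℓ m → ∀ hk : ks + kw = ℓ m,
    ∃ B : NUHUNCC.Codebook ks kw (ℓ m),
    ∀ (d : ℕ) (σ : ↥(NUHUNCC.midSet p β m) ↪ Fin d),
      (NUHUNCC.errProb hk B σ ≤
          (NUHUNCC.msgLen p β m : ℝ) * (C * (2 : ℝ) ^ (-(ℓ m : ℝ)))
          + √(2 * (NUHUNCC.msgLen p β m : ℝ) * (ℓ m : ℝ) * (2 : ℝ) ^ (-(((2 : ℝ) ^ m) ^ β)))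
          + (ℓ m : ℝ) * (2 : ℝ) ^ (-(((2 : ℝ) ^ m) ^ β)) ∧
        NUHUNCC.errProb hk B σ ≤ εe) ∧
      ∀ W K : Finset (Fin (ℓ m)), W.card = w → K.card = ks →
      ∀ v : ↥K → Fin (2 ^ m) → ZMod 2,
        0 < NUHUNCC.law (NUHUNCC.weight p) (NUHUNCC.secretPart d K) v →
        NUHUNCC.leakage hk B σ W K v ≤
          (NUHUNCC.msgLen p β m : ℝ) * (ℓ m : ℝ) ^ (-(t / 2))
          + 2 * √(2 * (NUHUNCC.msgLen p β m : ℝ) * (ℓ m : ℝ)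
              * (2 : ℝ) ^ (-(((2 : ℝ) ^ m) ^ β))) ∧
        NUHUNCC.leakage hk B σ W K v ≤ εs := by
  -- C = 0, since an injective column encoder has no channel errors.
  refine ⟨0, fun p β t h0 h1 hβ0 hβ ht ℓ hlow hup εe εs hεe hεs => ?_⟩
  -- A deterministic source has ñ = 0: the growth conditions say nothing on ℓ, nothing is sent, and
  -- the identity codebook gives zero error and zero leakage.
  by_cases hp : p = 0 ∨ p = 1
  · refine Eventually.of_forall fun m w ks kw _ _ hk => ?_
    have hN := NUHUNCC.msgLen_eq_zero hp β m
    have hB : Function.Injective (NUHUNCC.chanEnc hk (NUHUNCC.codebookOf hk id)) := by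
      rw [NUHUNCC.chanEnc_codebookOf]; exact Function.injective_id
    refine ⟨NUHUNCC.codebookOf hk id, fun d σ => ?_⟩
    have he := NUHUNCC.errProb_le h0 h1 hk _ hB σ
    rw [Finset.sum_eq_zero fun j _ => NUHUNCC.polarEntropy_eq_zero hp j, mul_zero] at he
    refine ⟨⟨he.trans (by positivity), he.trans hεe.le⟩, fun W K _ _ v hv => ?_⟩
    have hemp : IsEmpty ↥(NUHUNCC.highSet p β m) := by
      rw [Finset.isEmpty_coe_sort, ← Finset.card_eq_zero]
      exact (Nat.add_eq_zero_iff.1 hN).1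
    have hl := NUHUNCC.leakage_le h0 h1 hk _ hB σ W K v hv le_rfl fun j => hemp.elim j
    rw [hN] at hl
    simp only [Nat.cast_zero, mul_zero, zero_mul, Real.sqrt_zero, add_zero] at hl
    exact ⟨hl.trans (by positivity), hl.trans hεs.le⟩
  · have hp0 : 0 < p := lt_of_le_of_ne h0 fun h => hp (Or.inl h.symm)
    have hp1 : p < 1 := lt_of_le_of_ne h1 fun h => hp (Or.inr h)
    have ht0 : 0 < t := by linarith
    rcases hβ0.eq_or_lt with rfl | hβpos
    · -- the hypotheses on `ℓ` are contradictory
      filter_upwards [NUHUNCC.eventually_one_le_msgLen_zero hp0 hp1, hlow.bound one_pos,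
        hup.bound (show (0 : ℝ) < 1 / 4 by norm_num)] with m hm hlo hu
      exfalso
      have hmR : (1 : ℝ) ≤ NUHUNCC.msgLen p 0 m := by exact_mod_cast hm
      have h2 : (1 : ℝ) ≤ (NUHUNCC.msgLen p 0 m : ℝ) ^ (2 / t) :=
        Real.one_le_rpow hmR (by positivity)
      rw [one_mul, Real.norm_of_nonneg (by positivity), Real.norm_of_nonneg (by positivity)] at hlo
      rw [Real.norm_of_nonneg (by positivity), Real.norm_of_nonneg (by positivity),
        Real.rpow_zero, Real.rpow_one] at hu
      -- The first condition gives ℓ ≥ ñ^(2/t) ≥ 1, the second ℓñ ≤ 2/4.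
      nlinarith
    · set c := NUHUNCC.bitEntropy p / 2 with hc
      have hcpos : 0 < c := half_pos (NUHUNCC.bitEntropy_pos hp0 hp1)
      have hN : ∀ᶠ m : ℕ in atTop, c * 2 ^ m ≤ (NUHUNCC.msgLen p β m : ℝ) := by
        filter_upwards [(NUHUNCC.tendsto_delta hβpos).eventually_lt_const hcpos] with m hm
        refine le_trans ?_ (NUHUNCC.bitEntropy_mul_le_msgLen h0 h1 β m)
        rw [mul_comm]
        exact mul_le_mul_of_nonneg_left (by linarith) (by positivity)
      have hNtop : Tendsto (fun m => (NUHUNCC.msgLen p β m : ℝ)) atTop atTop :=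
        tendsto_atTop_mono' _ hN (NUHUNCC.tendsto_two_pow_atTop.const_mul_atTop hcpos)
      have hℓtop : Tendsto ℓ atTop atTop := by
        rw [← tendsto_natCast_atTop_iff (R := ℝ)]
        refine tendsto_atTop_mono' _ ?_
          ((tendsto_rpow_atTop (show 0 < 2 / t by positivity)).comp hNtop)
        filter_upwards [hlow.bound one_pos] with m hm
        rwa [one_mul, Real.norm_of_nonneg (by positivity), Real.norm_of_nonneg (by positivity)]
          at hm
      -- An eventual bound for ℓñδ_n: below 1 for log ℓ ≤ n^β, below 2c² for the error estimate, and
      -- small enough that √(2ñℓδ_n) is at most ε_e and ε_s/4.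
      obtain ⟨c₂, hc₂, hc₂1, hc₂c, hc₂e, hc₂s⟩ : ∃ c₂ : ℝ, 0 < c₂ ∧ c₂ ≤ 1 ∧ c₂ ≤ 2 * c ^ 2 ∧
          2 * c₂ ≤ εe ^ 2 ∧ 2 * c₂ ≤ (εs / 4) ^ 2 :=
        ⟨min 1 (min (2 * c ^ 2) (min (εe ^ 2 / 2) ((εs / 4) ^ 2 / 2))), by positivity,
          min_le_left _ _, (min_le_right _ _).trans (min_le_left _ _), by
            have := ((min_le_right 1 _).trans (min_le_right (2 * c ^ 2) _)).trans
              (min_le_left (εe ^ 2 / 2) ((εs / 4) ^ 2 / 2))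
            linarith, by
            have := ((min_le_right 1 _).trans (min_le_right (2 * c ^ 2) _)).trans
              (min_le_right (εe ^ 2 / 2) ((εs / 4) ^ 2 / 2))
            linarith⟩
      have hD : 0 < 42 + 7 * t := by positivity
      -- The constant (ε_s/2)^(2/t) becomes ñ ≤ (ε_s/2)ℓ^(t/2) after raising to the power t/2.
      filter_upwards [hN, hlow.bound (show 0 < (εs / 2) ^ (2 / t) by positivity), hup.bound hc₂,
        hℓtop.eventually_ge_atTop 1, NUHUNCC.eventually_quadratic_log_le (42 + 7 * t) hℓtop,
        NUHUNCC.eventually_quadratic_rpow_le (42 + 7 * t) (half_pos hcpos) hβ,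
        hNtop.eventually_ge_atTop 1] with m hNm hlo hu hℓ1 hlog hrp hN1 w ks kw _ hw hk
      set N : ℝ := ((NUHUNCC.msgLen p β m : ℕ) : ℝ) with hNdef
      set l : ℝ := (ℓ m : ℝ) with hldef
      have hl1 : 1 ≤ l := by rw [hldef]; exact_mod_cast hℓ1
      have hN0 : 0 < N := by linarith
      have hl0 : 0 < l := by linarith
      rw [Real.norm_of_nonneg (by positivity), Real.norm_of_nonneg (by positivity)] at hlo hu
      have hδ : (2 : ℝ) ^ (-(((2 : ℝ) ^ m) ^ β)) = NUHUNCC.delta β m := rfl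
      rw [hδ]
      set δ := NUHUNCC.delta β m with hδdef
      have hδ0 : 0 < δ := NUHUNCC.delta_pos β m
      have hδinv : δ * (2 : ℝ) ^ (((2 : ℝ) ^ m) ^ β) = 1 := by
        rw [← hδ, ← Real.rpow_add two_pos, neg_add_cancel, Real.rpow_zero]
      have hlNδ : l * N * δ ≤ c₂ := by
        calc l * N * δ ≤ c₂ * (2 : ℝ) ^ (((2 : ℝ) ^ m) ^ β) * δ :=
              mul_le_mul_of_nonneg_right hu hδ0.le
          _ = c₂ := by rw [mul_assoc, mul_comm _ δ, hδinv, mul_one]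
      have hlogle : Real.logb 2 l ≤ ((2 : ℝ) ^ m) ^ β := by
        rw [Real.logb_le_iff_le_rpow one_lt_two hl0]
        calc l ≤ l * N := le_mul_of_one_le_right hl0.le hN1
          _ ≤ _ := hu
          _ ≤ _ := mul_le_of_le_one_left (by positivity) hc₂1
      have hlog0 : 0 ≤ Real.logb 2 l := Real.logb_nonneg one_lt_two hl1
      -- With κ = ñ/2 the root √(2ñκ/2^u) is exactly ñ·2^(-u/2).
      have hκ : (42 + 7 * t) * (Real.logb 2 l ^ 2 + 1) ≤ N / 2 := by
        calc (42 + 7 * t) * (Real.logb 2 l ^ 2 + 1)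
            ≤ (42 + 7 * t) * ((((2 : ℝ) ^ m) ^ β) ^ 2 + 1) := by gcongr
          _ ≤ _ := hrp
          _ ≤ N / 2 := by linarith
      obtain ⟨B, hB, hkl⟩ := NUHUNCC.exists_codebook hℓ1 ht hlog hκ hw hk
      have hsq : √(2 * N * l * δ) ≤ √(2 * c₂) := Real.sqrt_le_sqrt (by nlinarith)
      refine ⟨B, fun d σ => ?_⟩
      -- The root alone absorbs the decoding error: (ℓnδ)² ≤ 2ñℓδ amounts to ℓn²δ ≤ 2ñ, which
      -- follows from cn ≤ ñ and ℓñδ ≤ 2c².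
      have herr : NUHUNCC.errProb hk B σ ≤ √(2 * N * l * δ) := by
        refine (NUHUNCC.errProb_le h0 h1 hk B hB σ).trans ?_
        refine (mul_le_mul_of_nonneg_left (NUHUNCC.sum_lowSet_le p β m) hl0.le).trans ?_
        refine Real.le_sqrt_of_sq_le ?_
        have hn : (0 : ℝ) < 2 ^ m := by positivity
        have h3 : c ^ 2 * (2 ^ m) ^ 2 ≤ N ^ 2 := by
          rw [← mul_pow]; exact pow_le_pow_left₀ (by positivity) hNm 2
        have h4 : l * (2 ^ m) ^ 2 * δ ≤ 2 * N := by
          have h5 : c ^ 2 * (l * (2 ^ m) ^ 2 * δ) ≤ c ^ 2 * (2 * N) := by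
            calc c ^ 2 * (l * (2 ^ m) ^ 2 * δ) = (c ^ 2 * (2 ^ m) ^ 2) * (l * δ) := by ring
              _ ≤ N ^ 2 * (l * δ) := mul_le_mul_of_nonneg_right h3 (by positivity)
              _ = (l * N * δ) * N := by ring
              _ ≤ (2 * c ^ 2) * N := mul_le_mul_of_nonneg_right (hlNδ.trans hc₂c) hN0.le
              _ = _ := by ring
          exact le_of_mul_le_mul_left h5 (by positivity)
        calc (l * (2 ^ m * δ)) ^ 2 = (l * (2 ^ m) ^ 2 * δ) * (l * δ) := by ring
          _ ≤ (2 * N) * (l * δ) := mul_le_mul_of_nonneg_right h4 (by positivity)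
          _ = _ := by ring
      refine ⟨⟨?_, ?_⟩, fun W K hW hK v hv => ?_⟩
      · have : 0 ≤ l * δ := by positivity
        linarith
      · refine herr.trans (hsq.trans ?_)
        rw [Real.sqrt_le_left hεe.le]
        exact hc₂e
      · have hpow : l ^ t ≤ 2 ^ ⌈t * Real.logb 2 l⌉₊ := by
          rw [← Real.rpow_natCast]
          calc l ^ t = ((2 : ℝ) ^ Real.logb 2 l) ^ t := by
                rw [Real.rpow_logb two_pos (by norm_num) hl0]
            _ = 2 ^ (t * Real.logb 2 l) := by rw [← Real.rpow_mul two_pos.le, mul_comm]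
            _ ≤ _ := Real.rpow_le_rpow_of_exponent_le one_le_two (Nat.le_ceil _)
        have hleak := NUHUNCC.leakage_le h0 h1 hk B hB σ W K v hv
          (by positivity : 0 ≤ N / 2 / 2 ^ ⌈t * Real.logb 2 l⌉₊) fun _ a => hkl W K hW hK a
        have hfirst : √(2 * N * (N / 2 / 2 ^ ⌈t * Real.logb 2 l⌉₊)) ≤ N * l ^ (-(t / 2)) := by
          rw [Real.sqrt_le_left (by positivity), mul_pow, ← Real.rpow_natCast (l ^ _),
            ← Real.rpow_mul hl0.le]
          have e : -(t / 2) * ((2 : ℕ) : ℝ) = -t := by push_cast; ring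
          rw [e, Real.rpow_neg hl0.le]
          calc 2 * N * (N / 2 / 2 ^ ⌈t * Real.logb 2 l⌉₊)
              = N ^ 2 * (2 ^ ⌈t * Real.logb 2 l⌉₊)⁻¹ := by field_simp
            _ ≤ _ := by gcongr
        have hb : NUHUNCC.leakage hk B σ W K v
            ≤ N * l ^ (-(t / 2)) + 2 * √(2 * N * l * δ) := by
          linarith
        refine ⟨hb, hb.trans ?_⟩
        have hN2 : N ≤ εs / 2 * l ^ (t / 2) := by
          have h5 := Real.rpow_le_rpow (by positivity) hlo (show 0 ≤ t / 2 by positivity)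
          rw [Real.mul_rpow (by positivity) hl0.le, ← Real.rpow_mul hN0.le,
            ← Real.rpow_mul (by positivity)] at h5
          have e : 2 / t * (t / 2) = 1 := by field_simp
          rwa [e, Real.rpow_one, Real.rpow_one] at h5
        have h6 : N * l ^ (-(t / 2)) ≤ εs / 2 := by
          calc N * l ^ (-(t / 2)) ≤ εs / 2 * l ^ (t / 2) * l ^ (-(t / 2)) :=
                mul_le_mul_of_nonneg_right hN2 (by positivity)
            _ = εs / 2 := by
                rw [mul_assoc, ← Real.rpow_add hl0, add_neg_cancel, Real.rpow_zero, mul_one]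
        have h7 : √(2 * N * l * δ) ≤ εs / 4 := by
          refine hsq.trans ?_
          rw [Real.sqrt_le_left (by positivity)]
          exact hc₂s
        linarith
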